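/- Let $d\ge 1$ and let $\Omega\subset\mathbb R^d$ be a bounded connected open polyhedral set (its boundary is contained in a finite union of hyperplanes). Let $\gamma$ be the $(d-1)$-dimensional Lebesgue measure on hyperplanes. **Discretisations.** A discretisation $\mathcal D=(\mathcal M,\mathcal E,\mathcal P)$ of $\Omega$ consists of * a finite family $\mathcal M$ of disjoint nonempty connected open sets $K\subset\Omega$ with $\overline\Omega=\bigcup_{K\in\mathcal M}\overline K$; * a finite family $\mathcal E$ of disjoint sets $\sigma\subset\overline\Omega$, each a nonempty relatively open subset of a hyperplane with $|\sigma|=\gamma(\sigma)>0$ and with $\gamma$-negligible relative boundary $\overline\sigma\setminus\sigma$, and for each $K$ a subset $\mathcal E_K\subset\mathcal E$ with $\partial K=\bigcup_{\sigma\in\mathcal E_K}\overline\sigma$, such that for each $\sigma$ the set $\mathcal M_\sigma=\{K:\sigma\in\mathcal E_K\}$ either has one element, and then $\sigma\subset\partial\Omega$ ($\sigma\in\mathcal E_{\rm ext}$), or has two elements ($\sigma\in\mathcal E_{\rm int}$); * points $x_K\in K$ such that $K$ is star-shaped with respect to $x_K$ and such that, for $\sigma\in\mathcal E_K$, the distance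 $d_{K,\sigma}$ from $x_K$ to the hyperplane containing $\sigma$ is positive. Let $|K|$ and $h_K$ be the volume and the diameter of $K$, $h_{\mathcal D}=\max_K h_K$, $x_\sigma$ the barycentre of $\sigma$, $n_{K,\sigma}$ the unit normal to $\sigma$ outward to $K$, and $D_{K,\sigma}$ the cone with vertex $x_K$ and basis $\sigma$. Let $\mathcal B\subset\mathcal E_{\rm int}$ and $(\beta_\sigma^K)_{\sigma\in\mathcal B,K\in\mathcal M}$ be real numbers with $\sum_K\beta_\sigma^K=1$ and $\sum_K\beta_\sigma^K x_K=x_\sigma$ for $\sigma\in\mathcal B$, and let $\theta_{\mathcal D,\mathcal B}$ be the maximum of $$\frac{d_{K,\sigma}}{d_{L,\sigma}}\ (\sigma\in\mathcal E_{\rm int},\,K,L\in\mathcal M_\sigma),\qquad \frac{h_K}{d_{K,\sigma}}\ (\sigma\in\mathcal E_K),\qquad \frac{\sum_L|\beta_\sigma^L|\,|x_L-x_\sigma|^2}{h_K^2}\ (\sigma\in\mathcal E_K\cap\mathcal B).$$ **Discrete spaces and operators.** Let $X_{\mathcal D}$ be the space of all $v=((v_K)_{K\in\mathcal M},(v_\sigma)_{\sigma\in\mathcal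 E})$ with real entries, and $X_{\mathcal D,\mathcal B}$ the subspace of those $v$ with $v_\sigma=0$ for $\sigma\in\mathcal E_{\rm ext}$ and $v_\sigma=\sum_K\beta_\sigma^Kv_K$ for $\sigma\in\mathcal B$. Put $|v|_X^2=\sum_K\sum_{\sigma\in\mathcal E_K}\frac{|\sigma|}{d_{K,\sigma}}(v_\sigma-v_K)^2$. Let $\Pi_{\mathcal M}v=v_K$ on $K$, and $P_{\mathcal M}\varphi=\varphi(x_K)$ on $K$. Let $P_{\mathcal D,\mathcal B}\varphi\in X_{\mathcal D,\mathcal B}$ have the values $\varphi(x_K)$ on $K$, $0$ on $\mathcal E_{\rm ext}$, $\sum_K\beta_\sigma^K\varphi(x_K)$ on $\sigma\in\mathcal B$, and $\varphi(x_\sigma)$ on $\sigma\in\mathcal E_{\rm int}\setminus\mathcal B$. The discrete gradient is $\nabla_{\mathcal D}v=\nabla_Kv+R_{K,\sigma}v\;n_{K,\sigma}$ on $D_{K,\sigma}$, where $$\nabla_Kv=\frac1{|K|}\sum_{\sigma\in\mathcal E_K}|\sigma|(v_\sigma-v_K)n_{K,\sigma},\qquad R_{K,\sigma}v=\frac{\sqrt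 d}{d_{K,\sigma}}\bigl(v_\sigma-v_K-\nabla_Kv\cdot(x_\sigma-x_K)\bigr).$$ For linear maps $F_{K,\sigma}:X_{\mathcal D}\to\mathbb R$ put $\langle v,w\rangle_F=\sum_K\sum_{\sigma\in\mathcal E_K}F_{K,\sigma}(v)(w_K-w_\sigma)$. The scheme is: find $u_{\mathcal D}\in X_{\mathcal D,\mathcal B}$ with $$\langle u_{\mathcal D},v\rangle_F=\sum_Kv_K\int_Kf\,dx\qquad\text{for all }v\in X_{\mathcal D,\mathcal B}.$$ The SUSHI fluxes (for $\Lambda=\mathrm{Id}$) are $F_{K,\sigma}(v)=\sum_{\sigma'\in\mathcal E_K}A_K^{\sigma\sigma'}(v_K-v_{\sigma'})$ with $A_K^{\sigma\sigma'}=\sum_{\sigma''\in\mathcal E_K}|D_{K,\sigma''}|\,y^{\sigma''\sigma}\cdot y^{\sigma''\sigma'}$, where $$y^{\sigma\sigma}=\frac{|\sigma|}{|K|}n_{K,\sigma}+\frac{\sqrt d}{d_{K,\sigma}}\Bigl(1-\frac{|\sigma|}{|K|}n_{K,\sigma}\cdot(x_\sigma-x_K)\Bigr)n_{K,\sigma},$$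 $$y^{\sigma\sigma'}=\frac{|\sigma'|}{|K|}n_{K,\sigma'}-\frac{\sqrt d\,|\sigma'|}{d_{K,\sigma}|K|}\bigl(n_{K,\sigma'}\cdot(x_\sigma-x_K)\bigr)n_{K,\sigma}\qquad(\sigma\ne\sigma').$$ **Theorem.** Let $f\in L^2(\Omega)$ and let $u\in H^1_0(\Omega)$ be the weak solution of $-\Delta u=f$, that is, $\int_\Omega\nabla u\cdot\nabla v=\int_\Omega fv$ for all $v\in H^1_0(\Omega)$. Assume that $u\in C^2(\overline\Omega)$, that is, $u$ is the restriction of a $C^2$ function on $\mathbb R^d$, again denoted by $u$. Let $\alpha>0$ and $\theta\in\mathbb R$. For every discretisation $\mathcal D$ with $\mathcal B$ and $\beta$ as above and $\theta_{\mathcal D,\mathcal B}\le\theta$, and every family $F$ of linear maps with $\alpha|v|_X^2\le\langle v,v\rangle_F$ for all $v\in X_{\mathcal D}$, the scheme has a unique solution $u_{\mathcal D}$. With $$E(u)=\Bigl(\sum_{K\in\mathcal M}\sum_{\sigma\in\mathcal E_K}\frac{d_{K,\sigma}}{|\sigma|}\Bigl(F_{K,\sigma}(P_{\mathcal D,\mathcal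 B}u)+\int_\sigma\nabla u\cdot n_{K,\sigma}\,d\gamma\Bigr)^2\Bigr)^{1/2},$$ it satisfies: 1. $\|\Pi_{\mathcal M}u_{\mathcal D}-P_{\mathcal M}u\|_{L^2(\Omega)}\le C_1E(u)$, where $C_1$ depends only on $d,\Omega,\alpha,\theta$; 2. $\|\nabla_{\mathcal D}u_{\mathcal D}-\nabla u\|_{L^2(\Omega)^d}\le C_2(E(u)+h_{\mathcal D})$, where $C_2$ depends only on $d,\Omega,\alpha,\theta,u$. For the SUSHI fluxes there is a constant $C_3$ depending only on $d,\Omega,\theta,u$ such that, whenever $\theta_{\mathcal D,\mathcal B}\le\theta$, 3. $E(u)\le C_3h_{\mathcal D}$; moreover the scheme has a unique solution, and $\|\Pi_{\mathcal M}u_{\mathcal D}-P_{\mathcal M}u\|_{L^2(\Omega)}\le C_3h_{\mathcal D}$ and $\|\nabla_{\mathcal D}u_{\mathcal D}-\nabla u\|_{L^2(\Omega)^d}\le C_3h_{\mathcal D}$. -/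

import Mathlib

open MeasureTheory Filter Topology
open scoped ContDiff RealInnerProductSpace Gradient

noncomputable section

/-- The Euclidean space `ℝ^d`. -/
abbrev Pt (d : ℕ) : Type := EuclideanSpace ℝ (Fin d)

/-- The `(d-1)`-dimensional measure `γ` on `ℝ^d` (`d ≥ 1`), normalised so that it agrees with the
Lebesgue measure on hyperplanes (the counting measure if `d = 1`). -/
abbrev surf (d : ℕ) : Measure (Pt d) := μHE[d - 1]

/-- Affine hyperplanes of `ℝ^d`. -/
def IsHyperplane {d : ℕ} (H : Set (Pt d)) : Prop :=
  ∃ (n : Pt d) (c : ℝ), n ≠ 0 ∧ H = {x | ⟪n, x⟫ = c}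

/-- A set is polyhedral if its boundary is a finite union of parts of hyperplanes. -/
def IsPolyhedral {d : ℕ} (S : Set (Pt d)) : Prop :=
  ∃ 𝓗 : Set (Set (Pt d)), 𝓗.Finite ∧ (∀ H ∈ 𝓗, IsHyperplane H) ∧ frontier S ⊆ ⋃₀ 𝓗

/-- `n` is the unit vector normal to `σ` and outward to `K` (where `σ` is a relatively open subset
of a hyperplane, contained in the boundary of `K`). -/
structure IsOutwardUnitNormal {d : ℕ} (K σ : Set (Pt d)) (n : Pt d) : Prop where
  norm_eq : ‖n‖ = 1
  orthogonal : ∀ x ∈ σ, ∀ y ∈ σ, ⟪n, x - y⟫ = 0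
  outward : ∀ y ∈ σ, ∀ᶠ t in 𝓝[>] (0 : ℝ), y - t • n ∈ K ∧ y + t • n ∉ K

/-- Space discretisations `(M, E, P)` of `Ω`: control volumes, edges and points. -/
structure Discretisation {d : ℕ} (Ω : Set (Pt d)) where
  /-- index set of the control volumes -/
  Cell : Type
  /-- index set of the edges -/
  Edge : Type
  cellFintype : Fintype Cell
  edgeFintype : Fintype Edge
  edgeDecidableEq : DecidableEq Edge
  /-- the control volumes `K` -/
  cell : Cell → Set (Pt d)
  cell_open : ∀ K, IsOpen (cell K)
  cell_connected : ∀ K, IsConnected (cell K)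
  cell_subset : ∀ K, cell K ⊆ Ω
  cell_disjoint : Pairwise fun K L => Disjoint (cell K) (cell L)
  closure_eq : closure Ω = ⋃ K, closure (cell K)
  /-- the edges `σ` -/
  edge : Edge → Set (Pt d)
  /-- the hyperplane including `σ` -/
  plane : Edge → Set (Pt d)
  plane_isHyperplane : ∀ σ, IsHyperplane (plane σ)
  edge_open : ∀ σ, ∃ U, IsOpen U ∧ edge σ = U ∩ plane σ
  edge_nonempty : ∀ σ, (edge σ).Nonempty
  edge_subset : ∀ σ, edge σ ⊆ closure Ω
  edge_disjoint : Pairwise fun σ τ => Disjoint (edge σ) (edge τ)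
  edge_measure_pos : ∀ σ, 0 < surf d (edge σ)
  /-- Edges are polyhedral pieces of their hyperplane; all that is required of this is that the
  relative boundary of `σ` is negligible. -/
  edge_boundary_null : ∀ σ, surf d (closure (edge σ) \ edge σ) = 0
  /-- the set `E_K` of the edges of `K` -/
  edgesOf : Cell → Finset Edge
  frontier_eq : ∀ K, frontier (cell K) = ⋃ σ ∈ edgesOf K, closure (edge σ)
  /-- An edge belongs to exactly one control volume, and then lies on the boundary of `Ω`, or to
  exactly two. -/
  edge_cells : ∀ σ,
    (Nat.card {K // σ ∈ edgesOf K} = 1 ∧ edge σ ⊆ frontier Ω) ∨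
      Nat.card {K // σ ∈ edgesOf K} = 2
  /-- the vectors `n_{K,σ}` -/
  normal : Cell → Edge → Pt d
  normal_spec : ∀ K, ∀ σ ∈ edgesOf K, IsOutwardUnitNormal (cell K) (edge σ) (normal K σ)
  /-- the points `x_K` -/
  center : Cell → Pt d
  center_mem : ∀ K, center K ∈ cell K
  cell_starShaped : ∀ K, StarConvex ℝ (center K) (cell K)
  dist_pos : ∀ K, ∀ σ ∈ edgesOf K, 0 < Metric.infDist (center K) (plane σ)

attribute [instance] Discretisation.cellFintype Discretisation.edgeFintype
  Discretisation.edgeDecidableEq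

namespace Discretisation

variable {d : ℕ} {Ω : Set (Pt d)} (D : Discretisation Ω)

/-- The set `M_σ` of the control volumes with edge `σ`. -/
def cellsOf (σ : D.Edge) : Finset D.Cell := Finset.univ.filter fun K => σ ∈ D.edgesOf K

/-- The boundary edges `E_ext`. -/
def extEdges : Finset D.Edge := Finset.univ.filter fun σ => (D.cellsOf σ).card = 1

/-- The interior edges `E_int`. -/
def intEdges : Finset D.Edge := Finset.univ.filter fun σ => (D.cellsOf σ).card = 2

/-- The measure `|K|`. -/
def vol (K : D.Cell) : ℝ := volume.real (D.cell K)

/-- The diameter `h_K`. -/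
def diam (K : D.Cell) : ℝ := Metric.diam (D.cell K)

/-- The measure `|σ|`. -/
def area (σ : D.Edge) : ℝ := (surf d).real (D.edge σ)

/-- The barycentre `x_σ`. -/
def bary (σ : D.Edge) : Pt d := ⨍ x in D.edge σ, x ∂(surf d)

/-- The distance `d_{K,σ}` from `x_K` to the hyperplane including `σ`. -/
def dist (K : D.Cell) (σ : D.Edge) : ℝ := Metric.infDist (D.center K) (D.plane σ)

/-- The (open) cone `D_{K,σ}` with vertex `x_K` and basis `σ`. -/
def cone (K : D.Cell) (σ : D.Edge) : Set (Pt d) :=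
  {x | ∃ y ∈ D.edge σ, ∃ t ∈ Set.Ioo (0 : ℝ) 1, x = D.center K + t • (y - D.center K)}

/-- The size `h_D` of the discretisation. -/
def size : ℝ := ⨆ K, D.diam K

/-- The regularity `θ_D` of the mesh. -/
def reg : ℝ :=
  max
    (sSup {r | ∃ σ ∈ D.intEdges, ∃ K ∈ D.cellsOf σ, ∃ L ∈ D.cellsOf σ, r = D.dist K σ / D.dist L σ})
    (sSup {r | ∃ K, ∃ σ ∈ D.edgesOf K, r = D.diam K / D.dist K σ})

/-- The regularity `θ_{D,B}`, for a set `B` of interior edges and coefficients `β_σ^K`. -/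
def regB (B : Finset D.Edge) (β : D.Edge → D.Cell → ℝ) : ℝ :=
  max D.reg
    (sSup {r | ∃ K, ∃ σ ∈ D.edgesOf K, σ ∈ B ∧
      r = (∑ L, |β σ L| * ‖D.center L - D.bary σ‖ ^ 2) / D.diam K ^ 2})

/-- The coefficients `β` express the barycentres of the edges in `B` as barycentric combinations
of the points `x_K`. -/
def IsBarycentric (B : Finset D.Edge) (β : D.Edge → D.Cell → ℝ) : Prop :=
  ∀ σ ∈ B, ∑ K, β σ K = 1 ∧ D.bary σ = ∑ K, β σ K • D.center K

/-- The space `X_D` of the discrete unknowns `((v_K)_K, (v_σ)_σ)`. -/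
abbrev X : Type := (D.Cell → ℝ) × (D.Edge → ℝ)

/-- Membership in the space `X_{D,B}`. -/
def MemXB (B : Finset D.Edge) (β : D.Edge → D.Cell → ℝ) (v : D.X) : Prop :=
  (∀ σ ∈ D.extEdges, v.2 σ = 0) ∧ ∀ σ ∈ B, v.2 σ = ∑ K, β σ K * v.1 K

/-- The square of the seminorm `|v|_X`. -/
def seminormSq (v : D.X) : ℝ :=
  ∑ K, ∑ σ ∈ D.edgesOf K, D.area σ / D.dist K σ * (v.2 σ - v.1 K) ^ 2

/-- Families `(F_{K,σ})` of linear mappings from `X_D` to `ℝ`. -/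
abbrev Fluxes : Type := D.Cell → D.Edge → D.X →ₗ[ℝ] ℝ

/-- The bilinear form `⟨u, v⟩_F`. -/
def form (F : D.Fluxes) (u v : D.X) : ℝ :=
  ∑ K, ∑ σ ∈ D.edgesOf K, F K σ u * (v.1 K - v.2 σ)

/-- Coercivity of the fluxes `F` with constant `α`. -/
def IsCoercive (F : D.Fluxes) (α : ℝ) : Prop :=
  ∀ v : D.X, α * D.seminormSq v ≤ D.form F v v

/-- `w` is a solution of the scheme with fluxes `F` and right-hand side `f`. -/
def IsSchemeSolution (B : Finset D.Edge) (β : D.Edge → D.Cell → ℝ) (F : D.Fluxes) (f : Pt d → ℝ)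
    (w : D.X) : Prop :=
  D.MemXB B β w ∧
    ∀ v, D.MemXB B β v → D.form F w v = ∑ K, v.1 K * ∫ x in D.cell K, f x

/-- The piecewise constant function `Π_M v`. -/
def piM (v : D.X) (x : Pt d) : ℝ := ∑ K, (D.cell K).indicator (fun _ => v.1 K) x

/-- The piecewise constant function `P_M φ`, equal to `φ(x_K)` on `K`. -/
def projM (φ : Pt d → ℝ) (x : Pt d) : ℝ :=
  ∑ K, (D.cell K).indicator (fun _ => φ (D.center K)) x

/-- The interpolate `P_{D,B} φ`. -/
def interpB (B : Finset D.Edge) (β : D.Edge → D.Cell → ℝ) (φ : Pt d → ℝ) : D.X :=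
  (fun K => φ (D.center K),
   fun σ => if σ ∈ D.extEdges then 0
    else if σ ∈ B then ∑ K, β σ K * φ (D.center K)
    else φ (D.bary σ))

/-- The cell gradient `∇_K v`. -/
def gradK (v : D.X) (K : D.Cell) : Pt d :=
  (D.vol K)⁻¹ • ∑ σ ∈ D.edgesOf K, (D.area σ * (v.2 σ - v.1 K)) • D.normal K σ

/-- The stabilisation `R_{K,σ} v`. -/
def stab (v : D.X) (K : D.Cell) (σ : D.Edge) : ℝ :=
  Real.sqrt d / D.dist K σ *
    (v.2 σ - v.1 K - ⟪D.gradK v K, D.bary σ - D.center K⟫)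

/-- The stabilised gradient `∇_{K,σ} v`. -/
def gradKσ (v : D.X) (K : D.Cell) (σ : D.Edge) : Pt d :=
  D.gradK v K + D.stab v K σ • D.normal K σ

/-- The discrete gradient `∇_D v`, equal to `∇_{K,σ} v` on `D_{K,σ}`. -/
def gradD (v : D.X) (x : Pt d) : Pt d :=
  ∑ K, ∑ σ ∈ D.edgesOf K, (D.cone K σ).indicator (fun _ => D.gradKσ v K σ) x

/-- The vectors `y^{σσ'}` (relative to the control volume `K`). -/
def yvec (K : D.Cell) (σ σ' : D.Edge) : Pt d :=
  if σ = σ' then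
    (D.area σ / D.vol K) • D.normal K σ +
      (Real.sqrt d / D.dist K σ *
        (1 - D.area σ / D.vol K * ⟪D.normal K σ, D.bary σ - D.center K⟫)) • D.normal K σ
  else
    (D.area σ' / D.vol K) • D.normal K σ' -
      (Real.sqrt d / (D.dist K σ * D.vol K) * D.area σ' *
        ⟪D.normal K σ', D.bary σ - D.center K⟫) • D.normal K σ

/-- The local matrices `A_K^{σσ'}` for the diffusion field `Λ`. -/
def localMatrix (Λ : Pt d → Pt d →L[ℝ] Pt d) (K : D.Cell) (σ σ' : D.Edge) : ℝ :=
  ∑ τ ∈ D.edgesOf K, ⟪D.yvec K τ σ, (∫ x in D.cone K τ, Λ x) (D.yvec K τ σ')⟫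

/-- The SUSHI fluxes `F_{K,σ}(u) = ∑_{σ'} A_K^{σσ'} (u_K - u_{σ'})`. -/
def sushiFlux (Λ : Pt d → Pt d →L[ℝ] Pt d) : D.Fluxes := fun K σ =>
  ∑ σ' ∈ D.edgesOf K, D.localMatrix Λ K σ σ' •
    ((LinearMap.proj K).comp (LinearMap.fst ℝ (D.Cell → ℝ) (D.Edge → ℝ)) -
      (LinearMap.proj σ').comp (LinearMap.snd ℝ (D.Cell → ℝ) (D.Edge → ℝ)))

/-- The flux consistency error `E(u)` (for `Λ = Id`). -/
def consErr (B : Finset D.Edge) (β : D.Edge → D.Cell → ℝ) (F : D.Fluxes) (u : Pt d → ℝ) : ℝ :=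
  Real.sqrt (∑ K, ∑ σ ∈ D.edgesOf K, D.dist K σ / D.area σ *
    (F K σ (D.interpB B β u) + ∫ x in D.edge σ, ⟪∇ u x, D.normal K σ⟫ ∂(surf d)) ^ 2)

end Discretisation

/-- The norm of `L²(Ω)` or `L²(Ω)^d`, with values in `[0, ∞]`. -/
def normL2 {d : ℕ} {V : Type*} [NormedAddCommGroup V] (Ω : Set (Pt d)) (g : Pt d → V) : ENNReal :=
  eLpNorm g 2 (volume.restrict Ω)

/-- `v` belongs to `H¹₀(Ω)`, the closure of `C_c^∞(Ω)` in `H¹(Ω)`, and its weak gradient is `G`. -/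
structure HasH10Gradient {d : ℕ} (Ω : Set (Pt d)) (v : Pt d → ℝ) (G : Pt d → Pt d) : Prop where
  memLp : MemLp v 2 (volume.restrict Ω)
  memLp_grad : MemLp G 2 (volume.restrict Ω)
  approx : ∃ φ : ℕ → Pt d → ℝ,
    (∀ k, ContDiff ℝ ∞ (φ k) ∧ HasCompactSupport (φ k) ∧ tsupport (φ k) ⊆ Ω) ∧
    Tendsto (fun k => normL2 Ω (φ k - v)) atTop (𝓝 0) ∧
    Tendsto (fun k => normL2 Ω (∇ (φ k) - G)) atTop (𝓝 0)

/-- `u` is the weak solution of `-div(Λ ∇u) = f` in `Ω`, `u = 0` on the boundary. -/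
def IsWeakSolution {d : ℕ} (Ω : Set (Pt d)) (Λ : Pt d → Pt d →L[ℝ] Pt d) (f u : Pt d → ℝ) : Prop :=
  ∃ G, HasH10Gradient Ω u G ∧ ∀ v H, HasH10Gradient Ω v H →
    ∫ x in Ω, ⟪Λ x (G x), H x⟫ = ∫ x in Ω, f x * v x

/-- The constant diffusion field `Λ = Id`. -/
def idField (d : ℕ) : Pt d → Pt d →L[ℝ] Pt d := fun _ => ContinuousLinearMap.id ℝ (Pt d)

end

/-!
Testing a discrete function `v` against `-Δu = f` and applying the divergence theorem in every cell
turns the scheme into an identity for `e = u_D - P u`: since `v` vanishes on the exterior edges and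
the fluxes of `∇ u` through the two sides of an interior edge cancel, `⟨e, v⟩` only involves the
flux errors measured by `E(u)`. With `v = e` and Cauchy–Schwarz, coercivity gives
`|e|_X ≤ E(u) / α`, and a discrete Poincaré inequality converts this into the `L²` estimate. The
gradient estimate combines the stability of `∇_D` in the seminorm `|·|_X` with the first-order
consistency of `∇_D (P u)`, which is a Taylor expansion based on the exactness of `∇_K` on affine
functions. For the SUSHI fluxes `⟨v, w⟩ = ∫ ∇_D v · ∇_D w`; coercivity holds because `∇_K v` and the
stabilisation `R_σ v n_σ` are orthogonal in `L²(K)`, and consistency to order `h` because `R_σ`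
vanishes on affine functions.
-/

noncomputable section

open scoped Laplacian

/-! ### Cones -/

/-- The open cone with vertex `c` and basis `σ`; the vertex and the basis itself are left out. -/
def coneOver {V : Type*} [AddCommGroup V] [Module ℝ V] (c : V) (σ : Set V) : Set V :=
  {x | ∃ y ∈ σ, ∃ t ∈ Set.Ioo (0 : ℝ) 1, x = c + t • (y - c)}

section Cone

variable {E : Type*} [NormedAddCommGroup E] [InnerProductSpace ℝ E] {c n : E} {δ : ℝ} {σ : Set E}

theorem isBounded_coneOver (hσ : Bornology.IsBounded σ) : Bornology.IsBounded (coneOver c σ) := by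
  obtain ⟨R, hR⟩ := hσ.subset_closedBall c
  refine Metric.isBounded_closedBall.subset (t := Metric.closedBall c R) ?_
  rintro _ ⟨y, hy, t, ht, rfl⟩
  have hyR := hR hy
  rw [Metric.mem_closedBall, dist_eq_norm] at hyR ⊢
  rw [add_sub_cancel_left, norm_smul, Real.norm_of_nonneg ht.1.le]
  exact (mul_le_of_le_one_left (norm_nonneg _) ht.2.le).trans hyR

theorem coneOver_eq (hδ : 0 < δ) (hσ : ∀ y ∈ σ, ⟪n, y - c⟫ = δ) :
    coneOver c σ = {x | ⟪n, x - c⟫ ∈ Set.Ioo 0 δ} ∩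
      (fun x => c + (δ / ⟪n, x - c⟫) • (x - c)) ⁻¹' σ := by
  ext x
  constructor
  · rintro ⟨y, hy, t, ⟨ht0, ht1⟩, rfl⟩
    have height : ⟪n, c + t • (y - c) - c⟫ = t * δ := by
      rw [add_sub_cancel_left, inner_smul_right, hσ y hy]
    refine ⟨?_, ?_⟩
    · rw [Set.mem_ofPred_eq, height]
      exact ⟨by positivity, mul_lt_of_lt_one_left hδ ht1⟩
    · rw [Set.mem_preimage, height, add_sub_cancel_left, smul_smul,
        show δ / (t * δ) * t = 1 by field_simp, one_smul, add_sub_cancel]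
      exact hy
  · rintro ⟨⟨h0, h1⟩, hx⟩
    refine ⟨_, hx, ⟪n, x - c⟫ / δ, ⟨by positivity, by rwa [div_lt_one hδ]⟩, ?_⟩
    rw [add_sub_cancel_left, smul_smul,
      show ⟪n, x - c⟫ / δ * (δ / ⟪n, x - c⟫) = 1 by field_simp, one_smul, add_sub_cancel]

theorem isOpen_coneOver (hδ : 0 < δ) {U : Set E} (hU : IsOpen U)
    (hσU : σ = U ∩ {y | ⟪n, y - c⟫ = δ}) : IsOpen (coneOver c σ) := by
  subst hσU
  have cone_eq : coneOver c (U ∩ {y | ⟪n, y - c⟫ = δ}) =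
      {x | ⟪n, x - c⟫ ∈ Set.Ioo 0 δ} ∩ (fun x => c + (δ / ⟪n, x - c⟫) • (x - c)) ⁻¹' U := by
    rw [coneOver_eq hδ fun y hy => hy.2]
    ext x
    refine and_congr_right fun hx => and_iff_left ?_
    have := hx.1.ne'
    simp only [Set.mem_ofPred_eq, add_sub_cancel_left, inner_smul_right]
    field_simp
  rw [cone_eq]
  have slab_open : IsOpen {x : E | ⟪n, x - c⟫ ∈ Set.Ioo 0 δ} :=
    isOpen_Ioo.preimage (by fun_prop : Continuous fun x : E => ⟪n, x - c⟫)
  refine ContinuousOn.isOpen_inter_preimage ?_ slab_open hU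
  have height_inv : ContinuousOn (fun x : E => δ / ⟪n, x - c⟫) {x | ⟪n, x - c⟫ ∈ Set.Ioo 0 δ} :=
    continuousOn_const.div (by fun_prop) fun x hx => hx.1.ne'
  exact continuousOn_const.add (height_inv.smul (by fun_prop))

theorem inter_coneOver_inter_plane (hδ : 0 < δ) (hσ : ∀ y ∈ σ, ⟪n, y - c⟫ = δ) (A : Set E)
    {t : ℝ} (ht : t ∈ Set.Ioo (0 : ℝ) 1) :
    A ∩ coneOver c σ ∩ {x | ⟪n, x - c⟫ = δ * t} =
      AffineMap.homothety c t '' (σ ∩ (fun y => c + t • (y - c)) ⁻¹' A) := by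
  ext x
  simp only [Set.mem_inter_iff, Set.mem_ofPred_eq, Set.mem_image, Set.mem_preimage,
    AffineMap.homothety_apply, vsub_eq_sub, vadd_eq_add]
  constructor
  · rintro ⟨⟨hA, y, hy, s, -, rfl⟩, hx⟩
    rw [add_sub_cancel_left, inner_smul_right, hσ y hy, mul_comm] at hx
    obtain rfl : s = t := mul_left_cancel₀ hδ.ne' hx
    exact ⟨y, ⟨hy, hA⟩, add_comm _ _⟩
  · rintro ⟨y, ⟨hy, hA⟩, rfl⟩
    refine ⟨⟨by rwa [add_comm], y, hy, t, ht, add_comm _ _⟩, ?_⟩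
    rw [add_sub_cancel_right, inner_smul_right, hσ y hy, mul_comm]

section Measurable

variable [MeasurableSpace E] [BorelSpace E] [FiniteDimensional ℝ E]

theorem measurableSet_coneOver (hδ : 0 < δ) (hσ : ∀ y ∈ σ, ⟪n, y - c⟫ = δ)
    (hσm : MeasurableSet σ) : MeasurableSet (coneOver c σ) := by
  rw [coneOver_eq hδ hσ]
  have height : Measurable fun x : E => ⟪n, x - c⟫ := by fun_prop
  have proj : Measurable fun x : E => c + (δ / ⟪n, x - c⟫) • (x - c) := by
    have := measurable_const (a := δ) |>.div height
    fun_prop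
  exact (height measurableSet_Ioo).inter (proj hσm)

theorem volume_eq_lintegral_plane (hn : ‖n‖ = 1) (c : E) {A : Set E} (hA : MeasurableSet A) :
    volume A = ∫⁻ s : ℝ, μHE[Module.finrank ℝ E - 1] (A ∩ {x | ⟪n, x - c⟫ = s}) := by
  have plane_eq (s : ℝ) : ((AffineSubspace.mk' (s • n +ᵥ c) (Submodule.span ℝ {n})ᗮ :
      AffineSubspace ℝ E) : Set E) = {x | ⟪n, x - c⟫ = s} := by
    ext x
    simp only [SetLike.mem_coe, AffineSubspace.mem_mk', vadd_eq_add, vsub_eq_sub,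
      Set.mem_ofPred_eq, Submodule.mem_orthogonal_singleton_iff_inner_right]
    rw [show x - (s • n + c) = (x - c) - s • n by abel, inner_sub_right, inner_smul_right,
      real_inner_self_eq_norm_sq, hn, one_pow, mul_one, sub_eq_zero]
  have hn0 : n ≠ 0 := norm_ne_zero_iff.1 (hn ▸ one_ne_zero)
  rw [← InnerProductSpace.euclideanHausdorffMeasure_eq_volume,
    EuclideanGeometry.euclideanHausdorffMeasure_eq_lintegral c hn0 hA]
  simp only [plane_eq, ← ofReal_norm, hn, ENNReal.ofReal_one, one_mul]

/-- Cavalieri's principle on a cone: the slice at height `δ * t` is a copy of the basis shrunk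
by `t`, which scales the measure of dimension `finrank ℝ E - 1` accordingly. -/
theorem volume_inter_coneOver (hn : ‖n‖ = 1) (hδ : 0 < δ) (hσ : ∀ y ∈ σ, ⟪n, y - c⟫ = δ)
    (hσm : MeasurableSet σ) {A : Set E} (hA : MeasurableSet A) :
    volume (A ∩ coneOver c σ) = ∫⁻ t in Set.Ioo (0 : ℝ) 1,
      ENNReal.ofReal (δ * t ^ (Module.finrank ℝ E - 1)) *
        μHE[Module.finrank ℝ E - 1] (σ ∩ (fun y => c + t • (y - c)) ⁻¹' A) := by
  set slice : ℝ → ENNReal := fun s =>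
    μHE[Module.finrank ℝ E - 1] (A ∩ coneOver c σ ∩ {x | ⟪n, x - c⟫ = s}) with slice_def
  have slice_support : slice = (Set.Ioo 0 δ).indicator slice := by
    refine (Set.indicator_eq_self.2 fun s hs => ?_).symm
    obtain ⟨x, ⟨_, hx⟩, hxs⟩ := nonempty_of_measure_ne_zero hs
    rw [coneOver_eq hδ hσ] at hx
    exact hxs ▸ hx.1
  have image_Ioo : (fun t : ℝ => δ * t) '' Set.Ioo 0 1 = Set.Ioo 0 δ := by
    rw [Set.image_mul_left_Ioo hδ, mul_zero, mul_one]
  rw [volume_eq_lintegral_plane hn c (hA.inter (measurableSet_coneOver hδ hσ hσm)), ← slice_def,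
    slice_support, lintegral_indicator measurableSet_Ioo, ← image_Ioo,
    lintegral_image_eq_lintegral_abs_deriv_mul (f' := fun _ => δ) measurableSet_Ioo
      (fun x _ => by simpa using ((hasDerivAt_id x).const_mul δ).hasDerivWithinAt)
      (mul_right_injective₀ hδ.ne').injOn]
  refine setLIntegral_congr_fun measurableSet_Ioo fun t ht => ?_
  dsimp only [slice]
  rw [inter_coneOver_inter_plane hδ hσ A ht,
    euclideanHausdorffMeasure_homothety_image _ _ ht.1.ne', abs_of_pos hδ,
    ENNReal.ofReal_mul hδ.le, mul_assoc, ENNReal.smul_def, smul_eq_mul, ENNReal.coe_pow,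
    ← enorm_eq_nnnorm, Real.enorm_eq_ofReal ht.1.le, ENNReal.ofReal_pow ht.1.le]

theorem lintegral_Ioo_ofReal_mul_pow_pred {m : ℕ} (hm : 0 < m) (hδ : 0 ≤ δ) :
    ∫⁻ t in Set.Ioo (0 : ℝ) 1, ENNReal.ofReal (δ * t ^ (m - 1)) = ENNReal.ofReal (δ / m) := by
  rw [← ofReal_integral_eq_lintegral_ofReal, integral_const_mul,
    ← integral_Ioc_eq_integral_Ioo, ← intervalIntegral.integral_of_le zero_le_one, integral_pow,
    ← Nat.cast_add_one, Nat.sub_add_cancel hm, one_pow, zero_pow hm.ne', sub_zero, mul_one_div]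
  · exact (Continuous.integrableOn_Icc (by fun_prop)).mono_set Set.Ioo_subset_Icc_self
  · filter_upwards [ae_restrict_mem measurableSet_Ioo] with t ht
    exact mul_nonneg hδ (pow_nonneg ht.1.le _)

theorem volume_coneOver (hn : ‖n‖ = 1) (hδ : 0 < δ) (hσ : ∀ y ∈ σ, ⟪n, y - c⟫ = δ)
    (hσm : MeasurableSet σ) :
    volume (coneOver c σ) =
      ENNReal.ofReal (δ / Module.finrank ℝ E) * μHE[Module.finrank ℝ E - 1] σ := by
  have : Nontrivial E := nontrivial_of_ne n 0 (norm_ne_zero_iff.1 (hn ▸ one_ne_zero))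
  have cavalieri := volume_inter_coneOver hn hδ hσ hσm MeasurableSet.univ
  simp only [Set.univ_inter, Set.preimage_univ, Set.inter_univ] at cavalieri
  rw [cavalieri, lintegral_mul_const _ (by fun_prop),
    lintegral_Ioo_ofReal_mul_pow_pred Module.finrank_pos hδ.le]

theorem volume_real_coneOver (hn : ‖n‖ = 1) (hδ : 0 < δ)
    (hσ : ∀ y ∈ σ, ⟪n, y - c⟫ = δ) (hσm : MeasurableSet σ) :
    volume.real (coneOver c σ) =
      δ / Module.finrank ℝ E * (μHE[Module.finrank ℝ E - 1]).real σ := by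
  rw [Measure.real, volume_coneOver hn hδ hσ hσm, ENNReal.toReal_mul,
    ENNReal.toReal_ofReal (by positivity), Measure.real]

theorem euclideanHausdorffMeasure_lt_top_of_isBounded (hn : ‖n‖ = 1) (hδ : 0 < δ)
    (hσ : ∀ y ∈ σ, ⟪n, y - c⟫ = δ) (hσm : MeasurableSet σ) (hb : Bornology.IsBounded σ) :
    μHE[Module.finrank ℝ E - 1] σ < ⊤ := by
  have : Nontrivial E := nontrivial_of_ne n 0 (norm_ne_zero_iff.1 (hn ▸ one_ne_zero))
  have cone_lt_top : volume (coneOver c σ) < ⊤ := (isBounded_coneOver hb).measure_lt_top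
  rw [volume_coneOver hn hδ hσ hσm] at cone_lt_top
  refine ENNReal.lt_top_of_mul_ne_top_right cone_lt_top.ne (ENNReal.ofReal_pos.2 ?_).ne'
  exact div_pos hδ (Nat.cast_pos.2 Module.finrank_pos)

theorem volume_restrict_coneOver (hn : ‖n‖ = 1) (hδ : 0 < δ)
    (hσ : ∀ y ∈ σ, ⟪n, y - c⟫ = δ) (hσm : MeasurableSet σ)
    (hfin : μHE[Module.finrank ℝ E - 1] σ < ⊤) :
    volume.restrict (coneOver c σ) =
      Measure.map (fun p : ℝ × E => c + p.1 • (p.2 - c))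
        (((volume.restrict (Set.Ioo (0 : ℝ) 1)).withDensity
          fun t => ENNReal.ofReal (δ * t ^ (Module.finrank ℝ E - 1))).prod
            (μHE[Module.finrank ℝ E - 1].restrict σ)) := by
  have : IsFiniteMeasure (μHE[Module.finrank ℝ E - 1].restrict σ) := ⟨by simpa using hfin⟩
  have hmeas : Measurable fun p : ℝ × E => c + p.1 • (p.2 - c) := by fun_prop
  ext A hA
  rw [Measure.restrict_apply hA, volume_inter_coneOver hn hδ hσ hσm hA,
    Measure.map_apply hmeas hA, Measure.prod_apply (hmeas hA),
    lintegral_withDensity_eq_lintegral_mul _ (by fun_prop)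
      (measurable_measure_prodMk_left (hmeas hA))]
  refine lintegral_congr fun t => ?_
  rw [Pi.mul_apply, Measure.restrict_apply (measurable_prodMk_left (hmeas hA)), Set.inter_comm]
  rfl

theorem integral_coneOver {F : Type*} [NormedAddCommGroup F] [NormedSpace ℝ F]
    (hn : ‖n‖ = 1) (hδ : 0 < δ) (hσ : ∀ y ∈ σ, ⟪n, y - c⟫ = δ) (hσm : MeasurableSet σ)
    (hfin : μHE[Module.finrank ℝ E - 1] σ < ⊤) {f : E → F}
    (hf : IntegrableOn f (coneOver c σ)) :
    ∫ x in coneOver c σ, f x = ∫ t in (0 : ℝ)..1, (δ * t ^ (Module.finrank ℝ E - 1)) •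
      ∫ y in σ, f (c + t • (y - c)) ∂μHE[Module.finrank ℝ E - 1] := by
  have : IsFiniteMeasure (μHE[Module.finrank ℝ E - 1].restrict σ) := ⟨by simpa using hfin⟩
  have hmeas : Measurable fun p : ℝ × E => c + p.1 • (p.2 - c) := by fun_prop
  have polar := volume_restrict_coneOver hn hδ hσ hσm hfin
  rw [IntegrableOn, polar] at hf
  rw [polar, integral_map hmeas.aemeasurable hf.aestronglyMeasurable]
  have hf' := (integrable_map_measure hf.aestronglyMeasurable hmeas.aemeasurable).1 hf
  have density_eq : (fun t : ℝ => ENNReal.ofReal (δ * t ^ (Module.finrank ℝ E - 1))) =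
    fun t => ((Real.toNNReal (δ * t ^ (Module.finrank ℝ E - 1)) : NNReal) : ENNReal) := rfl
  rw [density_eq] at hf' ⊢
  rw [integral_prod (fun p : ℝ × E => f (c + p.1 • (p.2 - c))) hf',
    integral_withDensity_eq_integral_smul (by fun_prop),
    intervalIntegral.integral_of_le zero_le_one, integral_Ioc_eq_integral_Ioo]
  refine setIntegral_congr_fun measurableSet_Ioo fun t ht => ?_
  simp only [NNReal.smul_def, Real.coe_toNNReal _ (mul_nonneg hδ.le (pow_nonneg ht.1.le _))]

end Measurable

end Cone

/-! ### Star-shaped cells -/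

theorem volume_plane {E : Type*} [NormedAddCommGroup E] [InnerProductSpace ℝ E]
    [MeasurableSpace E] [BorelSpace E] [FiniteDimensional ℝ E] {n : E} (hn : ‖n‖ = 1) (c : E)
    (δ : ℝ) : volume {x : E | ⟪n, x - c⟫ = δ} = 0 := by
  have plane_closed : IsClosed {x : E | ⟪n, x - c⟫ = δ} := isClosed_eq (by fun_prop) (by fun_prop)
  have slice_empty (s : ℝ) (hs : s ≠ δ) :
      {x : E | ⟪n, x - c⟫ = δ} ∩ {x | ⟪n, x - c⟫ = s} = ∅ :=
    Set.eq_empty_of_forall_notMem fun _ hx => hs (hx.2.symm.trans hx.1)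
  rw [volume_eq_lintegral_plane hn c plane_closed.measurableSet]
  refine lintegral_eq_zero_of_ae_eq_zero ?_
  filter_upwards [Measure.ae_ne volume δ] with s hs
  rw [slice_empty s hs, measure_empty, Pi.zero_apply]

theorem lipschitzWith_of_eventually_norm_sub_le {E F : Type*} [NormedAddCommGroup E]
    [NormedSpace ℝ E] [NormedAddCommGroup F] {f : E → F} {C : NNReal} (hf : Continuous f)
    (h : ∀ x, ∀ᶠ y in 𝓝 x, ‖f y - f x‖ ≤ C * ‖y - x‖) : LipschitzWith C f := by
  refine lipschitzWith_iff_norm_sub_le.2 fun y x => ?_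
  let line : ℝ → E := fun t => x + t • (y - x)
  have hline : Continuous line := by fun_prop
  let s : Set ℝ := {t | ‖f (line t) - f (line 0)‖ ≤ C * ‖y - x‖ * t}
  have hs : IsClosed s := isClosed_le (by fun_prop) (by fun_prop)
  have unit_subset : Set.Icc (0 : ℝ) 1 ⊆ s := by
    refine (hs.inter isClosed_Icc).Icc_subset_of_forall_exists_gt (by simp [s]) ?_
    rintro t ⟨hts : ‖f (line t) - f (line 0)‖ ≤ C * ‖y - x‖ * t, -⟩ r hr
    have near := (hline.continuousAt.eventually (h (line t))).filter_mono
      (nhdsWithin_le_nhds (s := Set.Ioi t))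
    obtain ⟨z, hz, hzr⟩ := (near.and (Ioc_mem_nhdsGT hr)).exists
    refine ⟨z, ?_, hzr⟩
    rw [show line z - line t = (z - t) • (y - x) by simp only [line]; module, norm_smul,
      Real.norm_of_nonneg (sub_nonneg.2 hzr.1.le)] at hz
    calc ‖f (line z) - f (line 0)‖
        ≤ ‖f (line z) - f (line t)‖ + ‖f (line t) - f (line 0)‖ :=
          norm_sub_le_norm_sub_add_norm_sub _ _ _
      _ ≤ C * ((z - t) * ‖y - x‖) + C * ‖y - x‖ * t := add_le_add hz hts
      _ = C * ‖y - x‖ * z := by ring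
  simpa [s, line] using unit_subset (Set.right_mem_Icc.2 zero_le_one)

/-- The Minkowski functional of `K` relative to the point `c`. -/
def starGauge {V : Type*} [AddCommGroup V] [Module ℝ V] (K : Set V) (c x : V) : ℝ :=
  gauge ((fun v => c + v) ⁻¹' K) (x - c)

theorem starGauge_nonneg {V : Type*} [AddCommGroup V] [Module ℝ V] (K : Set V) (c x : V) :
    0 ≤ starGauge K c x := gauge_nonneg _

theorem starGauge_self {V : Type*} [AddCommGroup V] [Module ℝ V] (K : Set V) (c : V) :
    starGauge K c c = 0 := by
  rw [starGauge, sub_self, gauge_zero]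

/-- A bounded open set `K`, star-shaped about `c`, whose boundary consists of the closures of
finitely many pairwise disjoint flat pieces `σ i`, relatively open in the hyperplanes
`⟪n i, y - c⟫ = δ i` with `δ i > 0`. -/
structure IsStarCell {E : Type*} [NormedAddCommGroup E] [InnerProductSpace ℝ E]
    [MeasurableSpace E] [BorelSpace E] {ι : Type*} (K : Set E) (c : E) (S : Finset ι)
    (σ : ι → Set E) (n : ι → E) (δ : ι → ℝ) : Prop where
  isOpen : IsOpen K
  isBounded : Bornology.IsBounded K
  center_mem : c ∈ K
  starConvex : StarConvex ℝ c K
  norm_normal : ∀ i ∈ S, ‖n i‖ = 1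
  height_pos : ∀ i ∈ S, 0 < δ i
  exists_open : ∀ i ∈ S, ∃ U, IsOpen U ∧ σ i = U ∩ {y | ⟪n i, y - c⟫ = δ i}
  boundary_null : ∀ i ∈ S, μHE[Module.finrank ℝ E - 1] (closure (σ i) \ σ i) = 0
  frontier_eq : frontier K = ⋃ i ∈ S, closure (σ i)
  disjoint : ∀ i ∈ S, ∀ j ∈ S, i ≠ j → Disjoint (σ i) (σ j)

namespace IsStarCell

variable {E : Type*} [NormedAddCommGroup E] [InnerProductSpace ℝ E] [MeasurableSpace E]
  [BorelSpace E] {ι : Type*} {K : Set E} {c : E} {S : Finset ι} {σ : ι → Set E} {n : ι → E}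
  {δ : ι → ℝ} (h : IsStarCell K c S σ n δ)

include h

theorem inner_eq_of_mem_closure {i : ι} (hi : i ∈ S) {y : E} (hy : y ∈ closure (σ i)) :
    ⟪n i, y - c⟫ = δ i := by
  obtain ⟨U, -, hU⟩ := h.exists_open i hi
  have plane_closed : IsClosed {y : E | ⟪n i, y - c⟫ = δ i} :=
    isClosed_eq (by fun_prop) continuous_const
  exact closure_minimal (hU ▸ Set.inter_subset_right) plane_closed hy

theorem inner_eq {i : ι} (hi : i ∈ S) {y : E} (hy : y ∈ σ i) : ⟪n i, y - c⟫ = δ i :=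
  h.inner_eq_of_mem_closure hi (subset_closure hy)

theorem measurableSet_edge {i : ι} (hi : i ∈ S) : MeasurableSet (σ i) := by
  obtain ⟨U, hUo, hU⟩ := h.exists_open i hi
  have plane_closed : IsClosed {y : E | ⟪n i, y - c⟫ = δ i} :=
    isClosed_eq (by fun_prop) continuous_const
  exact hU ▸ hUo.measurableSet.inter plane_closed.measurableSet

theorem edge_subset_frontier {i : ι} (hi : i ∈ S) : σ i ⊆ frontier K := by
  rw [h.frontier_eq]
  exact subset_closure.trans (Set.subset_biUnion_of_mem (u := fun i => closure (σ i)) hi)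

theorem edge_subset_closure {i : ι} (hi : i ∈ S) : σ i ⊆ closure K :=
  (h.edge_subset_frontier hi).trans frontier_subset_closure

theorem isBounded_edge {i : ι} (hi : i ∈ S) : Bornology.IsBounded (σ i) :=
  h.isBounded.closure.subset (h.edge_subset_closure hi)

theorem exists_of_mem_frontier {z : E} (hz : z ∈ frontier K) : ∃ i ∈ S, z ∈ closure (σ i) := by
  rw [h.frontier_eq] at hz
  simpa using hz

theorem add_smul_mem_closure {z : E} (hz : z ∈ closure K) {s : ℝ} (hs0 : 0 ≤ s)
    (hs1 : s ≤ 1) : c + s • (z - c) ∈ closure K :=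
  map_mem_closure (f := fun z : E => c + s • (z - c)) (by fun_prop) hz
    fun _ hy => h.starConvex.add_smul_sub_mem hy hs0 hs1

/-- A ray from the centre meets the boundary only once: otherwise it would do so along a whole
segment, and two points of that segment would lie in the same hyperplane `⟪n i, y - c⟫ = δ i`. -/
theorem add_smul_mem {z : E} (hz : z ∈ closure K) {s : ℝ} (hs0 : 0 ≤ s) (hs1 : s < 1) :
    c + s • (z - c) ∈ K := by
  by_contra hsK
  have segment_frontier : ∀ r ∈ Set.Icc s 1, c + r • (z - c) ∈ frontier K := by
    intro r hr
    have hr0 := hs0.trans hr.1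
    rw [h.isOpen.frontier_eq]
    refine ⟨h.add_smul_mem_closure hz hr0 hr.2, fun hrK => hsK ?_⟩
    have := h.starConvex.add_smul_sub_mem hrK (t := s / r) (by positivity)
      (div_le_one_of_le₀ hr.1 hr0)
    rwa [add_sub_cancel_left, smul_smul, div_mul_cancel_of_imp] at this
    rintro rfl
    exact le_antisymm hr.1 hs0
  have : Nonempty ι := ⟨(h.exists_of_mem_frontier (segment_frontier s ⟨le_rfl, hs1.le⟩)).choose⟩
  choose! f hfS hf using fun r hr => h.exists_of_mem_frontier (segment_frontier r hr)
  obtain ⟨r, hr, r', hr', hne, heq⟩ :=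
    (Set.Icc_infinite hs1).exists_ne_map_eq_of_mapsTo (t := (S : Set ι)) hfS S.finite_toSet
  have height := h.inner_eq_of_mem_closure (hfS r hr) (hf r hr)
  have height' := h.inner_eq_of_mem_closure (hfS r' hr') (hf r' hr')
  rw [add_sub_cancel_left, inner_smul_right] at height height'
  rw [← heq] at height'
  have hne0 : ⟪n (f r), z - c⟫ ≠ 0 :=
    right_ne_zero_of_mul (height.trans_ne (h.height_pos _ (hfS r hr)).ne')
  exact hne (mul_right_cancel₀ hne0 (height.trans height'.symm))

theorem isOpen_preimage : IsOpen ((fun v => c + v) ⁻¹' K) :=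
  h.isOpen.preimage (by fun_prop)

theorem absorbent_preimage : Absorbent ℝ ((fun v => c + v) ⁻¹' K) :=
  absorbent_nhds_zero (h.isOpen_preimage.mem_nhds (by simpa using h.center_mem))

theorem starGauge_lt_iff {x : E} {s : ℝ} (hs : 0 < s) :
    starGauge K c x < s ↔ c + s⁻¹ • (x - c) ∈ K := by
  constructor
  · intro hlt
    obtain ⟨r, hr0, hrs, v, hv, hvx⟩ := exists_lt_of_gauge_lt h.absorbent_preimage hlt
    have := h.starConvex.add_smul_sub_mem hv (t := r / s) (by positivity)
      ((div_le_one hs).2 hrs.le)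
    rw [← hvx]
    rwa [add_sub_cancel_left, div_eq_inv_mul, mul_smul] at this
  · intro hmem
    exact gauge_lt_of_mem_smul _ s hs h.isOpen_preimage
      ((Set.mem_smul_set_iff_inv_smul_mem₀ hs.ne' _ _).2 hmem)

theorem starGauge_le_iff {x : E} {s : ℝ} (hs : 0 < s) :
    starGauge K c x ≤ s ↔ c + s⁻¹ • (x - c) ∈ closure K := by
  constructor
  · intro hle
    have hcont : ContinuousAt (fun t : ℝ => c + t⁻¹ • (x - c)) s := by
      have := continuousAt_inv₀ hs.ne'
      fun_prop
    refine mem_closure_of_tendsto (hcont.tendsto.mono_left (nhdsWithin_le_nhds (s := Set.Ioi s))) ?_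
    filter_upwards [self_mem_nhdsWithin] with t ht
    exact (h.starGauge_lt_iff (hs.trans ht)).1 (hle.trans_lt ht)
  · intro hmem
    refine le_of_forall_gt_imp_ge_of_dense fun t ht => ?_
    have ht0 : 0 < t := hs.trans ht
    have := h.add_smul_mem hmem (s := s / t) (by positivity) ((div_lt_one ht0).2 ht)
    rw [add_sub_cancel_left, smul_smul, div_mul_eq_mul_div, mul_inv_cancel₀ hs.ne',
      one_div] at this
    exact ((h.starGauge_lt_iff ht0).2 this).le

theorem starGauge_lt_one_iff {x : E} : starGauge K c x < 1 ↔ x ∈ K := by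
  rw [h.starGauge_lt_iff one_pos, inv_one, one_smul, add_sub_cancel]

theorem starGauge_pos {x : E} (hx : x ≠ c) : 0 < starGauge K c x := by
  refine (gauge_pos h.absorbent_preimage (NormedSpace.isVonNBounded_of_isBounded ℝ ?_)).2
    (sub_ne_zero.2 hx)
  obtain ⟨R, hR⟩ := h.isBounded.subset_closedBall c
  refine (Metric.isBounded_closedBall (x := (0 : E)) (r := R)).subset fun v hv => ?_
  simpa using hR hv

theorem exists_edge_of_ne {x : E} (hx : x ≠ c) : ∃ i ∈ S,
    c + (starGauge K c x)⁻¹ • (x - c) ∈ closure (σ i) := by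
  have hpos := h.starGauge_pos hx
  refine h.exists_of_mem_frontier ?_
  rw [h.isOpen.frontier_eq]
  exact ⟨(h.starGauge_le_iff hpos).1 le_rfl,
    fun hmem => lt_irrefl _ ((h.starGauge_lt_iff hpos).2 hmem)⟩

theorem exists_starGauge_eq {x : E} (hx : x ≠ c) : ∃ i ∈ S,
    starGauge K c x = ⟪n i, x - c⟫ / δ i := by
  obtain ⟨i, hi, hmem⟩ := h.exists_edge_of_ne hx
  have height := h.inner_eq_of_mem_closure hi hmem
  rw [add_sub_cancel_left, inner_smul_right, inv_mul_eq_iff_eq_mul₀ (h.starGauge_pos hx).ne']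
    at height
  exact ⟨i, hi, ((div_eq_iff (h.height_pos i hi).ne').2 height).symm⟩

theorem starGauge_add_smul {y : E} (hy : y ∈ frontier K) {t : ℝ} (ht : 0 < t) :
    starGauge K c (c + t • (y - c)) = t := by
  have rescale : c + t⁻¹ • (c + t • (y - c) - c) = y := by
    rw [add_sub_cancel_left, smul_smul, inv_mul_cancel₀ ht.ne', one_smul, add_sub_cancel]
  rw [h.isOpen.frontier_eq] at hy
  refine le_antisymm ((h.starGauge_le_iff ht).2 (rescale.symm ▸ hy.1 :))
    (not_lt.1 fun hlt => hy.2 ?_)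
  rwa [h.starGauge_lt_iff ht, rescale] at hlt

theorem starGauge_eq_of_mem_cone {i : ι} (hi : i ∈ S) {x : E} (hx : x ∈ coneOver c (σ i)) :
    starGauge K c x = ⟪n i, x - c⟫ / δ i := by
  obtain ⟨y, hy, t, ht, rfl⟩ := hx
  rw [h.starGauge_add_smul (h.edge_subset_frontier hi hy) ht.1, add_sub_cancel_left,
    inner_smul_right, h.inner_eq hi hy, mul_div_cancel_right₀ _ (h.height_pos i hi).ne']

theorem cone_subset {i : ι} (hi : i ∈ S) : coneOver c (σ i) ⊆ K := by
  rintro _ ⟨y, hy, t, ht, rfl⟩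
  exact h.add_smul_mem (h.edge_subset_closure hi hy) ht.1.le ht.2

theorem cone_disjoint {i j : ι} (hi : i ∈ S) (hj : j ∈ S) (hij : i ≠ j) :
    Disjoint (coneOver c (σ i)) (coneOver c (σ j)) := by
  rw [Set.disjoint_left]
  rintro _ ⟨y, hy, t, ht, rfl⟩ ⟨z, hz, s, hs, hzs⟩
  have gauge_eq := h.starGauge_add_smul (h.edge_subset_frontier hj hz) hs.1
  rw [← hzs, h.starGauge_add_smul (h.edge_subset_frontier hi hy) ht.1] at gauge_eq
  subst gauge_eq
  obtain rfl : y = z :=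
    sub_left_injective (smul_right_injective _ ht.1.ne' (add_left_cancel hzs))
  exact Set.disjoint_left.1 (h.disjoint i hi j hj hij) hy hz

theorem isOpen_cone {i : ι} (hi : i ∈ S) : IsOpen (coneOver c (σ i)) := by
  obtain ⟨U, hU, hUσ⟩ := h.exists_open i hi
  exact isOpen_coneOver (h.height_pos i hi) hU hUσ

theorem lowerSemicontinuous_starGauge : LowerSemicontinuous (starGauge K c) := by
  rw [lowerSemicontinuous_iff_isClosed_preimage]
  intro s
  rcases lt_trichotomy s 0 with hs | rfl | hs
  · convert isClosed_empty
    ext x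
    simpa using hs.trans_le (starGauge_nonneg K c x)
  · convert isClosed_singleton (x := c)
    ext x
    simp only [Set.mem_preimage, Set.mem_Iic, Set.mem_singleton_iff]
    refine ⟨fun hx => ?_, fun hx => by rw [hx, starGauge_self]⟩
    by_contra hne
    exact (h.starGauge_pos hne).not_ge hx
  · have sublevel : starGauge K c ⁻¹' Set.Iic s = (fun x => c + s⁻¹ • (x - c)) ⁻¹' closure K :=
      Set.ext fun x => h.starGauge_le_iff hs
    rw [sublevel]
    exact isClosed_closure.preimage (by fun_prop)

theorem upperSemicontinuous_starGauge : UpperSemicontinuous (starGauge K c) := by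
  rw [upperSemicontinuous_iff_isOpen_preimage]
  intro s
  rcases le_or_gt s 0 with hs | hs
  · convert isOpen_empty
    ext x
    simpa using hs.trans (starGauge_nonneg K c x)
  · have sublevel : starGauge K c ⁻¹' Set.Iio s = (fun x => c + s⁻¹ • (x - c)) ⁻¹' K :=
      Set.ext fun x => h.starGauge_lt_iff hs
    rw [sublevel]
    exact h.isOpen.preimage (by fun_prop)

theorem continuous_starGauge : Continuous (starGauge K c) :=
  continuous_iff_lower_upperSemicontinuous.2
    ⟨h.lowerSemicontinuous_starGauge, h.upperSemicontinuous_starGauge⟩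

theorem abs_inner_div_height_sub_le {i : ι} (hi : i ∈ S) (x y : E) :
    |⟪n i, y - c⟫ / δ i - ⟪n i, x - c⟫ / δ i| ≤ (∑ j ∈ S, (δ j)⁻¹) * ‖y - x‖ := by
  have inv_nonneg : ∀ j ∈ S, 0 ≤ (δ j)⁻¹ := fun j hj => inv_nonneg.2 (h.height_pos j hj).le
  rw [← sub_div, ← inner_sub_right, sub_sub_sub_cancel_right, abs_div,
    abs_of_pos (h.height_pos i hi), div_eq_inv_mul]
  refine mul_le_mul (Finset.single_le_sum inv_nonneg hi) ?_ (abs_nonneg _)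
    (Finset.sum_nonneg inv_nonneg)
  simpa [h.norm_normal i hi] using abs_real_inner_le_norm (n i) (y - x)

/-- Near `x` the gauge coincides pointwise with one of the finitely many linear functions
`⟪n i, · - c⟫ / δ i` which take the value of the gauge at `x`. -/
theorem eventually_abs_starGauge_sub_le (x : E) : ∀ᶠ y in 𝓝 x,
    |starGauge K c y - starGauge K c x| ≤ (∑ j ∈ S, (δ j)⁻¹) * ‖y - x‖ := by
  have active : ∀ i ∈ S, ∀ᶠ y in 𝓝 x, starGauge K c y = ⟪n i, y - c⟫ / δ i →
      starGauge K c x = ⟪n i, x - c⟫ / δ i := by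
    intro i _
    by_cases hx : starGauge K c x = ⟪n i, x - c⟫ / δ i
    · exact Eventually.of_forall fun _ _ => hx
    · have hcont : Continuous fun y => starGauge K c y - ⟪n i, y - c⟫ / δ i := by
        have := h.continuous_starGauge
        fun_prop
      filter_upwards [hcont.continuousAt.eventually_ne (sub_ne_zero.2 hx)] with y hy hy'
      exact absurd (sub_eq_zero.2 hy') hy
  filter_upwards [(Filter.eventually_all_finset S).2 active] with y hy
  rcases eq_or_ne y c with rfl | hyc
  · rcases eq_or_ne x y with rfl | hxy
    · simp
    · obtain ⟨i, hi, hxi⟩ := h.exists_starGauge_eq hxy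
      simpa [hxi, starGauge_self] using h.abs_inner_div_height_sub_le hi x y
  · obtain ⟨i, hi, hyi⟩ := h.exists_starGauge_eq hyc
    rw [hyi, hy i hi hyi]
    exact h.abs_inner_div_height_sub_le hi x y

theorem lipschitzWith_starGauge :
    LipschitzWith (∑ j ∈ S, (δ j)⁻¹).toNNReal (starGauge K c) := by
  refine lipschitzWith_of_eventually_norm_sub_le h.continuous_starGauge fun x => ?_
  rw [Real.coe_toNNReal _ (Finset.sum_nonneg fun j hj => inv_nonneg.2 (h.height_pos j hj).le)]
  exact h.eventually_abs_starGauge_sub_le x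

theorem exists_mem_coneOver_closure {x : E} (hxK : x ∈ K) (hxc : x ≠ c) :
    ∃ i ∈ S, x ∈ coneOver c (closure (σ i)) := by
  have hpos := h.starGauge_pos hxc
  obtain ⟨i, hi, hmem⟩ := h.exists_edge_of_ne hxc
  refine ⟨i, hi, _, hmem, _, ⟨hpos, h.starGauge_lt_one_iff.2 hxK⟩, ?_⟩
  rw [add_sub_cancel_left, smul_smul, mul_inv_cancel₀ hpos.ne', one_smul, add_sub_cancel]

variable [FiniteDimensional ℝ E]

theorem volume_frontier : volume (frontier K) = 0 := by
  rw [h.frontier_eq]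
  exact (measure_biUnion_null_iff S.countable_toSet).2 fun i hi =>
    measure_mono_null (fun _ => h.inner_eq_of_mem_closure hi)
      (volume_plane (h.norm_normal i hi) c (δ i))

theorem volume_coneOver_closure_diff {i : ι} (hi : i ∈ S) :
    volume (coneOver c (closure (σ i) \ σ i)) = 0 := by
  rw [volume_coneOver (h.norm_normal i hi) (h.height_pos i hi)
    (fun y hy => h.inner_eq_of_mem_closure hi hy.1)
    (isClosed_closure.measurableSet.diff (h.measurableSet_edge hi)), h.boundary_null i hi, mul_zero]

theorem ae_mem_cone [Nontrivial E] :
    ∀ᵐ x : E, x ∈ closure K → ∃ i ∈ S, x ∈ coneOver c (σ i) := by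
  have off_boundary : ∀ᵐ x : E, ∀ i ∈ S, x ∉ coneOver c (closure (σ i) \ σ i) :=
    (Filter.eventually_all_finset S).2 fun i hi =>
      measure_eq_zero_iff_ae_notMem.1 (h.volume_coneOver_closure_diff hi)
  filter_upwards [measure_eq_zero_iff_ae_notMem.1 h.volume_frontier, off_boundary,
    Measure.ae_ne volume c] with x hx_frontier hx_cone hxc hxK
  have hxK' : x ∈ K := by
    by_contra hcon
    exact hx_frontier (h.isOpen.frontier_eq ▸ ⟨hxK, hcon⟩)
  obtain ⟨i, hi, y, hy, t, ht, rfl⟩ := h.exists_mem_coneOver_closure hxK' hxc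
  refine ⟨i, hi, y, ?_, t, ht, rfl⟩
  by_contra hcon
  exact hx_cone i hi ⟨y, ⟨hy, hcon⟩, t, ht, rfl⟩

end IsStarCell

/-! ### The divergence theorem on a star-shaped cell -/

theorem tendsto_integral_pow_mul {F : ℝ → ℝ} (hF : Continuous F) :
    Tendsto (fun k : ℕ => ((k : ℝ) + 1) * ∫ t in (0 : ℝ)..1, t ^ k * F t) atTop (𝓝 (F 1)) := by
  have peak := tendsto_setIntegral_pow_smul_of_unique_maximum_of_isCompact_of_continuousOn
    (μ := (volume : Measure ℝ)) (s := Set.Icc (0 : ℝ) 1) (x₀ := 1) (c := fun t => t) (g := F)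
    isCompact_Icc continuousOn_id (fun y hy hne => lt_of_le_of_ne hy.2 hne)
    (fun x hx => hx.1) one_pos
    (by rw [interior_Icc, closure_Ioo zero_ne_one]; exact Set.right_mem_Icc.2 zero_le_one)
    hF.continuousOn
  refine peak.congr fun k => ?_
  rw [integral_Icc_eq_integral_Ioc, integral_Icc_eq_integral_Ioc,
    ← intervalIntegral.integral_of_le zero_le_one, ← intervalIntegral.integral_of_le zero_le_one,
    integral_pow]
  simp

/-- The cut-off functions `1 - min(g, 1) ^ (k + 1)`, where `g` is the gauge of `K`; as `k → ∞` they
increase to the indicator of `K`. -/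
def starCutoff {V : Type*} [AddCommGroup V] [Module ℝ V] (K : Set V) (c : V) (k : ℕ) (x : V) : ℝ :=
  1 - min (starGauge K c x) 1 ^ (k + 1)

theorem abs_starCutoff_le_one {V : Type*} [AddCommGroup V] [Module ℝ V] (K : Set V) (c : V)
    (k : ℕ) (x : V) : |starCutoff K c k x| ≤ 1 := by
  have min_nonneg : 0 ≤ min (starGauge K c x) 1 := le_min (starGauge_nonneg K c x) zero_le_one
  have pow_le : min (starGauge K c x) 1 ^ (k + 1) ≤ 1 := pow_le_one₀ min_nonneg (min_le_right _ _)
  rw [starCutoff, abs_of_nonneg (sub_nonneg.2 pow_le)]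
  exact sub_le_self _ (by positivity)

namespace IsStarCell

variable {E : Type*} [NormedAddCommGroup E] [InnerProductSpace ℝ E] [MeasurableSpace E]
  [BorelSpace E] {ι : Type*} {K : Set E} {c : E} {S : Finset ι} {σ : ι → Set E} {n : ι → E}
  {δ : ι → ℝ} (h : IsStarCell K c S σ n δ)

include h

theorem starCutoff_eq_zero (k : ℕ) {x : E} (hx : x ∉ K) : starCutoff K c k x = 0 := by
  have : 1 ≤ starGauge K c x := not_lt.1 fun hlt => hx (h.starGauge_lt_one_iff.1 hlt)
  rw [starCutoff, min_eq_right this, one_pow, sub_self]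

theorem tendsto_starCutoff {x : E} (hx : x ∈ K) :
    Tendsto (fun k => starCutoff K c k x) atTop (𝓝 1) := by
  have hlt := h.starGauge_lt_one_iff.2 hx
  have pow_tendsto := (tendsto_pow_atTop_nhds_zero_of_lt_one (starGauge_nonneg K c x) hlt).comp
    (tendsto_add_atTop_nat 1)
  simpa [starCutoff, min_eq_left hlt.le] using pow_tendsto.const_sub 1

theorem exists_lipschitzWith_starCutoff (k : ℕ) : ∃ C, LipschitzWith C (starCutoff K c k) := by
  have min_lipschitz := h.lipschitzWith_starGauge.min_const 1
  set L := (∑ j ∈ S, (δ j)⁻¹).toNNReal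
  refine ⟨(k + 1) * L, LipschitzWith.of_dist_le_mul fun x y => ?_⟩
  have unit (z : E) : |min (starGauge K c z) 1| ≤ 1 := by
    rw [abs_of_nonneg (le_min (starGauge_nonneg K c z) zero_le_one)]
    exact min_le_right _ _
  rw [dist_comm, Real.dist_eq, starCutoff, starCutoff, sub_sub_sub_cancel_left]
  calc |min (starGauge K c x) 1 ^ (k + 1) - min (starGauge K c y) 1 ^ (k + 1)|
      ≤ |min (starGauge K c x) 1 - min (starGauge K c y) 1| * (k + 1 : ℕ) *
          max |min (starGauge K c x) 1| |min (starGauge K c y) 1| ^ (k + 1 - 1) :=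
        abs_pow_sub_pow_le _ _ _
    _ ≤ L * dist x y * (k + 1 : ℕ) * 1 := by
        gcongr
        · exact min_lipschitz.dist_le_mul x y
        · exact pow_le_one₀ (le_max_of_le_left (abs_nonneg _)) (max_le (unit x) (unit y))
    _ = ↑((k + 1) * L) * dist x y := by
        push_cast
        ring

theorem continuous_starCutoff (k : ℕ) : Continuous (starCutoff K c k) :=
  let ⟨_, hC⟩ := h.exists_lipschitzWith_starCutoff k
  hC.continuous

theorem lineDeriv_starCutoff_of_mem_cone (k : ℕ) {i : ι} (hi : i ∈ S) {x : E}
    (hx : x ∈ coneOver c (σ i)) (e : E) :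
    lineDeriv ℝ (starCutoff K c k) x e =
      -((k + 1) * (⟪n i, x - c⟫ / δ i) ^ k * (⟪n i, e⟫ / δ i)) := by
  have locally_pow : starCutoff K c k =ᶠ[𝓝 x] fun y => 1 - (⟪n i, y - c⟫ / δ i) ^ (k + 1) := by
    filter_upwards [(h.isOpen_cone hi).mem_nhds hx] with y hy
    rw [starCutoff, min_eq_left (h.starGauge_lt_one_iff.2 (h.cone_subset hi hy)).le,
      h.starGauge_eq_of_mem_cone hi hy]
  have linear : HasLineDerivAt ℝ (fun y : E => ⟪n i, y - c⟫ / δ i) (⟪n i, e⟫ / δ i) x e := by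
    have along_line : (fun t : ℝ => ⟪n i, x + t • e - c⟫ / δ i) =
        fun t : ℝ => ⟪n i, x - c⟫ / δ i + t * (⟪n i, e⟫ / δ i) := by
      ext t
      rw [add_sub_right_comm, inner_add_right, inner_smul_right]
      ring
    rw [HasLineDerivAt, along_line]
    simpa using ((hasDerivAt_id (0 : ℝ)).mul_const (⟪n i, e⟫ / δ i)).const_add
      (⟪n i, x - c⟫ / δ i)
  rw [locally_pow.lineDeriv_eq]
  refine HasLineDerivAt.lineDeriv ?_
  simpa [HasLineDerivAt] using (HasDerivAt.fun_pow linear (k + 1)).const_sub 1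

variable [FiniteDimensional ℝ E]

theorem hasCompactSupport_starCutoff (k : ℕ) : HasCompactSupport (starCutoff K c k) :=
  HasCompactSupport.intro h.isBounded.isCompact_closure
    fun _ hx => h.starCutoff_eq_zero k fun hxK => hx (subset_closure hxK)

theorem ae_lineDeriv_starCutoff [Nontrivial E] (k : ℕ) (e : E) :
    ∀ᵐ x : E, lineDeriv ℝ (starCutoff K c k) x e =
      ∑ i ∈ S, (coneOver c (σ i)).indicator
        (fun x => -((k + 1) * (⟪n i, x - c⟫ / δ i) ^ k * (⟪n i, e⟫ / δ i))) x := by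
  filter_upwards [h.ae_mem_cone] with x hx
  by_cases hxK : x ∈ closure K
  · obtain ⟨i, hi, hxi⟩ := hx hxK
    rw [h.lineDeriv_starCutoff_of_mem_cone k hi hxi, Finset.sum_eq_single_of_mem i hi,
      Set.indicator_of_mem hxi]
    exact fun j hj hji => Set.indicator_of_notMem
      (Set.disjoint_left.1 (h.cone_disjoint hi hj hji.symm) hxi) _
  · have locally_zero : starCutoff K c k =ᶠ[𝓝 x] fun _ => 0 := by
      filter_upwards [isClosed_closure.isOpen_compl.mem_nhds hxK] with y hy
      exact h.starCutoff_eq_zero k fun hyK => hy (subset_closure hyK)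
    rw [locally_zero.lineDeriv_eq, Finset.sum_eq_zero]
    · simp [lineDeriv]
    exact fun i hi =>
      Set.indicator_of_notMem (fun hxi => hxK (subset_closure (h.cone_subset hi hxi))) _

theorem euclideanHausdorffMeasure_edge_lt_top {i : ι} (hi : i ∈ S) :
    μHE[Module.finrank ℝ E - 1] (σ i) < ⊤ :=
  euclideanHausdorffMeasure_lt_top_of_isBounded (h.norm_normal i hi) (h.height_pos i hi)
    (fun _ hy => h.inner_eq hi hy) (h.measurableSet_edge hi) (h.isBounded_edge hi)

theorem integrableOn_cone {F : Type*} [NormedAddCommGroup F] {f : E → F}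
    (hf : Continuous f) {i : ι} (hi : i ∈ S) : IntegrableOn f (coneOver c (σ i)) :=
  (hf.continuousOn.integrableOn_compact
    (isBounded_coneOver (h.isBounded_edge hi)).isCompact_closure).mono_set subset_closure

theorem integral_cone {F : Type*} [NormedAddCommGroup F] [NormedSpace ℝ F] {i : ι} (hi : i ∈ S)
    {f : E → F} (hf : Continuous f) :
    ∫ x in coneOver c (σ i), f x = ∫ t in (0 : ℝ)..1, (δ i * t ^ (Module.finrank ℝ E - 1)) •
      ∫ y in σ i, f (c + t • (y - c)) ∂μHE[Module.finrank ℝ E - 1] :=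
  integral_coneOver (h.norm_normal i hi) (h.height_pos i hi) (fun _ hy => h.inner_eq hi hy)
    (h.measurableSet_edge hi) (h.euclideanHausdorffMeasure_edge_lt_top hi)
    (h.integrableOn_cone hf hi)

theorem integral_cone_pow_mul {i : ι} (hi : i ∈ S) (k : ℕ) {a : E → ℝ} (ha : Continuous a) :
    ∫ x in coneOver c (σ i), (⟪n i, x - c⟫ / δ i) ^ k * a x =
      δ i * ∫ t in (0 : ℝ)..1, t ^ k * (t ^ (Module.finrank ℝ E - 1) *
        ∫ y in σ i, a (c + t • (y - c)) ∂μHE[Module.finrank ℝ E - 1]) := by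
  rw [h.integral_cone hi (by fun_prop), ← intervalIntegral.integral_const_mul]
  refine intervalIntegral.integral_congr fun t _ => ?_
  have slice : ∫ y in σ i, (⟪n i, c + t • (y - c) - c⟫ / δ i) ^ k * a (c + t • (y - c))
      ∂μHE[Module.finrank ℝ E - 1] =
      ∫ y in σ i, t ^ k * a (c + t • (y - c)) ∂μHE[Module.finrank ℝ E - 1] := by
    refine setIntegral_congr_fun (h.measurableSet_edge hi) fun y hy => ?_
    rw [add_sub_cancel_left, inner_smul_right, h.inner_eq hi hy,
      mul_div_cancel_right₀ _ (h.height_pos i hi).ne']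
  rw [slice, integral_const_mul, smul_eq_mul]
  ring

theorem integral_lineDeriv_starCutoff_mul [Nontrivial E] (k : ℕ) {a : E → ℝ} (ha : Continuous a)
    (e : E) :
    ∫ x, lineDeriv ℝ (starCutoff K c k) x e * a x = -∑ i ∈ S, ⟪n i, e⟫ * ((k + 1) *
      ∫ t in (0 : ℝ)..1, t ^ k * (t ^ (Module.finrank ℝ E - 1) *
        ∫ y in σ i, a (c + t • (y - c)) ∂μHE[Module.finrank ℝ E - 1])) := by
  have coneDeriv : ∀ᵐ x : E, lineDeriv ℝ (starCutoff K c k) x e * a x =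
      ∑ i ∈ S, (coneOver c (σ i)).indicator
        (fun x => -(⟪n i, e⟫ / δ i * (k + 1)) * ((⟪n i, x - c⟫ / δ i) ^ k * a x)) x := by
    filter_upwards [h.ae_lineDeriv_starCutoff k e] with x hx
    rw [hx, Finset.sum_mul]
    refine Finset.sum_congr rfl fun i _ => ?_
    rw [← Set.indicator_mul_left]
    congr 1 with x
    ring
  rw [integral_congr_ae coneDeriv, integral_finsetSum, ← Finset.sum_neg_distrib]
  · refine Finset.sum_congr rfl fun i hi => ?_
    rw [integral_indicator (h.isOpen_cone hi).measurableSet, integral_const_mul,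
      h.integral_cone_pow_mul hi k ha]
    have := (h.height_pos i hi).ne'
    field_simp
  · intro i hi
    rw [integrable_indicator_iff (h.isOpen_cone hi).measurableSet]
    exact h.integrableOn_cone (by fun_prop) hi

theorem integral_fderiv_mul_starCutoff [Nontrivial E] (k : ℕ) {a : E → ℝ} (ha : ContDiff ℝ 1 a)
    (hac : HasCompactSupport a) (e : E) :
    ∫ x in K, fderiv ℝ a x e * starCutoff K c k x = ∑ i ∈ S, ⟪n i, e⟫ * ((k + 1) *
      ∫ t in (0 : ℝ)..1, t ^ k * (t ^ (Module.finrank ℝ E - 1) *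
        ∫ y in σ i, a (c + t • (y - c)) ∂μHE[Module.finrank ℝ E - 1])) := by
  obtain ⟨C, hC⟩ := h.exists_lipschitzWith_starCutoff k
  obtain ⟨C', hC'⟩ := ha.lipschitzWith_of_hasCompactSupport hac one_ne_zero
  have lineDeriv_eq (x : E) : fderiv ℝ a x e = lineDeriv ℝ a x e :=
    ((ha.differentiable one_ne_zero) x).lineDeriv_eq_fderiv.symm
  rw [setIntegral_eq_integral_of_forall_compl_eq_zero fun x hx => by
    rw [h.starCutoff_eq_zero k hx, mul_zero]]
  simp_rw [lineDeriv_eq]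
  rw [hC'.integral_lineDeriv_mul_eq hC (h.hasCompactSupport_starCutoff k),
    h.integral_lineDeriv_starCutoff_mul k ha.continuous]
  simp only [inner_neg_right, neg_mul, Finset.sum_neg_distrib, neg_neg]

theorem tendsto_integral_mul_starCutoff {f : E → ℝ} (hf : Continuous f) :
    Tendsto (fun k => ∫ x in K, f x * starCutoff K c k x) atTop (𝓝 (∫ x in K, f x)) := by
  refine tendsto_integral_of_dominated_convergence (fun x => ‖f x‖)
    (fun k => (hf.mul (h.continuous_starCutoff k)).aestronglyMeasurable)
    ((hf.norm.continuousOn.integrableOn_compact h.isBounded.isCompact_closure).mono_set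
      subset_closure)
    (fun k => Eventually.of_forall fun x => ?_) ?_
  · rw [norm_mul]
    exact mul_le_of_le_one_right (norm_nonneg _) (abs_starCutoff_le_one K c k x)
  · filter_upwards [ae_restrict_mem h.isOpen.measurableSet] with x hx
    simpa using (h.tendsto_starCutoff hx).const_mul (f x)

theorem tendsto_integral_pow_mul_integral_edge {i : ι} (hi : i ∈ S) {a : E → ℝ}
    (ha : Continuous a) (hac : HasCompactSupport a) :
    Tendsto (fun k : ℕ => ((k : ℝ) + 1) *
      ∫ t in (0 : ℝ)..1, t ^ k * (t ^ (Module.finrank ℝ E - 1) *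
        ∫ y in σ i, a (c + t • (y - c)) ∂μHE[Module.finrank ℝ E - 1])) atTop
      (𝓝 (∫ y in σ i, a y ∂μHE[Module.finrank ℝ E - 1])) := by
  have : IsFiniteMeasure ((μHE[Module.finrank ℝ E - 1] : Measure E).restrict (σ i)) :=
    ⟨by simpa using h.euclideanHausdorffMeasure_edge_lt_top hi⟩
  obtain ⟨M, hM⟩ := hac.exists_bound_of_continuous ha
  have slice_continuous : Continuous fun t : ℝ =>
      ∫ y in σ i, a (c + t • (y - c)) ∂μHE[Module.finrank ℝ E - 1] :=
    continuous_of_dominated (bound := fun _ => M)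
      (fun t => Continuous.aestronglyMeasurable (by fun_prop))
      (fun t => Eventually.of_forall fun y => hM _) (integrable_const _)
      (Eventually.of_forall fun y => by fun_prop)
  simpa using tendsto_integral_pow_mul ((continuous_pow _).mul slice_continuous)

theorem integral_fderiv_of_hasCompactSupport [Nontrivial E] {a : E → ℝ} (ha : ContDiff ℝ 1 a)
    (hac : HasCompactSupport a) (e : E) :
    ∫ x in K, fderiv ℝ a x e =
      ∑ i ∈ S, ⟪n i, e⟫ * ∫ y in σ i, a y ∂μHE[Module.finrank ℝ E - 1] := by
  have volume_limit := h.tendsto_integral_mul_starCutoff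
    (f := fun x => fderiv ℝ a x e) ((ha.continuous_fderiv one_ne_zero).clm_apply continuous_const)
  simp only [h.integral_fderiv_mul_starCutoff _ ha hac e] at volume_limit
  exact tendsto_nhds_unique volume_limit <| tendsto_finsetSum _ fun i hi =>
    (h.tendsto_integral_pow_mul_integral_edge hi ha.continuous hac).const_mul _

/-- The divergence theorem on a star-shaped cell; multiplying `a` by a bump function reduces it to
compactly supported `a`. -/
theorem integral_fderiv [Nontrivial E] {a : E → ℝ} (ha : ContDiff ℝ 1 a) (e : E) :
    ∫ x in K, fderiv ℝ a x e =
      ∑ i ∈ S, ⟪n i, e⟫ * ∫ y in σ i, a y ∂μHE[Module.finrank ℝ E - 1] := by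
  obtain ⟨R, hR0, hR⟩ := h.isBounded.subset_ball_lt 0 c
  let b : ContDiffBump c := ⟨R + 1, R + 2, by linarith, by linarith⟩
  have closure_subset : closure K ⊆ Metric.ball c (R + 1) :=
    (closure_mono hR).trans (Metric.closure_ball_subset_closedBall.trans
      (Metric.closedBall_subset_ball (by linarith)))
  have eq_on_ball : ∀ x ∈ Metric.ball c (R + 1), b x * a x = a x := fun x hx => by
    rw [b.one_of_mem_closedBall (Metric.ball_subset_closedBall hx), one_mul]
  have truncated := h.integral_fderiv_of_hasCompactSupport (a := fun x => b x * a x)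
    (b.contDiff.mul ha) b.hasCompactSupport.mul_right e
  calc ∫ x in K, fderiv ℝ a x e = ∫ x in K, fderiv ℝ (fun x => b x * a x) x e := by
        refine setIntegral_congr_fun h.isOpen.measurableSet fun x hx => ?_
        have : (fun x => b x * a x) =ᶠ[𝓝 x] a :=
          Filter.eventuallyEq_of_mem
            (Metric.isOpen_ball.mem_nhds (closure_subset (subset_closure hx))) eq_on_ball
        rw [this.fderiv_eq]
    _ = ∑ i ∈ S, ⟪n i, e⟫ * ∫ y in σ i, b y * a y ∂μHE[Module.finrank ℝ E - 1] := truncated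
    _ = ∑ i ∈ S, ⟪n i, e⟫ * ∫ y in σ i, a y ∂μHE[Module.finrank ℝ E - 1] := by
        refine Finset.sum_congr rfl fun i hi => congrArg _ ?_
        exact setIntegral_congr_fun (h.measurableSet_edge hi) fun y hy =>
          eq_on_ball y (closure_subset (h.edge_subset_closure hi hy))

end IsStarCell

/-! ### Geometry of a discretisation -/

theorem mem_span_singleton_of_orthogonal {E : Type*} [NormedAddCommGroup E] [InnerProductSpace ℝ E]
    {U : Set E} {m n y : E} {b : ℝ} (hU : IsOpen U) (hy : y ∈ U ∩ {x | ⟪m, x⟫ = b})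
    (hn : ∀ x ∈ U ∩ {x | ⟪m, x⟫ = b}, ⟪n, x - y⟫ = 0) : n ∈ ℝ ∙ m := by
  rw [← (ℝ ∙ m).orthogonal_orthogonal, Submodule.mem_orthogonal']
  intro z hz
  have hmz : ⟪m, z⟫ = 0 := Submodule.mem_orthogonal_singleton_iff_inner_right.1 hz
  have hcont : Tendsto (fun t : ℝ => y + t • z) (𝓝[≠] 0) (𝓝 y) := by
    have : ContinuousAt (fun t : ℝ => y + t • z) 0 := by fun_prop
    simpa [ContinuousAt] using this.tendsto.mono_left (nhdsWithin_le_nhds (s := {0}ᶜ))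
  obtain ⟨t, htU, ht0⟩ :=
    ((hcont.eventually (hU.mem_nhds hy.1)).and self_mem_nhdsWithin).exists
  have hplane : ⟪m, y + t • z⟫ = b := by
    rw [inner_add_right, inner_smul_right, hmz, mul_zero, add_zero, hy.2]
  have := hn _ ⟨htU, hplane⟩
  rw [add_sub_cancel_left, inner_smul_right] at this
  exact (mul_eq_zero.1 this).resolve_left ht0

theorem infDist_hyperplane {E : Type*} [NormedAddCommGroup E] [InnerProductSpace ℝ E] {n : E}
    (hn : ‖n‖ = 1) (c : E) (s : ℝ) : Metric.infDist c {x | ⟪n, x - c⟫ = s} = |s| := by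
  have hmem : c + s • n ∈ {x : E | ⟪n, x - c⟫ = s} := by
    simp [inner_smul_right, hn]
  refine le_antisymm ?_ ((Metric.le_infDist ⟨_, hmem⟩).2 ?_)
  · refine (Metric.infDist_le_dist_of_mem hmem).trans_eq ?_
    rw [dist_self_add_right, norm_smul, hn, mul_one, Real.norm_eq_abs]
  · rintro y rfl
    rw [dist_comm, dist_eq_norm]
    simpa only [hn, one_mul] using abs_real_inner_le_norm n (y - c)

/-- If `⟪n, y - c⟫` were negative, the segments from `c` to the points `y - t • n` would cross the
hyperplane through `y` inside `K` and arbitrarily close to `y`. -/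
theorem inner_sub_nonneg_of_outward {E : Type*} [NormedAddCommGroup E] [InnerProductSpace ℝ E]
    {K U : Set E} {n c y : E} (hK : StarConvex ℝ c K) (hU : IsOpen U) (hyU : y ∈ U)
    (hdisj : Disjoint K (U ∩ {x | ⟪n, x - c⟫ = ⟪n, y - c⟫}))
    (hy : ∀ᶠ t in 𝓝[>] (0 : ℝ), y - t • n ∈ K) : 0 ≤ ⟪n, y - c⟫ := by
  by_contra! hneg
  set s := ⟪n, y - c⟫ with hs
  let r : ℝ → ℝ := fun t => s / (s - t * ‖n‖ ^ 2)
  have hcont : Tendsto (fun t => c + r t • (y - t • n - c)) (𝓝[>] 0) (𝓝 y) := by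
    have hr : ContinuousAt r 0 := continuousAt_const.div (by fun_prop) (by simpa using hneg.ne)
    have : ContinuousAt (fun t => c + r t • (y - t • n - c)) 0 := by fun_prop
    simpa [r, div_self hneg.ne, ContinuousAt] using
      this.tendsto.mono_left (nhdsWithin_le_nhds (s := Set.Ioi 0))
  obtain ⟨t, ⟨htU, htK⟩, ht0 : 0 < t⟩ :=
    (((hcont.eventually (hU.mem_nhds hyU)).and hy).and self_mem_nhdsWithin).exists
  have hst : s - t * ‖n‖ ^ 2 < 0 := by nlinarith [sq_nonneg ‖n‖]
  have hr1 : r t ≤ 1 := by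
    rw [div_le_one_of_neg hst]
    nlinarith [sq_nonneg ‖n‖]
  have hplane : ⟪n, c + r t • (y - t • n - c) - c⟫ = s := by
    rw [add_sub_cancel_left, inner_smul_right, sub_right_comm, inner_sub_right, ← hs,
      inner_smul_right, real_inner_self_eq_norm_sq, div_mul_cancel₀ _ hst.ne]
  exact Set.disjoint_left.1 hdisj
    (hK.add_smul_sub_mem htK (div_nonneg_of_nonpos hneg.le hst.le) hr1) ⟨htU, hplane⟩

namespace Discretisation

variable {d : ℕ} {Ω : Set (Pt d)} (D : Discretisation Ω)

theorem mem_cellsOf {K : D.Cell} {σ : D.Edge} : K ∈ D.cellsOf σ ↔ σ ∈ D.edgesOf K := by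
  simp [cellsOf]

theorem plane_eq_of_mem {K : D.Cell} {σ : D.Edge} (hσ : σ ∈ D.edgesOf K) {y : Pt d}
    (hy : y ∈ D.edge σ) (c : Pt d) :
    D.plane σ = {x | ⟪D.normal K σ, x - c⟫ = ⟪D.normal K σ, y - c⟫} := by
  obtain ⟨m, b, -, hp⟩ := D.plane_isHyperplane σ
  obtain ⟨U, hU, he⟩ := D.edge_open σ
  have hN := D.normal_spec K σ hσ
  rw [hp] at he
  obtain ⟨a, ha⟩ := Submodule.mem_span_singleton.1 <|
    mem_span_singleton_of_orthogonal hU (he ▸ hy) fun x hx => hN.orthogonal x (he ▸ hx) y hy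
  have ha0 : a ≠ 0 := by
    rintro rfl
    simpa [← ha] using hN.norm_eq
  have hyb : ⟪m, y⟫ = b := (he ▸ hy : y ∈ U ∩ {x | ⟪m, x⟫ = b}).2
  ext x
  rw [hp, ← ha]
  simp only [Set.mem_ofPred_eq, real_inner_smul_left, inner_sub_right, mul_right_inj' ha0,
    sub_left_inj, hyb]

theorem measurableSet_edge (σ : D.Edge) : MeasurableSet (D.edge σ) := by
  obtain ⟨m, b, -, hp⟩ := D.plane_isHyperplane σ
  obtain ⟨U, hU, he⟩ := D.edge_open σ
  rw [he, hp]
  exact hU.measurableSet.inter (isClosed_eq (by fun_prop) continuous_const).measurableSet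

theorem edge_subset_frontier {K : D.Cell} {σ : D.Edge} (hσ : σ ∈ D.edgesOf K) :
    D.edge σ ⊆ frontier (D.cell K) := by
  rw [D.frontier_eq K]
  exact subset_closure.trans (Set.subset_biUnion_of_mem (u := fun σ => closure (D.edge σ)) hσ)

theorem edge_subset_closure_cell {K : D.Cell} {σ : D.Edge} (hσ : σ ∈ D.edgesOf K) :
    D.edge σ ⊆ closure (D.cell K) :=
  (D.edge_subset_frontier hσ).trans frontier_subset_closure

theorem disjoint_cell_edge {K : D.Cell} {σ : D.Edge} (hσ : σ ∈ D.edgesOf K) :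
    Disjoint (D.cell K) (D.edge σ) :=
  (Set.disjoint_iff_inter_eq_empty.2 (D.cell_open K).inter_frontier_eq).mono_right
    (D.edge_subset_frontier hσ)

theorem inner_normal_eq_dist {K : D.Cell} {σ : D.Edge} (hσ : σ ∈ D.edgesOf K) {y : Pt d}
    (hy : y ∈ D.edge σ) : ⟪D.normal K σ, y - D.center K⟫ = D.dist K σ := by
  obtain ⟨U, hU, he⟩ := D.edge_open σ
  have hN := D.normal_spec K σ hσ
  have hp := D.plane_eq_of_mem hσ hy (D.center K)
  have hdisj := he ▸ D.disjoint_cell_edge hσ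
  have hnonneg : 0 ≤ ⟪D.normal K σ, y - D.center K⟫ :=
    inner_sub_nonneg_of_outward (D.cell_starShaped K) hU (he ▸ hy : y ∈ U ∩ D.plane σ).1
      (hp ▸ hdisj) ((hN.outward y hy).mono fun _ h => h.1)
  rw [dist, hp, infDist_hyperplane hN.norm_eq, abs_of_nonneg hnonneg]

theorem plane_eq {K : D.Cell} {σ : D.Edge} (hσ : σ ∈ D.edgesOf K) :
    D.plane σ = {x | ⟪D.normal K σ, x - D.center K⟫ = D.dist K σ} := by
  obtain ⟨y, hy⟩ := D.edge_nonempty σ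
  rw [D.plane_eq_of_mem hσ hy (D.center K), D.inner_normal_eq_dist hσ hy]

theorem isStarCell (hΩ : Bornology.IsBounded Ω) (K : D.Cell) :
    IsStarCell (D.cell K) (D.center K) (D.edgesOf K) D.edge (D.normal K) (D.dist K) where
  isOpen := D.cell_open K
  isBounded := hΩ.subset (D.cell_subset K)
  center_mem := D.center_mem K
  starConvex := D.cell_starShaped K
  norm_normal σ hσ := (D.normal_spec K σ hσ).norm_eq
  height_pos := D.dist_pos K
  exists_open σ hσ := D.plane_eq hσ ▸ D.edge_open σ
  boundary_null σ _ := by rw [finrank_euclideanSpace_fin, D.edge_boundary_null σ]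
  frontier_eq := D.frontier_eq K
  disjoint σ _ τ _ hστ := D.edge_disjoint hστ

theorem normal_neg {K L : D.Cell} (hKL : K ≠ L) {σ : D.Edge} (hK : σ ∈ D.edgesOf K)
    (hL : σ ∈ D.edgesOf L) : D.normal L σ = -D.normal K σ := by
  obtain ⟨U, hU, he⟩ := D.edge_open σ
  obtain ⟨y, hy⟩ := D.edge_nonempty σ
  have hNK := D.normal_spec K σ hK
  have hNL := D.normal_spec L σ hL
  rw [D.plane_eq_of_mem hK hy 0] at he
  simp only [sub_zero] at he
  obtain ⟨a, ha⟩ := Submodule.mem_span_singleton.1 <|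
    mem_span_singleton_of_orthogonal hU (he ▸ hy) fun x hx => hNL.orthogonal x (he ▸ hx) y hy
  have habs : |a| = 1 := by
    simpa only [← ha, norm_smul, hNK.norm_eq, mul_one, Real.norm_eq_abs] using hNL.norm_eq
  obtain rfl | rfl := eq_or_eq_neg_of_abs_eq habs
  · obtain ⟨t, ⟨htK, -⟩, htL, -⟩ := ((hNK.outward y hy).and (hNL.outward y hy)).exists
    rw [← ha, one_smul] at htL
    exact (Set.disjoint_left.1 (D.cell_disjoint hKL) htK htL).elim
  · rw [← ha, neg_one_smul]

theorem card_cellsOf (σ : D.Edge) :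
    ((D.cellsOf σ).card = 1 ∧ D.edge σ ⊆ frontier Ω) ∨ (D.cellsOf σ).card = 2 := by
  have : Nat.card {K // σ ∈ D.edgesOf K} = (D.cellsOf σ).card := by
    rw [cellsOf, Nat.card_eq_fintype_card, Fintype.card_subtype]
  exact this ▸ D.edge_cells σ

theorem notMem_extEdges {σ : D.Edge} (h : σ ∈ D.intEdges) : σ ∉ D.extEdges := by
  simp only [extEdges, intEdges, Finset.mem_filter_univ] at h ⊢
  omega

theorem edge_subset_frontier_of_ext {σ : D.Edge} (h : σ ∈ D.extEdges) :
    D.edge σ ⊆ frontier Ω := by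
  rw [extEdges, Finset.mem_filter_univ] at h
  exact ((D.card_cellsOf σ).resolve_right (by omega)).2

theorem exists_cell (σ : D.Edge) : ∃ K, σ ∈ D.edgesOf K := by
  have : (D.cellsOf σ).Nonempty := by
    rw [← Finset.card_pos]
    rcases D.card_cellsOf σ with h | h <;> omega
  exact this.imp fun K => D.mem_cellsOf.1

/-- The two normals of an interior edge are opposite, so that its contributions cancel. -/
theorem sum_edge_inner_normal_eq_zero (q : D.Edge → ℝ) (hq : ∀ σ ∈ D.extEdges, q σ = 0)
    (a : D.Edge → Pt d) :
    ∑ K, ∑ σ ∈ D.edgesOf K, q σ * ⟪D.normal K σ, a σ⟫ = 0 := by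
  classical
  rw [Finset.sum_comm' (t' := Finset.univ) (s' := D.cellsOf) (by simp [D.mem_cellsOf])]
  refine Finset.sum_eq_zero fun σ _ => ?_
  rcases D.card_cellsOf σ with h | h
  · simp [hq σ (by simpa [extEdges] using h.1)]
  · obtain ⟨K, L, hKL, he⟩ := Finset.card_eq_two.1 h
    have hK : σ ∈ D.edgesOf K := D.mem_cellsOf.1 (by simp [he])
    have hL : σ ∈ D.edgesOf L := D.mem_cellsOf.1 (by simp [he])
    rw [he, Finset.sum_pair hKL, D.normal_neg hKL hK hL, inner_neg_left]
    ring

theorem cone_eq (K : D.Cell) (σ : D.Edge) : D.cone K σ = coneOver (D.center K) (D.edge σ) := rfl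

theorem bddAbove_range_diam : BddAbove (Set.range D.diam) := (Set.finite_range _).bddAbove

theorem diam_le_size (K : D.Cell) : D.diam K ≤ D.size := le_ciSup D.bddAbove_range_diam K

theorem size_nonneg : 0 ≤ D.size := Real.iSup_nonneg fun _ => Metric.diam_nonneg

section Bounded

variable (hΩ : Bornology.IsBounded Ω)

include hΩ

theorem surf_edge_lt_top (σ : D.Edge) : surf d (D.edge σ) < ⊤ := by
  obtain ⟨K, hK⟩ := D.exists_cell σ
  simpa only [finrank_euclideanSpace_fin] using
    (D.isStarCell hΩ K).euclideanHausdorffMeasure_edge_lt_top hK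

theorem area_pos (σ : D.Edge) : 0 < D.area σ :=
  ENNReal.toReal_pos (D.edge_measure_pos σ).ne' (D.surf_edge_lt_top hΩ σ).ne

theorem vol_pos (K : D.Cell) : 0 < D.vol K :=
  ENNReal.toReal_pos ((D.cell_open K).measure_pos _ ⟨_, D.center_mem K⟩).ne'
    (hΩ.subset (D.cell_subset K)).measure_lt_top.ne

theorem integrableOn_edge {F : Type*} [NormedAddCommGroup F] (σ : D.Edge)
    {f : Pt d → F} (hf : Continuous f) : IntegrableOn f (D.edge σ) (surf d) := by
  obtain ⟨K, hK⟩ := D.exists_cell σ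
  have hc := ((D.isStarCell hΩ K).isBounded_edge hK).isCompact_closure
  obtain ⟨M, hM⟩ := hc.exists_bound_of_continuousOn hf.continuousOn
  exact Measure.integrableOn_of_bounded (D.surf_edge_lt_top hΩ σ).ne hf.aestronglyMeasurable <|
    (ae_restrict_mem (D.measurableSet_edge σ)).mono fun x hx => hM x (subset_closure hx)

theorem integral_edge_sub (σ : D.Edge) (c : Pt d) :
    ∫ y in D.edge σ, (y - c) ∂(surf d) = D.area σ • (D.bary σ - c) := by
  have hc : IntegrableOn (fun _ : Pt d => c) (D.edge σ) (surf d) :=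
    D.integrableOn_edge hΩ σ continuous_const
  rw [integral_sub (D.integrableOn_edge hΩ σ continuous_id') hc, setIntegral_const, smul_sub,
    area, bary, measure_smul_setAverage _ (D.surf_edge_lt_top hΩ σ).ne]

theorem integral_edge_inner_sub (σ : D.Edge) (c e : Pt d) :
    ∫ y in D.edge σ, ⟪e, y - c⟫ ∂(surf d) = D.area σ * ⟪e, D.bary σ - c⟫ := by
  have h : IntegrableOn (fun y : Pt d => y - c) (D.edge σ) (surf d) :=
    D.integrableOn_edge hΩ σ (by fun_prop)
  rw [integral_inner h, D.integral_edge_sub hΩ, inner_smul_right]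

theorem bary_mem_of_subset {s : Set (Pt d)} (hs : Convex ℝ s) (hsc : IsClosed s) {σ : D.Edge}
    (h : D.edge σ ⊆ s) : D.bary σ ∈ s :=
  hs.set_average_mem hsc (D.edge_measure_pos σ).ne' (D.surf_edge_lt_top hΩ σ).ne
    ((ae_restrict_mem (D.measurableSet_edge σ)).mono fun _ hx => h hx)
    (D.integrableOn_edge hΩ σ continuous_id')

theorem inner_bary_sub_eq {c e : Pt d} {s : ℝ} (σ : D.Edge)
    (h : ∀ y ∈ D.edge σ, ⟪e, y - c⟫ = s) : ⟪e, D.bary σ - c⟫ = s := by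
  have h1 := D.integral_edge_inner_sub hΩ σ c e
  rw [setIntegral_congr_fun (D.measurableSet_edge σ) h, setIntegral_const, smul_eq_mul] at h1
  exact (mul_left_cancel₀ (D.area_pos hΩ σ).ne' h1).symm

theorem norm_sub_le_diam {K : D.Cell} {x y : Pt d} (hx : x ∈ closure (D.cell K))
    (hy : y ∈ closure (D.cell K)) : ‖x - y‖ ≤ D.diam K := by
  rw [← dist_eq_norm, diam, ← Metric.diam_closure]
  exact Metric.dist_le_diam_of_mem (hΩ.subset (D.cell_subset K)).closure hx hy

theorem norm_bary_sub_le {K : D.Cell} {σ : D.Edge} (hσ : σ ∈ D.edgesOf K) {x : Pt d}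
    (hx : x ∈ closure (D.cell K)) : ‖D.bary σ - x‖ ≤ D.diam K := by
  rw [← mem_closedBall_iff_norm]
  exact D.bary_mem_of_subset hΩ (convex_closedBall x _) Metric.isClosed_closedBall fun y hy =>
    mem_closedBall_iff_norm.2 (D.norm_sub_le_diam hΩ (D.edge_subset_closure_cell hσ hy) hx)

theorem dist_le_diam {K : D.Cell} {σ : D.Edge} (hσ : σ ∈ D.edgesOf K) :
    D.dist K σ ≤ D.diam K := by
  obtain ⟨y, hy⟩ := D.edge_nonempty σ
  calc D.dist K σ = ⟪D.normal K σ, y - D.center K⟫ := (D.inner_normal_eq_dist hσ hy).symm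
    _ ≤ ‖D.normal K σ‖ * ‖y - D.center K‖ := real_inner_le_norm _ _
    _ = ‖y - D.center K‖ := by rw [(D.normal_spec K σ hσ).norm_eq, one_mul]
    _ ≤ D.diam K := D.norm_sub_le_diam hΩ (D.edge_subset_closure_cell hσ hy)
      (subset_closure (D.center_mem K))

theorem vol_cone {K : D.Cell} {σ : D.Edge} (hσ : σ ∈ D.edgesOf K) :
    volume.real (D.cone K σ) = D.area σ * D.dist K σ / d := by
  have h := D.isStarCell hΩ K
  rw [cone_eq, volume_real_coneOver (h.norm_normal σ hσ) (h.height_pos σ hσ)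
    (fun y hy => h.inner_eq hσ hy) (D.measurableSet_edge σ), finrank_euclideanSpace_fin, area]
  ring

variable [NeZero d]

theorem integral_cell_fderiv (K : D.Cell) {a : Pt d → ℝ} (ha : ContDiff ℝ 1 a) (e : Pt d) :
    ∫ x in D.cell K, fderiv ℝ a x e =
      ∑ σ ∈ D.edgesOf K, ⟪D.normal K σ, e⟫ * ∫ y in D.edge σ, a y ∂(surf d) := by
  simpa only [finrank_euclideanSpace_fin] using (D.isStarCell hΩ K).integral_fderiv ha e

/-- In tensor notation, `∑_σ |σ| n_{K,σ} ⊗ (x_σ - p) = |K| Id`. -/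
theorem sum_area_inner_mul_inner (K : D.Cell) (p e e' : Pt d) :
    ∑ σ ∈ D.edgesOf K, D.area σ * (⟪D.normal K σ, e⟫ * ⟪e', D.bary σ - p⟫) =
      D.vol K * ⟪e', e⟫ := by
  have hderiv (x : Pt d) : fderiv ℝ (fun x => ⟪e', x - p⟫) x = innerSL ℝ e' :=
    ((innerSL ℝ e').hasFDerivAt.comp x ((hasFDerivAt_id x).sub_const p)).fderiv
  have h := D.integral_cell_fderiv hΩ K (a := fun x => ⟪e', x - p⟫)
    (contDiff_const.inner ℝ (by fun_prop)) e
  simp only [hderiv, innerSL_apply_apply, setIntegral_const, smul_eq_mul,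
    D.integral_edge_inner_sub hΩ] at h
  rw [vol, h]
  exact Finset.sum_congr rfl fun σ _ => by ring

theorem sum_area_inner_smul (K : D.Cell) (g : Pt d) :
    ∑ σ ∈ D.edgesOf K, (D.area σ * ⟪g, D.bary σ - D.center K⟫) • D.normal K σ =
      D.vol K • g := by
  refine ext_inner_right ℝ fun e => ?_
  rw [sum_inner, real_inner_smul_left, ← D.sum_area_inner_mul_inner hΩ K (D.center K) e g]
  refine Finset.sum_congr rfl fun σ _ => ?_
  rw [real_inner_smul_left]
  ring

/-- The trace of `∑_σ |σ| n_{K,σ} ⊗ (x_σ - x_K) = |K| Id`. -/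
theorem sum_area_mul_dist (K : D.Cell) :
    ∑ σ ∈ D.edgesOf K, D.area σ * D.dist K σ = d * D.vol K := by
  let b := EuclideanSpace.basisFun (Fin d) ℝ
  have htrace : ∑ i, ∑ σ ∈ D.edgesOf K,
      D.area σ * (⟪D.normal K σ, b i⟫ * ⟪b i, D.bary σ - D.center K⟫) = d * D.vol K := by
    simp [D.sum_area_inner_mul_inner hΩ]
  rw [← htrace, Finset.sum_comm]
  refine Finset.sum_congr rfl fun σ hσ => ?_
  rw [← Finset.mul_sum, b.sum_inner_mul_inner,
    D.inner_bary_sub_eq hΩ σ fun y hy => D.inner_normal_eq_dist hσ hy]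

theorem sum_vol_cone (K : D.Cell) :
    ∑ σ ∈ D.edgesOf K, volume.real (D.cone K σ) = D.vol K := by
  rw [Finset.sum_congr rfl fun σ hσ => D.vol_cone hΩ hσ, ← Finset.sum_div,
    D.sum_area_mul_dist hΩ, mul_div_cancel_left₀ _ (NeZero.ne (d : ℝ))]

theorem ae_mem_cone : ∀ᵐ x : Pt d, x ∈ Ω → ∃ K, ∃ σ ∈ D.edgesOf K, x ∈ D.cone K σ := by
  filter_upwards [ae_all_iff.2 fun K => (D.isStarCell hΩ K).ae_mem_cone] with x hx hxΩ
  obtain ⟨K, hK⟩ := Set.mem_iUnion.1 (D.closure_eq ▸ subset_closure hxΩ)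
  exact ⟨K, hx K hK⟩

end Bounded

end Discretisation

/-! ### The discrete Poincaré inequality and the scheme -/

/-- Young's inequality for `(x - y) ^ 2` and `x ^ 2`, with weights absorbing half of `x ^ 2` in the
discrete Poincaré inequality. -/
theorem sq_sub_sq_mul_le {m R s δ x y : ℝ} (hm : 0 < m) (hδ : 0 < δ) (hδR : δ ≤ 2 * R)
    (hs : |s| ≤ R) :
    (x ^ 2 - y ^ 2) * s ≤ (2 * m + 2) * R ^ 2 * ((y - x) ^ 2 / δ) + δ * x ^ 2 / (2 * m) := by
  have hcross : 2 * x * (x - y) * s ≤ 2 * m * R ^ 2 * ((y - x) ^ 2 / δ) + δ * x ^ 2 / (2 * m) := by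
    have hsquare : 2 * m * s ^ 2 * ((y - x) ^ 2 / δ) + δ * x ^ 2 / (2 * m) - 2 * x * (x - y) * s =
        (2 * m * s * (y - x) + δ * x) ^ 2 / (2 * m * δ) := by
      field_simp
      ring
    have hnonneg : 0 ≤ (2 * m * s * (y - x) + δ * x) ^ 2 / (2 * m * δ) := by positivity
    have hsR : 2 * m * s ^ 2 * ((y - x) ^ 2 / δ) ≤ 2 * m * R ^ 2 * ((y - x) ^ 2 / δ) := by
      have : s ^ 2 ≤ R ^ 2 := sq_le_sq' (abs_le.1 hs).1 (abs_le.1 hs).2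
      gcongr
    linarith
  have hsq : -((y - x) ^ 2 * s) ≤ 2 * R ^ 2 * ((y - x) ^ 2 / δ) := by
    have hRδ : R ≤ 2 * R ^ 2 / δ := by
      rw [le_div_iff₀ hδ]
      nlinarith
    calc -((y - x) ^ 2 * s) ≤ (y - x) ^ 2 * R := by
          nlinarith [(abs_le.1 hs).1, sq_nonneg (y - x)]
      _ ≤ (y - x) ^ 2 * (2 * R ^ 2 / δ) := by gcongr
      _ = 2 * R ^ 2 * ((y - x) ^ 2 / δ) := by ring
  linear_combination hcross + hsq

theorem bijective_of_apply_self_eq_zero {V : Type*} [AddCommGroup V] [Module ℝ V]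
    [FiniteDimensional ℝ V] (b : V →ₗ[ℝ] Module.Dual ℝ V) (hb : ∀ v, b v v = 0 → v = 0) :
    Function.Bijective b := by
  have hinj : Function.Injective b :=
    (injective_iff_map_eq_zero b).2 fun v hv => hb v (by rw [hv, LinearMap.zero_apply])
  exact ⟨hinj, (LinearMap.injective_iff_surjective_of_finrank_eq_finrank
    Subspace.dual_finrank_eq.symm).1 hinj⟩

namespace Discretisation

variable {d : ℕ} {Ω : Set (Pt d)} (D : Discretisation Ω)

/-- The square of the `L²` norm of the piecewise constant function `Π_M v`. -/
def cellNormSq (v : D.X) : ℝ := ∑ K, D.vol K * v.1 K ^ 2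

section Poincare

variable {R : ℝ} (hR : Ω ⊆ Metric.closedBall 0 R)

include hR

theorem norm_bary_le (σ : D.Edge) : ‖D.bary σ‖ ≤ R := by
  rw [← mem_closedBall_zero_iff]
  exact D.bary_mem_of_subset (Metric.isBounded_closedBall.subset hR) (convex_closedBall 0 R)
    Metric.isClosed_closedBall
    ((D.edge_subset σ).trans (closure_minimal hR Metric.isClosed_closedBall))

theorem diam_le_two_mul (K : D.Cell) : D.diam K ≤ 2 * R :=
  have hKR := (D.cell_subset K).trans hR
  (Metric.diam_mono hKR Metric.isBounded_closedBall).trans <|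
    Metric.diam_closedBall (Metric.nonempty_closedBall.1 ⟨_, hKR (D.center_mem K)⟩)

/-- The divergence theorem for the fields `v_K² ⟪e, x⟫ e` on the cells `K`, whose traces may be
corrected by the single-valued `v_σ²` because normals of neighbouring cells are opposite. -/
theorem cellNormSq_eq_sum [NeZero d] {v : D.X} (hv : ∀ σ ∈ D.extEdges, v.2 σ = 0) {e : Pt d}
    (he : ‖e‖ = 1) :
    D.cellNormSq v = ∑ K, ∑ σ ∈ D.edgesOf K,
      D.area σ * ((v.1 K ^ 2 - v.2 σ ^ 2) * (⟪D.normal K σ, e⟫ * ⟪e, D.bary σ⟫)) := by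
  have hΩ : Bornology.IsBounded Ω := Metric.isBounded_closedBall.subset hR
  have hcancel := D.sum_edge_inner_normal_eq_zero (fun σ => v.2 σ ^ 2)
    (fun σ hσ => by simp [hv σ hσ]) (fun σ => (D.area σ * ⟪e, D.bary σ⟫) • e)
  have hvol (K : D.Cell) :
      D.vol K = ∑ σ ∈ D.edgesOf K, D.area σ * (⟪D.normal K σ, e⟫ * ⟪e, D.bary σ⟫) := by
    simpa [he] using (D.sum_area_inner_mul_inner hΩ K 0 e e).symm
  rw [← sub_zero (D.cellNormSq v), ← hcancel, cellNormSq, ← Finset.sum_sub_distrib]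
  refine Finset.sum_congr rfl fun K _ => ?_
  rw [hvol, Finset.sum_mul, ← Finset.sum_sub_distrib]
  refine Finset.sum_congr rfl fun σ _ => ?_
  rw [inner_smul_right]
  ring

/-- The discrete Poincaré inequality. -/
theorem cellNormSq_le [NeZero d] {v : D.X} (hv : ∀ σ ∈ D.extEdges, v.2 σ = 0) :
    D.cellNormSq v ≤ (4 * d + 4) * R ^ 2 * D.seminormSq v := by
  have hΩ : Bornology.IsBounded Ω := Metric.isBounded_closedBall.subset hR
  have hd : (0 : ℝ) < d := Nat.cast_pos.2 (NeZero.pos d)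
  obtain ⟨e, he⟩ := exists_norm_eq (Pt d) zero_le_one
  have hedge : ∀ K, ∀ σ ∈ D.edgesOf K,
      D.area σ * ((v.1 K ^ 2 - v.2 σ ^ 2) * (⟪D.normal K σ, e⟫ * ⟪e, D.bary σ⟫)) ≤
        (2 * d + 2) * R ^ 2 * (D.area σ / D.dist K σ * (v.2 σ - v.1 K) ^ 2) +
          D.area σ * D.dist K σ * (v.1 K ^ 2 / (2 * d)) := by
    intro K σ hσ
    have hs : |⟪D.normal K σ, e⟫ * ⟪e, D.bary σ⟫| ≤ R := by
      rw [abs_mul, ← one_mul R]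
      refine mul_le_mul ?_ ?_ (abs_nonneg _) zero_le_one
      · simpa [he, (D.normal_spec K σ hσ).norm_eq] using abs_real_inner_le_norm (D.normal K σ) e
      · refine (abs_real_inner_le_norm _ _).trans ?_
        rw [he, one_mul]
        exact D.norm_bary_le hR σ
    refine (mul_le_mul_of_nonneg_left (sq_sub_sq_mul_le hd (D.dist_pos K σ hσ)
      ((D.dist_le_diam hΩ hσ).trans (D.diam_le_two_mul hR K)) hs)
      (D.area_pos hΩ σ).le).trans_eq ?_
    rw [dist]
    ring
  have habsorb : D.cellNormSq v ≤
      (2 * d + 2) * R ^ 2 * D.seminormSq v + D.cellNormSq v / 2 := by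
    conv_lhs => rw [D.cellNormSq_eq_sum hR hv he]
    refine (Finset.sum_le_sum fun K _ => Finset.sum_le_sum fun σ hσ => hedge K σ hσ).trans_eq ?_
    simp_rw [Finset.sum_add_distrib, ← Finset.sum_mul, D.sum_area_mul_dist hΩ, ← Finset.mul_sum]
    rw [seminormSq, cellNormSq, Finset.sum_div]
    congr 1
    refine Finset.sum_congr rfl fun K _ => ?_
    field_simp
  linarith

end Poincare

section WellPosed

variable (hΩ : Bornology.IsBounded Ω)

include hΩ

theorem area_div_dist_pos {K : D.Cell} {σ : D.Edge} (hσ : σ ∈ D.edgesOf K) :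
    0 < D.area σ / D.dist K σ :=
  div_pos (D.area_pos hΩ σ) (D.dist_pos K σ hσ)

theorem seminormSq_nonneg (v : D.X) : 0 ≤ D.seminormSq v :=
  Finset.sum_nonneg fun _ _ => Finset.sum_nonneg fun _ hσ =>
    mul_nonneg (D.area_div_dist_pos hΩ hσ).le (sq_nonneg _)

theorem eq_zero_of_seminormSq_eq_zero [NeZero d] {v : D.X} (hv : ∀ σ ∈ D.extEdges, v.2 σ = 0)
    (h : D.seminormSq v = 0) : v = 0 := by
  obtain ⟨R, hR⟩ := hΩ.subset_closedBall 0
  have hcellterm : ∀ K ∈ Finset.univ, 0 ≤ D.vol K * v.1 K ^ 2 := fun K _ =>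
    mul_nonneg (D.vol_pos hΩ K).le (sq_nonneg _)
  have hedgeterm : ∀ K, ∀ σ ∈ D.edgesOf K, 0 ≤ D.area σ / D.dist K σ * (v.2 σ - v.1 K) ^ 2 :=
    fun K σ hσ => mul_nonneg (D.area_div_dist_pos hΩ hσ).le (sq_nonneg _)
  have hcell (K : D.Cell) : v.1 K = 0 := by
    have hzero : D.cellNormSq v = 0 := le_antisymm
      ((D.cellNormSq_le hR hv).trans_eq (by rw [h, mul_zero])) (Finset.sum_nonneg hcellterm)
    have := (Finset.sum_eq_zero_iff_of_nonneg hcellterm).1 hzero K (Finset.mem_univ K)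
    exact pow_eq_zero_iff two_ne_zero |>.1
      ((mul_eq_zero.1 this).resolve_left (D.vol_pos hΩ K).ne')
  have hedge (σ : D.Edge) : v.2 σ = 0 := by
    obtain ⟨K, hσ⟩ := D.exists_cell σ
    have hK := (Finset.sum_eq_zero_iff_of_nonneg
      fun K _ => Finset.sum_nonneg (hedgeterm K)).1 h K (Finset.mem_univ K)
    have := (Finset.sum_eq_zero_iff_of_nonneg (hedgeterm K)).1 hK σ hσ
    rw [hcell, sub_zero, mul_eq_zero] at this
    exact pow_eq_zero_iff two_ne_zero |>.1
      (this.resolve_left (D.area_div_dist_pos hΩ hσ).ne')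
  exact Prod.ext (funext hcell) (funext hedge)

omit hΩ in
/-- The space `X_{D,B}` as a submodule of `X_D`. -/
def submoduleXB (B : Finset D.Edge) (β : D.Edge → D.Cell → ℝ) : Submodule ℝ D.X where
  carrier := {v | D.MemXB B β v}
  add_mem' {v w} hv hw := by
    refine ⟨fun σ hσ => ?_, fun σ hσ => ?_⟩
    · simp [hv.1 σ hσ, hw.1 σ hσ]
    · simp [hv.2 σ hσ, hw.2 σ hσ, mul_add, Finset.sum_add_distrib]
  zero_mem' := ⟨fun σ _ => by simp, fun σ _ => by simp⟩
  smul_mem' r v hv := by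
    refine ⟨fun σ hσ => ?_, fun σ hσ => ?_⟩
    · simp [hv.1 σ hσ]
    · simp [hv.2 σ hσ, Finset.mul_sum, mul_left_comm]

omit hΩ in
/-- The bilinear form `⟨u, v⟩_F` as a bilinear map. -/
def formBilin (F : D.Fluxes) : D.X →ₗ[ℝ] D.X →ₗ[ℝ] ℝ :=
  ∑ K, ∑ σ ∈ D.edgesOf K, (F K σ).smulRight
    ((LinearMap.proj K).comp (LinearMap.fst ℝ (D.Cell → ℝ) (D.Edge → ℝ)) -
      (LinearMap.proj σ).comp (LinearMap.snd ℝ (D.Cell → ℝ) (D.Edge → ℝ)))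

omit hΩ in
theorem formBilin_apply (F : D.Fluxes) (u v : D.X) : D.formBilin F u v = D.form F u v := by
  simp [formBilin, form, LinearMap.sum_apply]

theorem existsUnique_schemeSolution [NeZero d] {α : ℝ} (hα : 0 < α) (B : Finset D.Edge)
    (β : D.Edge → D.Cell → ℝ) {F : D.Fluxes} (hF : D.IsCoercive F α) (f : Pt d → ℝ) :
    ∃! w : D.X, D.IsSchemeSolution B β F f w := by
  let W := D.submoduleXB B β
  let T : W →ₗ[ℝ] Module.Dual ℝ W := (D.formBilin F).domRestrict₁₂ W W
  have hT (w v : W) : T w v = D.form F w v := D.formBilin_apply F w v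
  have hbij : Function.Bijective T := by
    refine bijective_of_apply_self_eq_zero T fun w hw => Subtype.ext ?_
    have hle : α * D.seminormSq w ≤ 0 := (hF w).trans_eq ((hT w w).symm.trans hw)
    exact D.eq_zero_of_seminormSq_eq_zero hΩ w.2.1 <|
      le_antisymm (nonpos_of_mul_nonpos_right hle hα) (D.seminormSq_nonneg hΩ w)
  let ℓ : Module.Dual ℝ W := ∑ K, (∫ x in D.cell K, f x) •
    ((LinearMap.proj K).comp (LinearMap.fst ℝ (D.Cell → ℝ) (D.Edge → ℝ))).comp W.subtype
  have hℓ (v : W) : ℓ v = ∑ K, v.1.1 K * ∫ x in D.cell K, f x := by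
    simp [ℓ, LinearMap.sum_apply, mul_comm]
  obtain ⟨w, hw, huniq⟩ := hbij.existsUnique ℓ
  refine ⟨w, ⟨w.2, fun v hv => ?_⟩, fun w' hw' => congrArg Subtype.val (huniq ⟨w', hw'.1⟩ ?_)⟩
  · rw [← hℓ ⟨v, hv⟩, ← hw, hT]
  · ext v
    rw [hT, hℓ]
    exact hw'.2 v v.2

end WellPosed

theorem memXB_interpB {B : Finset D.Edge} {β : D.Edge → D.Cell → ℝ} (hB : B ⊆ D.intEdges)
    (u : Pt d → ℝ) : D.MemXB B β (D.interpB B β u) := by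
  refine ⟨fun σ hσ => by simp [interpB, hσ], fun σ hσ => ?_⟩
  simp [interpB, hσ, D.notMem_extEdges (hB hσ)]

/-- The consistency error of the flux through `σ`; `consErr` is a weighted `ℓ²` norm of these. -/
def fluxErr (B : Finset D.Edge) (β : D.Edge → D.Cell → ℝ) (F : D.Fluxes) (u : Pt d → ℝ)
    (K : D.Cell) (σ : D.Edge) : ℝ :=
  F K σ (D.interpB B β u) + ∫ x in D.edge σ, ⟪∇ u x, D.normal K σ⟫ ∂(surf d)

section ErrorEstimate

variable (hΩ : Bornology.IsBounded Ω) {B : Finset D.Edge} {β : D.Edge → D.Cell → ℝ}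
  {F : D.Fluxes} {f u : Pt d → ℝ} {uD : D.X}

include hΩ

theorem consErr_sq : D.consErr B β F u ^ 2 =
    ∑ K, ∑ σ ∈ D.edgesOf K, D.dist K σ / D.area σ * D.fluxErr B β F u K σ ^ 2 :=
  Real.sq_sqrt <| Finset.sum_nonneg fun _ _ => Finset.sum_nonneg fun σ _ =>
    mul_nonneg (div_nonneg Metric.infDist_nonneg (D.area_pos hΩ σ).le) (sq_nonneg _)

theorem sum_mul_sq_le_weighted (r y : D.Cell → D.Edge → ℝ) :
    (∑ K, ∑ σ ∈ D.edgesOf K, r K σ * y K σ) ^ 2 ≤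
      (∑ K, ∑ σ ∈ D.edgesOf K, D.dist K σ / D.area σ * r K σ ^ 2) *
        ∑ K, ∑ σ ∈ D.edgesOf K, D.area σ / D.dist K σ * y K σ ^ 2 := by
  simp only [Finset.sum_sigma']
  have hpos : ∀ p ∈ Finset.univ.sigma D.edgesOf, 0 < D.area p.2 / D.dist p.1 p.2 :=
    fun p hp => D.area_div_dist_pos hΩ (Finset.mem_sigma.1 hp).2
  refine Finset.sum_sq_le_sum_mul_sum_of_sq_le_mul _ (fun p hp => ?_) (fun p hp => ?_)
    (fun p hp => ?_)
  · rw [← inv_div]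
    exact mul_nonneg (inv_nonneg.2 (hpos p hp).le) (sq_nonneg _)
  · exact mul_nonneg (hpos p hp).le (sq_nonneg _)
  · rw [← inv_div, mul_mul_mul_comm, inv_mul_cancel₀ (hpos p hp).ne', one_mul, mul_pow]

theorem form_sub_interpB_eq (hB : B ⊆ D.intEdges) (hu : Continuous (∇ u))
    (hfu : ∀ K, ∫ x in D.cell K, f x =
      -∑ σ ∈ D.edgesOf K, ⟪D.normal K σ, ∫ y in D.edge σ, ∇ u y ∂(surf d)⟫)
    (huD : D.IsSchemeSolution B β F f uD) {w : D.X} (hw : w = uD - D.interpB B β u) :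
    D.form F w w = ∑ K, ∑ σ ∈ D.edgesOf K, D.fluxErr B β F u K σ * (w.2 σ - w.1 K) := by
  have hwB : D.MemXB B β w := hw ▸ (D.submoduleXB B β).sub_mem huD.1 (D.memXB_interpB hB u)
  have hflux (K : D.Cell) (σ : D.Edge) : ∫ x in D.edge σ, ⟪∇ u x, D.normal K σ⟫ ∂(surf d) =
      ⟪D.normal K σ, ∫ y in D.edge σ, ∇ u y ∂(surf d)⟫ := by
    simp only [← integral_inner (D.integrableOn_edge hΩ σ hu), real_inner_comm]
  have hcancel := D.sum_edge_inner_normal_eq_zero w.2 hwB.1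
    (fun σ => ∫ y in D.edge σ, ∇ u y ∂(surf d))
  have hform : D.form F w w = D.form F uD w - D.form F (D.interpB B β u) w := by
    simp only [← formBilin_apply, ← LinearMap.sub_apply, ← map_sub, hw]
  rw [hform, huD.2 w hwB, form, ← sub_zero (_ - _), ← neg_zero, ← hcancel]
  simp only [← Finset.sum_neg_distrib, ← Finset.sum_sub_distrib, hfu, mul_neg, Finset.mul_sum,
    fluxErr, hflux]
  exact Finset.sum_congr rfl fun K _ => Finset.sum_congr rfl fun σ _ => by ring

theorem sqrt_seminormSq_sub_interpB_le {α : ℝ} (hα : 0 < α) (hB : B ⊆ D.intEdges)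
    (hF : D.IsCoercive F α) (hu : Continuous (∇ u))
    (hfu : ∀ K, ∫ x in D.cell K, f x =
      -∑ σ ∈ D.edgesOf K, ⟪D.normal K σ, ∫ y in D.edge σ, ∇ u y ∂(surf d)⟫)
    (huD : D.IsSchemeSolution B β F f uD) :
    √(D.seminormSq (uD - D.interpB B β u)) ≤ D.consErr B β F u / α := by
  set w := uD - D.interpB B β u with hw
  have hS := D.seminormSq_nonneg hΩ w
  have hcs : D.form F w w ^ 2 ≤ D.consErr B β F u ^ 2 * D.seminormSq w := by
    rw [D.form_sub_interpB_eq hΩ hB hu hfu huD hw, D.consErr_sq hΩ]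
    exact D.sum_mul_sq_le_weighted hΩ _ fun K σ => w.2 σ - w.1 K
  have hmul : α * D.seminormSq w ≤ D.consErr B β F u * √(D.seminormSq w) := by
    refine (hF w).trans
      (le_of_sq_le_sq ?_ (mul_nonneg (Real.sqrt_nonneg _) (Real.sqrt_nonneg _)))
    rwa [mul_pow, Real.sq_sqrt hS]
  rw [le_div_iff₀ hα]
  rcases (Real.sqrt_nonneg (D.seminormSq w)).eq_or_lt with h0 | hpos
  · rw [← h0, zero_mul]
    exact Real.sqrt_nonneg _
  · refine le_of_mul_le_mul_right ?_ hpos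
    rwa [mul_right_comm, Real.mul_self_sqrt hS, mul_comm]

end ErrorEstimate

end Discretisation

/-! ### Weak solutions of class `C²` -/

section Gradient

variable {E : Type*} [NormedAddCommGroup E] [InnerProductSpace ℝ E] [CompleteSpace E]

theorem contDiff_gradient {u : E → ℝ} {m k : WithTop ℕ∞} (hu : ContDiff ℝ k u)
    (hmk : m + 1 ≤ k) : ContDiff ℝ m (∇ u) :=
  (InnerProductSpace.toDual ℝ E).symm.toContinuousLinearEquiv.contDiff.comp (hu.fderiv_right hmk)

theorem continuous_gradient {u : E → ℝ} (hu : ContDiff ℝ 1 u) : Continuous (∇ u) :=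
  (contDiff_gradient (m := 0) hu (zero_add 1).le).continuous

theorem contDiff_inner_gradient {u : E → ℝ} (hu : ContDiff ℝ 2 u) (e : E) :
    ContDiff ℝ 1 fun y => ⟪∇ u y, e⟫ :=
  (contDiff_gradient hu one_add_one_eq_two.le).inner ℝ contDiff_const

theorem tsupport_gradient_subset (u : E → ℝ) : tsupport (∇ u) ⊆ tsupport u := by
  have hcomp : ∇ u = (InnerProductSpace.toDual ℝ E).symm ∘ fderiv ℝ u := rfl
  rw [hcomp]
  exact (tsupport_comp_subset (map_zero _) _).trans (tsupport_fderiv_subset ℝ)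

theorem hasCompactSupport_gradient {u : E → ℝ} (hu : HasCompactSupport u) :
    HasCompactSupport (∇ u) :=
  hu.mono' (subset_closure.trans (tsupport_gradient_subset u))

end Gradient

section IntegrationByParts

variable {E : Type*} [NormedAddCommGroup E] [InnerProductSpace ℝ E] [FiniteDimensional ℝ E]

theorem laplacian_eq_sum_inner_gradient {u : E → ℝ} (hu : ContDiff ℝ 2 u) {ι : Type*} [Fintype ι]
    (b : OrthonormalBasis ι ℝ E) (x : E) :
    (Δ u) x = ∑ i, ⟪∇ (fun y => ⟪∇ u y, b i⟫) x, b i⟫ := by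
  rw [InnerProductSpace.laplacian_eq_iteratedFDeriv_orthonormalBasis u b]
  refine Finset.sum_congr rfl fun i _ => ?_
  have hdiff : DifferentiableAt ℝ (fderiv ℝ u) x :=
    (hu.fderiv_right one_add_one_eq_two.le).differentiable one_ne_zero x
  simp_rw [iteratedFDeriv_two_apply, inner_gradient_left]
  rw [fderiv_clm_apply hdiff (differentiableAt_const _)]
  simp

theorem continuous_laplacian {u : E → ℝ} (hu : ContDiff ℝ 2 u) : Continuous (Δ u) := by
  have hsum := funext (laplacian_eq_sum_inner_gradient hu (stdOrthonormalBasis ℝ E))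
  rw [hsum]
  exact continuous_finsetSum _ fun i _ =>
    (continuous_gradient (contDiff_inner_gradient hu _)).inner continuous_const

variable [MeasurableSpace E] [BorelSpace E] {μ : Measure E} [μ.IsAddHaarMeasure]

theorem integral_mul_inner_gradient {a φ : E → ℝ} (ha : ContDiff ℝ 1 a) (hφ : ContDiff ℝ 1 φ)
    (hc : HasCompactSupport φ) (e : E) :
    ∫ x, a x * ⟪∇ φ x, e⟫ ∂μ = -∫ x, ⟪∇ a x, e⟫ * φ x ∂μ := by
  simp_rw [inner_gradient_left]
  have ha' : Continuous fun x => fderiv ℝ a x e :=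
    (ha.continuous_fderiv one_ne_zero).clm_apply continuous_const
  have hφ' : Continuous fun x => fderiv ℝ φ x e :=
    (hφ.continuous_fderiv one_ne_zero).clm_apply continuous_const
  refine integral_mul_fderiv_eq_neg_fderiv_mul_of_integrable ?_ ?_ ?_
    (fun x _ => ha.differentiable one_ne_zero x) (fun x _ => hφ.differentiable one_ne_zero x)
  · exact (ha'.mul hφ.continuous).integrable_of_hasCompactSupport hc.mul_left
  · exact (ha.continuous.mul hφ').integrable_of_hasCompactSupport
      (hc.fderiv_apply (𝕜 := ℝ) e).mul_left
  · exact (ha.continuous.mul hφ.continuous).integrable_of_hasCompactSupport hc.mul_left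

theorem setIntegral_mul_inner_gradient {Ω : Set E} {a φ : E → ℝ} (ha : ContDiff ℝ 1 a)
    (hφ : ContDiff ℝ 1 φ) (hc : HasCompactSupport φ) (hs : tsupport φ ⊆ Ω) (e : E) :
    ∫ x in Ω, a x * ⟪∇ φ x, e⟫ ∂μ = -∫ x in Ω, ⟪∇ a x, e⟫ * φ x ∂μ := by
  have hφ0 (x : E) (hx : x ∉ Ω) : φ x = 0 := image_eq_zero_of_notMem_tsupport fun h => hx (hs h)
  have hgrad0 (x : E) (hx : x ∉ Ω) : ∇ φ x = 0 := image_eq_zero_of_notMem_tsupport fun h =>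
    hx (hs (tsupport_gradient_subset φ h))
  rw [setIntegral_eq_integral_of_forall_compl_eq_zero fun x hx => by simp [hgrad0 x hx],
    setIntegral_eq_integral_of_forall_compl_eq_zero fun x hx => by simp [hφ0 x hx]]
  exact integral_mul_inner_gradient ha hφ hc e

omit [InnerProductSpace ℝ E] [FiniteDimensional ℝ E] [μ.IsAddHaarMeasure] in
theorem memLp_restrict_of_isBounded [ProperSpace E] {F : Type*} [NormedAddCommGroup F] {s : Set E}
    (hs : Bornology.IsBounded s) (hμs : μ s ≠ ⊤) {f : E → F} (hf : Continuous f)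
    {p : ENNReal} : MemLp f p (μ.restrict s) := by
  have : IsFiniteMeasure (μ.restrict s) := ⟨by simpa using hμs.lt_top⟩
  obtain ⟨M, hM⟩ := hs.isCompact_closure.exists_bound_of_continuousOn hf.continuousOn
  refine .of_bound hf.aestronglyMeasurable M ?_
  exact ae_restrict_of_ae_restrict_of_subset subset_closure
    ((ae_restrict_mem isClosed_closure.measurableSet).mono hM)

theorem setIntegral_inner_gradient_gradient {Ω : Set E} (hΩ : Bornology.IsBounded Ω)
    {u φ : E → ℝ} (hu : ContDiff ℝ 2 u) (hφ : ContDiff ℝ 1 φ) (hc : HasCompactSupport φ)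
    (hs : tsupport φ ⊆ Ω) :
    ∫ x in Ω, ⟪∇ u x, ∇ φ x⟫ ∂μ = -∫ x in Ω, (Δ u) x * φ x ∂μ := by
  have hintegral {g : E → ℝ} (hg : Continuous g) : IntegrableOn g Ω μ :=
    memLp_one_iff_integrable.1 (memLp_restrict_of_isBounded hΩ hΩ.measure_lt_top.ne hg)
  let b := stdOrthonormalBasis ℝ E
  have hinner (x : E) : ⟪∇ u x, ∇ φ x⟫ = ∑ i, ⟪∇ u x, b i⟫ * ⟪∇ φ x, b i⟫ := by
    rw [← b.sum_inner_mul_inner]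
    exact Finset.sum_congr rfl fun i _ => by rw [real_inner_comm (∇ φ x)]
  simp_rw [hinner, laplacian_eq_sum_inner_gradient hu b, Finset.sum_mul]
  rw [integral_finsetSum, integral_finsetSum, ← Finset.sum_neg_distrib]
  · exact Finset.sum_congr rfl fun i _ =>
      setIntegral_mul_inner_gradient (contDiff_inner_gradient hu _) hφ hc hs _
  · exact fun i _ => hintegral <| ((continuous_gradient (contDiff_inner_gradient hu _)).inner
      continuous_const).mul hφ.continuous
  · exact fun i _ => hintegral <| (contDiff_inner_gradient hu _).continuous.mul
      ((continuous_gradient hφ).inner continuous_const)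

end IntegrationByParts

theorem tendsto_integral_inner {α ι V : Type*} [MeasurableSpace α] {μ : Measure α}
    [NormedAddCommGroup V] [InnerProductSpace ℝ V] {l : Filter ι} {ψ g : α → V}
    {gs : ι → α → V} (hψ : MemLp ψ 2 μ) (hg : MemLp g 2 μ) (hgs : ∀ k, MemLp (gs k) 2 μ)
    (h : Tendsto (fun k => eLpNorm (gs k - g) 2 μ) l (𝓝 0)) :
    Tendsto (fun k => ∫ x, ⟪ψ x, gs k x⟫ ∂μ) l (𝓝 (∫ x, ⟪ψ x, g x⟫ ∂μ)) := by
  have hinner {f : α → V} (hf : MemLp f 2 μ) :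
      ∫ x, ⟪ψ x, f x⟫ ∂μ = ⟪hψ.toLp ψ, hf.toLp f⟫ := by
    rw [L2.inner_def]
    refine integral_congr_ae ?_
    filter_upwards [hψ.coeFn_toLp, hf.coeFn_toLp] with x hψx hfx
    rw [hψx, hfx]
  simp_rw [hinner hg, fun k => hinner (hgs k)]
  exact tendsto_const_nhds.inner ((Lp.tendsto_Lp_iff_tendsto_eLpNorm'' gs hgs g hg).2 h)

section Weak

variable {d : ℕ} {Ω : Set (Pt d)} {u f : Pt d → ℝ} {G : Pt d → Pt d}

theorem hasH10Gradient_of_test {φ : Pt d → ℝ} (hφ : ContDiff ℝ ∞ φ) (hc : HasCompactSupport φ)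
    (hs : tsupport φ ⊆ Ω) : HasH10Gradient Ω φ (∇ φ) where
  memLp := (hφ.continuous.memLp_of_hasCompactSupport hc).restrict Ω
  memLp_grad :=
    have hgrad := continuous_gradient (hφ.of_le (by exact_mod_cast le_top))
    (hgrad.memLp_of_hasCompactSupport (hasCompactSupport_gradient hc)).restrict Ω
  approx := ⟨fun _ => φ, fun _ => ⟨hφ, hc, hs⟩, by simp [normL2], by simp [normL2]⟩

/-- Identities which are continuous in `H¹` extend from test functions to `H¹₀`. -/
theorem HasH10Gradient.setIntegral_add_eq_zero (h : HasH10Gradient Ω u G) {A : Set (Pt d)}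
    (hA : A ⊆ Ω) {ψ : Pt d → ℝ} {Ψ : Pt d → Pt d} (hψ : MemLp ψ 2 (volume.restrict A))
    (hΨ : MemLp Ψ 2 (volume.restrict A))
    (htest : ∀ φ, ContDiff ℝ ∞ φ → HasCompactSupport φ → tsupport φ ⊆ Ω →
      (∫ x in A, φ x * ψ x) + ∫ x in A, ⟪Ψ x, ∇ φ x⟫ = 0) :
    (∫ x in A, u x * ψ x) + ∫ x in A, ⟪Ψ x, G x⟫ = 0 := by
  have hle : volume.restrict A ≤ volume.restrict Ω := Measure.restrict_mono hA le_rfl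
  have hrestrict {V : Type} [NormedAddCommGroup V] {g : ℕ → Pt d → V}
      (hg : Tendsto (fun k => normL2 Ω (g k)) atTop (𝓝 0)) :
      Tendsto (fun k => eLpNorm (g k) 2 (volume.restrict A)) atTop (𝓝 0) :=
    tendsto_of_tendsto_of_tendsto_of_le_of_le tendsto_const_nhds hg (fun _ => zero_le)
      fun _ => eLpNorm_mono_measure _ hle
  obtain ⟨φ, hφ, hφu, hφG⟩ := h.approx
  have hφ' (k : ℕ) := hasH10Gradient_of_test (hφ k).1 (hφ k).2.1 (hφ k).2.2
  have hval := tendsto_integral_inner hψ (h.memLp.mono_measure hle)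
    (fun k => (hφ' k).memLp.mono_measure hle) (hrestrict hφu)
  have hgrad := tendsto_integral_inner hΨ (h.memLp_grad.mono_measure hle)
    (fun k => (hφ' k).memLp_grad.mono_measure hle) (hrestrict hφG)
  exact tendsto_nhds_unique (hval.add hgrad)
    (tendsto_const_nhds.congr fun k => (htest _ (hφ k).1 (hφ k).2.1 (hφ k).2.2).symm)

theorem HasH10Gradient.setIntegral_inner_eq (hΩ : Bornology.IsBounded Ω)
    (h : HasH10Gradient Ω u G) {g : Pt d → ℝ} (hg : ContDiff ℝ 1 g) (e : Pt d) :
    (∫ x in Ω, u x * ⟪∇ g x, e⟫) + ∫ x in Ω, g x * ⟪G x, e⟫ = 0 := by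
  have hmem {V : Type} [NormedAddCommGroup V] {ψ : Pt d → V} (hψ : Continuous ψ) :
      MemLp ψ 2 (volume.restrict Ω) :=
    memLp_restrict_of_isBounded hΩ hΩ.measure_lt_top.ne hψ
  have htest := h.setIntegral_add_eq_zero (ψ := fun x => ⟪∇ g x, e⟫)
    (Ψ := fun x => g x • e) subset_rfl
    (hmem ((continuous_gradient hg).inner continuous_const))
    (hmem (hg.continuous.smul continuous_const)) fun φ hφ hc hs => ?_
  · simpa only [real_inner_smul_left, real_inner_comm e] using htest
  have hparts := setIntegral_mul_inner_gradient (μ := volume) hg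
    (hφ.of_le (by exact_mod_cast le_top)) hc hs e
  simp_rw [real_inner_smul_left, real_inner_comm (∇ φ _), hparts, mul_comm (φ _)]
  exact add_neg_cancel _

theorem HasH10Gradient.ae_eq_gradient (hΩo : IsOpen Ω) (hΩ : Bornology.IsBounded Ω)
    (h : HasH10Gradient Ω u G) (hu : ContDiff ℝ 1 u) : ∀ᵐ x, x ∈ Ω → G x = ∇ u x := by
  have hmem {V : Type} [NormedAddCommGroup V] {ψ : Pt d → V} (hψ : Continuous ψ) :
      MemLp ψ 2 (volume.restrict Ω) :=
    memLp_restrict_of_isBounded hΩ hΩ.measure_lt_top.ne hψ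
  have : IsFiniteMeasure (volume.restrict Ω) := ⟨by simpa using hΩ.measure_lt_top⟩
  have hdiff : MemLp (fun x => G x - ∇ u x) 2 (volume.restrict Ω) :=
    h.memLp_grad.sub (hmem (continuous_gradient hu))
  have hinner (e : Pt d) : ∀ᵐ x, x ∈ Ω → ⟪G x - ∇ u x, e⟫ = 0 := by
    refine hΩo.ae_eq_zero_of_integral_contDiff_smul_eq_zero ?_ fun g hg hc hs => ?_
    · exact IntegrableOn.locallyIntegrableOn ((hdiff.integrable one_le_two).inner_const e)
    have hg1 : ContDiff ℝ 1 g := hg.of_le (by exact_mod_cast le_top)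
    have hg0 (x : Pt d) (hx : x ∉ Ω) : g x = 0 :=
      image_eq_zero_of_notMem_tsupport fun hxs => hx (hs hxs)
    have hweak : Integrable (fun x => g x * ⟪G x, e⟫) (volume.restrict Ω) :=
      (hmem hg.continuous).integrable_mul (h.memLp_grad.inner_const e)
    have hclassical : Integrable (fun x => ⟪∇ u x, e⟫ * g x) (volume.restrict Ω) :=
      (hmem ((continuous_gradient hu).inner continuous_const)).integrable_mul (hmem hg.continuous)
    calc ∫ x, g x • ⟪G x - ∇ u x, e⟫
        = ∫ x in Ω, g x • ⟪G x - ∇ u x, e⟫ :=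
          (setIntegral_eq_integral_of_forall_compl_eq_zero
            fun x hx => by rw [hg0 x hx, zero_smul]).symm
      _ = ∫ x in Ω, (g x * ⟪G x, e⟫ - ⟪∇ u x, e⟫ * g x) := by
          simp_rw [smul_eq_mul, inner_sub_left, mul_sub, mul_comm (g _) ⟪∇ u _, e⟫]
      _ = (∫ x in Ω, g x * ⟪G x, e⟫) - ∫ x in Ω, ⟪∇ u x, e⟫ * g x :=
          integral_sub hweak hclassical
      _ = 0 := by
          linarith [h.setIntegral_inner_eq hΩ hg1 e,
            setIntegral_mul_inner_gradient (μ := volume) hu hg1 hc hs e]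
  have hbasis : ∀ᵐ x, ∀ i, x ∈ Ω → ⟪G x - ∇ u x, stdOrthonormalBasis ℝ (Pt d) i⟫ = 0 :=
    ae_all_iff.2 fun i => hinner _
  filter_upwards [hbasis] with x hx hxΩ
  refine sub_eq_zero.1 (InnerProductSpace.ext_inner_right_basis
    (stdOrthonormalBasis ℝ (Pt d)).toBasis fun i => ?_)
  rw [OrthonormalBasis.coe_toBasis, hx i hxΩ, inner_zero_left]

theorem IsWeakSolution.ae_add_laplacian_eq_zero (hΩo : IsOpen Ω) (hΩ : Bornology.IsBounded Ω)
    (hu : ContDiff ℝ 2 u) (hf : MemLp f 2 (volume.restrict Ω))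
    (h : IsWeakSolution Ω (idField d) f u) : ∀ᵐ x, x ∈ Ω → f x + (Δ u) x = 0 := by
  have : IsFiniteMeasure (volume.restrict Ω) := ⟨by simpa using hΩ.measure_lt_top⟩
  obtain ⟨G, hG, hw⟩ := h
  have hΔ : MemLp (Δ u) 2 (volume.restrict Ω) :=
    memLp_restrict_of_isBounded hΩ hΩ.measure_lt_top.ne (continuous_laplacian hu)
  refine hΩo.ae_eq_zero_of_integral_contDiff_smul_eq_zero ?_ fun g hg hc hs => ?_
  · exact IntegrableOn.locallyIntegrableOn ((hf.add hΔ).integrable one_le_two)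
  have hg2 : MemLp g 2 (volume.restrict Ω) :=
    (hasH10Gradient_of_test hg hc hs).memLp
  have hg0 (x : Pt d) (hx : x ∉ Ω) : g x = 0 :=
    image_eq_zero_of_notMem_tsupport fun hxs => hx (hs hxs)
  have hweak : ∫ x in Ω, ⟪∇ u x, ∇ g x⟫ = ∫ x in Ω, f x * g x := by
    rw [← hw g (∇ g) (hasH10Gradient_of_test hg hc hs)]
    refine setIntegral_congr_ae hΩo.measurableSet ?_
    filter_upwards [hG.ae_eq_gradient hΩo hΩ (hu.of_le one_le_two)] with x hx hxΩ
    rw [hx hxΩ, idField, ContinuousLinearMap.id_apply]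
  have hfg : Integrable (fun x => f x * g x) (volume.restrict Ω) := hf.integrable_mul hg2
  have hΔg : Integrable (fun x => (Δ u) x * g x) (volume.restrict Ω) := hΔ.integrable_mul hg2
  have hgreen := setIntegral_inner_gradient_gradient (μ := volume) hΩ hu
    (hg.of_le (by exact_mod_cast le_top)) hc hs
  rw [← setIntegral_eq_integral_of_forall_compl_eq_zero fun x hx => by rw [hg0 x hx, zero_smul]]
  simp_rw [smul_eq_mul, mul_comm (g _), add_mul]
  rw [integral_add hfg hΔg, ← hweak, hgreen, neg_add_cancel]

end Weak

theorem integral_pow_mul_radial {E : Type*} [NormedAddCommGroup E] [InnerProductSpace ℝ E]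
    [CompleteSpace E] {m : ℕ} (hm : m ≠ 0) {g : E → ℝ} (hg : ContDiff ℝ 1 g) (c v : E) :
    ∫ t in (0 : ℝ)..1, t ^ (m - 1) * (m * g (c + t • v) + ⟪∇ g (c + t • v), t • v⟫) =
      g (c + v) := by
  have hgc := hg.continuous
  have hgrad := continuous_gradient hg
  have hline (t : ℝ) : HasDerivAt (fun t : ℝ => g (c + t • v)) ⟪∇ g (c + t • v), v⟫ t := by
    rw [inner_gradient_left]
    refine (hg.differentiable one_ne_zero _).hasFDerivAt.comp_hasDerivAt t ?_
    simpa using ((hasDerivAt_id t).smul_const v).const_add c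
  have hder (t : ℝ) : HasDerivAt (fun t : ℝ => t ^ m * g (c + t • v))
      (t ^ (m - 1) * (m * g (c + t • v) + ⟪∇ g (c + t • v), t • v⟫)) t := by
    refine ((hasDerivAt_pow m t).mul (hline t)).congr_deriv ?_
    rw [real_inner_smul_right, ← pow_sub_one_mul hm t]
    ring
  rw [intervalIntegral.integral_eq_sub_of_hasDerivAt (fun t _ => hder t)
    (Continuous.intervalIntegrable (by fun_prop) _ _)]
  simp [hm]

namespace IsStarCell

section Radial

variable {E : Type*} [NormedAddCommGroup E] [InnerProductSpace ℝ E] [FiniteDimensional ℝ E]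
  [MeasurableSpace E] [BorelSpace E] {ι : Type*} {K : Set E} {c : E} {S : Finset ι}
  {σ : ι → Set E} {n : ι → E} {δ : ι → ℝ} (h : IsStarCell K c S σ n δ) {i : ι} (hi : i ∈ S)

include h hi

theorem isFiniteMeasure_restrict_edge :
    IsFiniteMeasure (μHE[Module.finrank ℝ E - 1].restrict (σ i)) :=
  ⟨by simpa using h.euclideanHausdorffMeasure_edge_lt_top hi⟩

theorem integrable_prod_edge {Ψ : ℝ × E → ℝ} (hΨ : Continuous Ψ) :
    Integrable Ψ ((volume.restrict (Set.uIoc (0 : ℝ) 1)).prod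
      (μHE[Module.finrank ℝ E - 1].restrict (σ i))) := by
  have := h.isFiniteMeasure_restrict_edge hi
  have hcompact : IsCompact (Set.uIcc (0 : ℝ) 1 ×ˢ closure (σ i)) :=
    isCompact_uIcc.prod (h.isBounded_edge hi).isCompact_closure
  obtain ⟨M, hM⟩ := hcompact.exists_bound_of_continuousOn hΨ.continuousOn
  have : IsFiniteMeasure ((volume : Measure ℝ).restrict (Set.uIoc 0 1)) := by
    rw [Set.uIoc_of_le zero_le_one]
    infer_instance
  refine Integrable.of_bound hΨ.aestronglyMeasurable M ?_
  filter_upwards [Measure.quasiMeasurePreserving_fst.ae (ae_restrict_mem measurableSet_uIoc),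
    Measure.quasiMeasurePreserving_snd.ae (ae_restrict_mem (h.measurableSet_edge hi))] with p h1 h2
  exact hM p ⟨Set.uIoc_subset_uIcc h1, subset_closure h2⟩

/-- The divergence theorem for the field `g(x) (x - c)`, whose normal component vanishes on the
lateral boundary of the cone. -/
theorem integral_cone_radial [Nontrivial E] {g : E → ℝ} (hg : ContDiff ℝ 1 g) :
    ∫ x in coneOver c (σ i), (Module.finrank ℝ E * g x + ⟪∇ g x, x - c⟫) =
      δ i * ∫ y in σ i, g y ∂μHE[Module.finrank ℝ E - 1] := by
  have hgc := hg.continuous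
  have hgrad := continuous_gradient hg
  have := h.isFiniteMeasure_restrict_edge hi
  let Ψ : ℝ × E → ℝ := fun p => p.1 ^ (Module.finrank ℝ E - 1) *
    (Module.finrank ℝ E * g (c + p.1 • (p.2 - c)) +
      ⟪∇ g (c + p.1 • (p.2 - c)), p.1 • (p.2 - c)⟫)
  have hΨ : Continuous Ψ := by fun_prop
  have hradial (y : E) : ∫ t in (0 : ℝ)..1, Ψ (t, y) = g y := by
    simpa only [Ψ, add_sub_cancel] using
      integral_pow_mul_radial (Module.finrank_pos (R := ℝ) (M := E)).ne' hg c (y - c)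
  calc ∫ x in coneOver c (σ i), (Module.finrank ℝ E * g x + ⟪∇ g x, x - c⟫)
      = ∫ t in (0 : ℝ)..1, δ i * ∫ y in σ i, Ψ (t, y) ∂μHE[Module.finrank ℝ E - 1] := by
        rw [h.integral_cone hi (by fun_prop)]
        simp only [Ψ, add_sub_cancel_left, smul_eq_mul, integral_const_mul, mul_assoc]
    _ = δ i * ∫ y in σ i, (∫ t in (0 : ℝ)..1, Ψ (t, y)) ∂μHE[Module.finrank ℝ E - 1] := by
        rw [intervalIntegral.integral_const_mul,
          intervalIntegral_integral_swap (f := fun t y => Ψ (t, y))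
            (h.integrable_prod_edge hi hΨ)]
    _ = δ i * ∫ y in σ i, g y ∂μHE[Module.finrank ℝ E - 1] := by
        simp_rw [hradial]

/-- A relatively open part of an edge on which `g` does not vanish spans an open cone. -/
theorem eq_zero_of_integral_sq_eq_zero {g : E → ℝ} (hg : Continuous g)
    (hintegral : ∫ y in σ i, g y ^ 2 ∂μHE[Module.finrank ℝ E - 1] = 0) {y : E} (hy : y ∈ σ i) :
    g y = 0 := by
  by_contra hne
  have hWo : IsOpen {x | g x ≠ 0} := isOpen_ne_fun hg continuous_const
  have hsq : MemLp (fun y => g y ^ 2) 1 (μHE[Module.finrank ℝ E - 1].restrict (σ i)) :=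
    memLp_restrict_of_isBounded (h.isBounded_edge hi)
      (h.euclideanHausdorffMeasure_edge_lt_top hi).ne (hg.pow 2)
  have hae := (setIntegral_eq_zero_iff_of_nonneg_ae
    (Eventually.of_forall fun y => sq_nonneg (g y)) (memLp_one_iff_integrable.1 hsq)).1 hintegral
  have hnull : μHE[Module.finrank ℝ E - 1] ({x | g x ≠ 0} ∩ σ i) = 0 := by
    rw [← Measure.restrict_apply hWo.measurableSet]
    exact measure_mono_null (fun x hx => by simpa using hx) (ae_iff.1 hae)
  have hvol : volume (coneOver c ({x | g x ≠ 0} ∩ σ i)) = 0 := by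
    rw [volume_coneOver (h.norm_normal i hi) (h.height_pos i hi)
      (fun z hz => h.inner_eq hi hz.2) (hWo.measurableSet.inter (h.measurableSet_edge hi)),
      hnull, mul_zero]
  obtain ⟨U, hU, hσ⟩ := h.exists_open i hi
  have hopen : IsOpen (coneOver c ({x | g x ≠ 0} ∩ σ i)) :=
    isOpen_coneOver (h.height_pos i hi) (hWo.inter hU) (by rw [hσ, Set.inter_assoc])
  exact (hopen.measure_pos volume
    ⟨_, y, ⟨hne, hy⟩, 1 / 2, ⟨by norm_num, by norm_num⟩, rfl⟩).ne' hvol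

theorem integral_cone_radial_mul [Nontrivial E] {a u : E → ℝ} (ha : ContDiff ℝ 1 a)
    (hu : ContDiff ℝ 1 u) :
    (∫ x in coneOver c (σ i), a x * (Module.finrank ℝ E * u x + ⟪∇ u x, x - c⟫)) +
        ∫ x in coneOver c (σ i), ⟪u x • (x - c), ∇ a x⟫ =
      δ i * ∫ y in σ i, a y * u y ∂μHE[Module.finrank ℝ E - 1] := by
  have hac := ha.continuous
  have huc := hu.continuous
  have hagrad := continuous_gradient ha
  have hugrad := continuous_gradient hu
  rw [← integral_add (h.integrableOn_cone (by fun_prop) hi)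
    (h.integrableOn_cone (by fun_prop) hi), ← h.integral_cone_radial hi (ha.mul hu)]
  refine setIntegral_congr_fun (h.isOpen_cone hi).measurableSet fun x _ => ?_
  simp only [inner_gradient_left, real_inner_comm (∇ a x), map_smul]
  rw [fderiv_fun_mul (ha.differentiable one_ne_zero x) (hu.differentiable one_ne_zero x)]
  simp only [_root_.add_apply, _root_.smul_apply, smul_eq_mul]
  ring

end Radial

/-- Trace zero: the test functions `a` approximating `u` satisfy `∫_σ a u = 0`, and the cone over
`σ` expresses `∫_σ a u` through `a` and `∇ a`. -/
theorem eq_zero_of_hasH10Gradient {d : ℕ} [NeZero d] {Ω : Set (Pt d)} (hΩo : IsOpen Ω)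
    (hΩ : Bornology.IsBounded Ω) {ι : Type*} {K : Set (Pt d)} {c : Pt d} {S : Finset ι}
    {σ : ι → Set (Pt d)} {n : ι → Pt d} {δ : ι → ℝ} (h : IsStarCell K c S σ n δ) (hK : K ⊆ Ω)
    {i : ι} (hi : i ∈ S) (hσ : σ i ⊆ frontier Ω) {u : Pt d → ℝ} {G : Pt d → Pt d}
    (hu : ContDiff ℝ 1 u) (hG : HasH10Gradient Ω u G) {y : Pt d} (hy : y ∈ σ i) : u y = 0 := by
  have hugrad := continuous_gradient hu
  have huc := hu.continuous
  have hCΩ : coneOver c (σ i) ⊆ Ω := (h.cone_subset hi).trans hK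
  have hmem {V : Type} [NormedAddCommGroup V] {ψ : Pt d → V} (hψ : Continuous ψ) :
      MemLp ψ 2 (volume.restrict (coneOver c (σ i))) :=
    memLp_restrict_of_isBounded (hΩ.subset hCΩ) (hΩ.subset hCΩ).measure_lt_top.ne hψ
  have hlim := hG.setIntegral_add_eq_zero hCΩ (Ψ := fun x => u x • (x - c))
    (ψ := fun x => Module.finrank ℝ (Pt d) * u x + ⟪∇ u x, x - c⟫)
    (hmem (by fun_prop)) (hmem (by fun_prop)) fun φ hφ _ hs => by
      rw [h.integral_cone_radial_mul hi (hφ.of_le (by exact_mod_cast le_top)) hu,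
        setIntegral_eq_zero_of_forall_eq_zero, mul_zero]
      intro y hy
      have hyΩ : y ∉ Ω := (hΩo.frontier_eq ▸ hσ hy).2
      rw [image_eq_zero_of_notMem_tsupport fun hyt => hyΩ (hs hyt), zero_mul]
  have hGu : ∫ x in coneOver c (σ i), ⟪u x • (x - c), G x⟫ =
      ∫ x in coneOver c (σ i), ⟪u x • (x - c), ∇ u x⟫ := by
    refine setIntegral_congr_ae (h.isOpen_cone hi).measurableSet ?_
    filter_upwards [hG.ae_eq_gradient hΩo hΩ hu] with x hx hxC
    rw [hx (hCΩ hxC)]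
  rw [hGu, h.integral_cone_radial_mul hi hu hu] at hlim
  refine h.eq_zero_of_integral_sq_eq_zero hi huc ?_ hy
  simpa only [sq] using (mul_eq_zero.1 hlim).resolve_left (h.height_pos i hi).ne'

end IsStarCell

namespace Discretisation

variable {d : ℕ} {Ω : Set (Pt d)} (D : Discretisation Ω)

theorem inner_gradient_eq_zero {u : Pt d → ℝ} {σ : D.Edge} (hzero : ∀ y ∈ D.edge σ, u y = 0)
    {y z : Pt d} (hu : DifferentiableAt ℝ u y) (hy : y ∈ D.edge σ) (hz : z ∈ D.edge σ) :
    ⟪∇ u y, z - y⟫ = 0 := by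
  obtain ⟨K, hK⟩ := D.exists_cell σ
  obtain ⟨U, hU, hσU⟩ := D.edge_open σ
  have hplane := D.plane_eq_of_mem hK hy y
  have hline : HasDerivAt (fun t : ℝ => y + t • (z - y)) (z - y) 0 := by
    simpa using ((hasDerivAt_id (0 : ℝ)).smul_const (z - y)).const_add y
  have hder : HasDerivAt (fun t : ℝ => u (y + t • (z - y))) (fderiv ℝ u y (z - y)) 0 := by
    refine HasFDerivAt.comp_hasDerivAt 0 ?_ hline
    simpa using hu.hasFDerivAt
  have hyU : y + (0 : ℝ) • (z - y) ∈ U := by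
    simpa using (hσU ▸ hy : y ∈ U ∩ D.plane σ).1
  have hzy : ⟪D.normal K σ, z - y⟫ = 0 := by
    have hzplane : z ∈ D.plane σ := (hσU ▸ hz : z ∈ U ∩ D.plane σ).2
    rw [hplane] at hzplane
    simpa using hzplane
  have hconst : (fun t : ℝ => u (y + t • (z - y))) =ᶠ[𝓝 0] fun _ => 0 := by
    filter_upwards [hline.continuousAt.eventually (hU.mem_nhds hyU)] with t ht
    refine hzero _ ?_
    rw [hσU, hplane]
    exact ⟨ht, by simp [real_inner_smul_right, hzy]⟩
  rw [inner_gradient_left]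
  exact hder.unique ((hasDerivAt_const (0 : ℝ) (0 : ℝ)).congr_of_eventuallyEq hconst)

variable [NeZero d] (hΩo : IsOpen Ω) (hΩ : Bornology.IsBounded Ω) {u f : Pt d → ℝ}

include hΩo hΩ

theorem eq_zero_on_extEdge (hu : ContDiff ℝ 1 u) (hw : IsWeakSolution Ω (idField d) f u)
    {σ : D.Edge} (hσ : σ ∈ D.extEdges) {y : Pt d} (hy : y ∈ D.edge σ) : u y = 0 := by
  obtain ⟨K, hK⟩ := D.exists_cell σ
  obtain ⟨G, hG, -⟩ := hw
  exact (D.isStarCell hΩ K).eq_zero_of_hasH10Gradient hΩo hΩ (D.cell_subset K) hK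
    (D.edge_subset_frontier_of_ext hσ) hu hG hy

theorem integral_cell_eq (hu : ContDiff ℝ 2 u) (hf : MemLp f 2 (volume.restrict Ω))
    (hw : IsWeakSolution Ω (idField d) f u) (K : D.Cell) :
    ∫ x in D.cell K, f x =
      -∑ σ ∈ D.edgesOf K, ⟪D.normal K σ, ∫ y in D.edge σ, ∇ u y ∂(surf d)⟫ := by
  let b := EuclideanSpace.basisFun (Fin d) ℝ
  have hgrad : Continuous (∇ u) := continuous_gradient (hu.of_le one_le_two)
  have hcoord (σ : D.Edge) (i : Fin d) :
      ∫ y in D.edge σ, ⟪∇ u y, b i⟫ ∂(surf d) = ⟪b i, ∫ y in D.edge σ, ∇ u y ∂(surf d)⟫ := by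
    rw [← integral_inner (D.integrableOn_edge hΩ σ hgrad)]
    simp_rw [real_inner_comm]
  have hcell (i : Fin d) : ∫ x in D.cell K, ⟪∇ (fun y => ⟪∇ u y, b i⟫) x, b i⟫ =
      ∑ σ ∈ D.edgesOf K, ⟪D.normal K σ, b i⟫ * ⟪b i, ∫ y in D.edge σ, ∇ u y ∂(surf d)⟫ := by
    simp_rw [← hcoord, ← D.integral_cell_fderiv hΩ K (contDiff_inner_gradient hu (b i)),
      inner_gradient_left]
  calc ∫ x in D.cell K, f x = -∫ x in D.cell K, (Δ u) x := by
        rw [← integral_neg]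
        refine setIntegral_congr_ae (D.cell_open K).measurableSet ?_
        filter_upwards [hw.ae_add_laplacian_eq_zero hΩo hΩ hu hf] with x hx hxK
        exact eq_neg_of_add_eq_zero_left (hx (D.cell_subset K hxK))
    _ = -∑ i, ∫ x in D.cell K, ⟪∇ (fun y => ⟪∇ u y, b i⟫) x, b i⟫ := by
        simp_rw [laplacian_eq_sum_inner_gradient hu b]
        rw [integral_finsetSum]
        exact fun i _ => memLp_one_iff_integrable.1 <| memLp_restrict_of_isBounded
          (D.isStarCell hΩ K).isBounded (D.isStarCell hΩ K).isBounded.measure_lt_top.ne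
          ((continuous_gradient (contDiff_inner_gradient hu _)).inner continuous_const)
    _ = -∑ σ ∈ D.edgesOf K, ⟪D.normal K σ, ∫ y in D.edge σ, ∇ u y ∂(surf d)⟫ := by
        simp_rw [hcell]
        rw [Finset.sum_comm]
        simp_rw [b.sum_inner_mul_inner]

end Discretisation

/-! ### The discrete gradient -/

section Taylor

variable {E : Type*} [NormedAddCommGroup E] [InnerProductSpace ℝ E] [CompleteSpace E]

/-- First-order Taylor bounds for `u` on the ball of radius `R`, with a common constant `M` for the
oscillation of the gradient and for the remainder. -/
structure IsTaylorBound (u : E → ℝ) (R M : ℝ) : Prop where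
  nonneg : 0 ≤ M
  grad : ∀ x y : E, ‖x‖ ≤ R → ‖y‖ ≤ R → ‖∇ u y - ∇ u x‖ ≤ M * ‖y - x‖
  taylor : ∀ x y : E, ‖x‖ ≤ R → ‖y‖ ≤ R → |u y - u x - ⟪∇ u x, y - x⟫| ≤ M * ‖y - x‖ ^ 2

theorem norm_fderiv_sub_fderiv (u : E → ℝ) (x y : E) :
    ‖fderiv ℝ u y - fderiv ℝ u x‖ = ‖∇ u y - ∇ u x‖ := by
  rw [gradient, gradient, ← map_sub, LinearIsometryEquiv.norm_map]

theorem abs_sub_sub_inner_gradient_le {u : E → ℝ} (hu : Differentiable ℝ u) {s : Set E}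
    (hs : Convex ℝ s) {M : ℝ} (hM : 0 ≤ M)
    (hgrad : ∀ x ∈ s, ∀ y ∈ s, ‖∇ u y - ∇ u x‖ ≤ M * ‖y - x‖) {x y : E} (hx : x ∈ s)
    (hy : y ∈ s) : |u y - u x - ⟪∇ u x, y - x⟫| ≤ M * ‖y - x‖ ^ 2 := by
  have hderiv (z : E) (hz : z ∈ segment ℝ x y) :
      ‖fderiv ℝ u z - fderiv ℝ u x‖ ≤ M * ‖y - x‖ := by
    rw [norm_fderiv_sub_fderiv]
    refine (hgrad x hx z (hs.segment_subset hx hy hz)).trans ?_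
    gcongr
    exact norm_sub_le_of_mem_segment hz
  rw [inner_gradient_left, ← Real.norm_eq_abs, sq, ← mul_assoc]
  exact (convex_segment x y).norm_image_sub_le_of_norm_fderiv_le' (𝕜 := ℝ)
    (fun z _ => hu z) hderiv (left_mem_segment ℝ x y) (right_mem_segment ℝ x y)

theorem exists_isTaylorBound [FiniteDimensional ℝ E] {u : E → ℝ} (hu : ContDiff ℝ 2 u) (R : ℝ) :
    ∃ M, IsTaylorBound u R M := by
  have hgrad : ContDiff ℝ 1 (∇ u) := contDiff_gradient hu (by norm_num)
  obtain ⟨C, hC⟩ := hgrad.contDiffOn.exists_lipschitzOnWith (s := Metric.closedBall (0 : E) R)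
    one_ne_zero (convex_closedBall _ _) (isCompact_closedBall _ _)
  have hlip : ∀ x ∈ Metric.closedBall (0 : E) R, ∀ y ∈ Metric.closedBall (0 : E) R,
      ‖∇ u y - ∇ u x‖ ≤ C * ‖y - x‖ := fun x hx y hy => by
    simpa only [dist_eq_norm] using hC.dist_le_mul y hy x hx
  exact ⟨C, C.2,
    fun x y hx hy => hlip x (mem_closedBall_zero_iff.2 hx) y (mem_closedBall_zero_iff.2 hy),
    fun x y hx hy => abs_sub_sub_inner_gradient_le (hu.differentiable two_ne_zero)
      (convex_closedBall _ _) C.2 hlip (mem_closedBall_zero_iff.2 hx)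
      (mem_closedBall_zero_iff.2 hy)⟩

/-- The first-order terms of the Taylor expansions at `b` cancel. -/
theorem IsTaylorBound.abs_sum_mul_sub_le {u : E → ℝ} {R M : ℝ} (hM : IsTaylorBound u R M)
    {ι : Type*} {s : Finset ι} {β : ι → ℝ} {x : ι → E} {b : E} (hβ : ∑ i ∈ s, β i = 1)
    (hb : b = ∑ i ∈ s, β i • x i) (hbR : ‖b‖ ≤ R) (hxR : ∀ i ∈ s, ‖x i‖ ≤ R) :
    |∑ i ∈ s, β i * u (x i) - u b| ≤ M * ∑ i ∈ s, |β i| * ‖x i - b‖ ^ 2 := by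
  have hsum : ∑ i ∈ s, β i • (x i - b) = 0 := by
    simp only [smul_sub, Finset.sum_sub_distrib, ← Finset.sum_smul, hβ, one_smul, ← hb, sub_self]
  have hlinear : ∑ i ∈ s, β i * ⟪∇ u b, x i - b⟫ = 0 := by
    simp only [← real_inner_smul_right, ← inner_sum, hsum, inner_zero_right]
  have hremainder : ∑ i ∈ s, β i * u (x i) - u b =
      ∑ i ∈ s, β i * (u (x i) - u b - ⟪∇ u b, x i - b⟫) := by
    simp only [mul_sub, Finset.sum_sub_distrib, hlinear, ← Finset.sum_mul, hβ, one_mul, sub_zero]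
  rw [hremainder, Finset.mul_sum]
  refine (Finset.abs_sum_le_sum_abs _ _).trans (Finset.sum_le_sum fun i hi => ?_)
  rw [abs_mul, mul_left_comm]
  exact mul_le_mul_of_nonneg_left (hM.taylor _ _ hbR (hxR i hi)) (abs_nonneg _)

end Taylor

namespace Discretisation

variable {d : ℕ} {Ω : Set (Pt d)} (D : Discretisation Ω)

/-- The shape-regularity bounds encoded in `θ_{D,B}`, with a constant at least `1`. -/
structure IsRegular (B : Finset D.Edge) (β : D.Edge → D.Cell → ℝ) (T : ℝ) : Prop where
  one_le : 1 ≤ T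
  diam_le : ∀ K, ∀ σ ∈ D.edgesOf K, D.diam K ≤ T * D.dist K σ
  bary_le : ∀ K, ∀ σ ∈ D.edgesOf K, σ ∈ B →
    ∑ L, |β σ L| * ‖D.center L - D.bary σ‖ ^ 2 ≤ T * D.diam K ^ 2

theorem diam_div_dist_le_reg {K : D.Cell} {σ : D.Edge} (hσ : σ ∈ D.edgesOf K) :
    D.diam K / D.dist K σ ≤ D.reg := by
  refine le_max_of_le_right (le_csSup ?_ ⟨K, σ, hσ, rfl⟩)
  refine ((Set.finite_range fun p : D.Cell × D.Edge =>
    D.diam p.1 / D.dist p.1 p.2).subset ?_).bddAbove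
  rintro _ ⟨K, σ, -, rfl⟩
  exact ⟨(K, σ), rfl⟩

theorem sum_abs_div_diam_sq_le_regB {B : Finset D.Edge} (β : D.Edge → D.Cell → ℝ) {K : D.Cell}
    {σ : D.Edge} (hσ : σ ∈ D.edgesOf K) (hB : σ ∈ B) :
    (∑ L, |β σ L| * ‖D.center L - D.bary σ‖ ^ 2) / D.diam K ^ 2 ≤ D.regB B β := by
  refine le_max_of_le_right (le_csSup ?_ ⟨K, σ, hσ, hB, rfl⟩)
  refine ((Set.finite_range fun p : D.Cell × D.Edge =>
    (∑ L, |β p.2 L| * ‖D.center L - D.bary p.2‖ ^ 2) / D.diam p.1 ^ 2).subset ?_).bddAbove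
  rintro _ ⟨K, σ, -, -, rfl⟩
  exact ⟨(K, σ), rfl⟩

theorem isRegular_of_regB_le (hΩ : Bornology.IsBounded Ω) {B : Finset D.Edge}
    {β : D.Edge → D.Cell → ℝ} {θ : ℝ} (h : D.regB B β ≤ θ) : D.IsRegular B β (max θ 1) where
  one_le := le_max_right _ _
  diam_le K σ hσ := by
    have hdist : 0 < D.dist K σ := D.dist_pos K σ hσ
    rw [← div_le_iff₀ hdist]
    exact (D.diam_div_dist_le_reg hσ).trans
      (((le_max_left _ _).trans h).trans (le_max_left _ _))
  bary_le K σ hσ hB := by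
    have hdiam : 0 < D.diam K := (D.dist_pos K σ hσ).trans_le (D.dist_le_diam hΩ hσ)
    rw [← div_le_iff₀ (by positivity)]
    exact (D.sum_abs_div_diam_sq_le_regB β hσ hB).trans (h.trans (le_max_left _ _))

section Linear

variable (v w : D.X) (K : D.Cell) (σ : D.Edge)

theorem gradK_sub : D.gradK (v - w) K = D.gradK v K - D.gradK w K := by
  simp only [gradK, ← smul_sub, ← Finset.sum_sub_distrib, ← sub_smul, Prod.fst_sub, Prod.snd_sub,
    Pi.sub_apply]
  congr! 3
  ring

theorem stab_sub : D.stab (v - w) K σ = D.stab v K σ - D.stab w K σ := by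
  simp only [stab, gradK_sub, inner_sub_left, Prod.fst_sub, Prod.snd_sub, Pi.sub_apply]
  ring

theorem gradKσ_sub : D.gradKσ (v - w) K σ = D.gradKσ v K σ - D.gradKσ w K σ := by
  rw [gradKσ, gradKσ, gradKσ, gradK_sub, stab_sub]
  module

theorem gradD_sub : D.gradD (v - w) = D.gradD v - D.gradD w := by
  ext1 x
  simp only [gradD, Pi.sub_apply, ← Finset.sum_sub_distrib]
  refine Finset.sum_congr rfl fun K _ => Finset.sum_congr rfl fun σ _ => ?_
  by_cases hx : x ∈ D.cone K σ <;> simp [hx, gradKσ_sub]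

end Linear

section Bounds

variable (hΩ : Bornology.IsBounded Ω)

/-- The contribution of `K` to the square of the seminorm `|v|_X`. -/
def cellSeminormSq (v : D.X) (K : D.Cell) : ℝ :=
  ∑ σ ∈ D.edgesOf K, D.area σ / D.dist K σ * (v.2 σ - v.1 K) ^ 2

theorem norm_smul_normal {K : D.Cell} {σ : D.Edge} (hσ : σ ∈ D.edgesOf K) (a : ℝ) :
    ‖a • D.normal K σ‖ = |a| := by
  rw [norm_smul, (D.normal_spec K σ hσ).norm_eq, mul_one, Real.norm_eq_abs]

theorem norm_gradKσ_le {K : D.Cell} {σ : D.Edge} (hσ : σ ∈ D.edgesOf K) (v : D.X) (G : Pt d) :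
    ‖D.gradKσ v K σ - G‖ ≤ ‖D.gradK v K - G‖ + |D.stab v K σ| := by
  rw [gradKσ, add_sub_right_comm, ← D.norm_smul_normal hσ]
  exact norm_add_le _ _

include hΩ

theorem abs_inner_bary_le {K : D.Cell} {σ : D.Edge} (hσ : σ ∈ D.edgesOf K) (g : Pt d) :
    |⟪g, D.bary σ - D.center K⟫| ≤ ‖g‖ * D.diam K := by
  refine (abs_real_inner_le_norm _ _).trans ?_
  gcongr
  exact D.norm_bary_sub_le hΩ hσ (subset_closure (D.center_mem K))

theorem area_div_dist_mul_inner_sq_le {T : ℝ} {K : D.Cell} {σ : D.Edge} (hσ : σ ∈ D.edgesOf K)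
    (hT : D.diam K ≤ T * D.dist K σ) (g : Pt d) :
    D.area σ / D.dist K σ * ⟪g, D.bary σ - D.center K⟫ ^ 2 ≤
      D.area σ * D.dist K σ * (T ^ 2 * ‖g‖ ^ 2) := by
  have hdist : 0 < D.dist K σ := D.dist_pos K σ hσ
  have hinner : |⟪g, D.bary σ - D.center K⟫| ≤ ‖g‖ * (T * D.dist K σ) :=
    (D.abs_inner_bary_le hΩ hσ g).trans (mul_le_mul_of_nonneg_left hT (norm_nonneg _))
  have := D.area_div_dist_pos hΩ hσ
  calc _ = D.area σ / D.dist K σ * |⟪g, D.bary σ - D.center K⟫| ^ 2 := by rw [sq_abs]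
    _ ≤ D.area σ / D.dist K σ * (‖g‖ * (T * D.dist K σ)) ^ 2 := by gcongr
    _ = _ := by field_simp

variable [NeZero d]

theorem vol_mul_norm_gradK_sq_le (v : D.X) (K : D.Cell) :
    D.vol K * ‖D.gradK v K‖ ^ 2 ≤ d * D.cellSeminormSq v K := by
  have hvol := D.vol_pos hΩ K
  have hnorm : D.vol K * ‖D.gradK v K‖ ≤ ∑ σ ∈ D.edgesOf K, D.area σ * |v.2 σ - v.1 K| := by
    rw [gradK, norm_smul, norm_inv, Real.norm_of_nonneg hvol.le, mul_inv_cancel_left₀ hvol.ne']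
    refine (norm_sum_le _ _).trans_eq (Finset.sum_congr rfl fun σ hσ => ?_)
    rw [D.norm_smul_normal hσ, abs_mul, abs_of_pos (D.area_pos hΩ σ)]
  have hcauchy : (∑ σ ∈ D.edgesOf K, D.area σ * |v.2 σ - v.1 K|) ^ 2 ≤
      (∑ σ ∈ D.edgesOf K, D.area σ * D.dist K σ) * D.cellSeminormSq v K := by
    refine Finset.sum_sq_le_sum_mul_sum_of_sq_le_mul _ (fun σ hσ => ?_) (fun σ hσ => ?_)
      (fun σ hσ => ?_)
    all_goals
      have harea := D.area_pos hΩ σ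
      have hdist : 0 < D.dist K σ := D.dist_pos K σ hσ
    · positivity
    · positivity
    · rw [mul_pow, sq_abs]
      refine le_of_eq ?_
      field_simp
  rw [D.sum_area_mul_dist hΩ] at hcauchy
  refine le_of_mul_le_mul_left ?_ hvol
  calc D.vol K * (D.vol K * ‖D.gradK v K‖ ^ 2) = (D.vol K * ‖D.gradK v K‖) ^ 2 := by ring
    _ ≤ (∑ σ ∈ D.edgesOf K, D.area σ * |v.2 σ - v.1 K|) ^ 2 := by gcongr
    _ ≤ d * D.vol K * D.cellSeminormSq v K := hcauchy
    _ = _ := by ring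

theorem vol_cone_mul_stab_sq {K : D.Cell} {σ : D.Edge} (hσ : σ ∈ D.edgesOf K) (v : D.X) :
    volume.real (D.cone K σ) * D.stab v K σ ^ 2 = D.area σ / D.dist K σ *
      (v.2 σ - v.1 K - ⟪D.gradK v K, D.bary σ - D.center K⟫) ^ 2 := by
  have hdist : D.dist K σ ≠ 0 := (D.dist_pos K σ hσ).ne'
  have hd : (d : ℝ) ≠ 0 := NeZero.ne _
  rw [D.vol_cone hΩ hσ, stab, mul_pow, div_pow, Real.sq_sqrt (Nat.cast_nonneg d)]
  field_simp

section Stability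

variable {T : ℝ} {K : D.Cell} (hT : ∀ σ ∈ D.edgesOf K, D.diam K ≤ T * D.dist K σ)

include hT

theorem sum_vol_cone_mul_stab_sq_le (v : D.X) :
    ∑ σ ∈ D.edgesOf K, volume.real (D.cone K σ) * D.stab v K σ ^ 2 ≤
      2 * D.cellSeminormSq v K + 2 * T ^ 2 * d * (D.vol K * ‖D.gradK v K‖ ^ 2) := by
  have hedge (σ) (hσ : σ ∈ D.edgesOf K) : volume.real (D.cone K σ) * D.stab v K σ ^ 2 ≤
      2 * (D.area σ / D.dist K σ * (v.2 σ - v.1 K) ^ 2) +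
        D.area σ * D.dist K σ * (2 * T ^ 2 * ‖D.gradK v K‖ ^ 2) := by
    rw [D.vol_cone_mul_stab_sq hΩ hσ]
    calc _ ≤ D.area σ / D.dist K σ * (2 * ((v.2 σ - v.1 K) ^ 2 +
            ⟪D.gradK v K, D.bary σ - D.center K⟫ ^ 2)) := by
          have := D.area_div_dist_pos hΩ hσ
          gcongr
          simpa only [sub_eq_add_neg, neg_sq] using
            add_sq_le (a := v.2 σ - v.1 K) (b := -⟪D.gradK v K, D.bary σ - D.center K⟫)
      _ ≤ _ := by linarith [D.area_div_dist_mul_inner_sq_le hΩ hσ (hT σ hσ) (D.gradK v K)]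
  refine (Finset.sum_le_sum hedge).trans_eq ?_
  rw [Finset.sum_add_distrib, ← Finset.mul_sum, ← Finset.sum_mul, D.sum_area_mul_dist hΩ,
    cellSeminormSq]
  ring

theorem sum_vol_cone_mul_norm_sq_le (v : D.X) :
    ∑ σ ∈ D.edgesOf K, volume.real (D.cone K σ) * ‖D.gradKσ v K σ‖ ^ 2 ≤
      (2 * d + 4 + 4 * T ^ 2 * d ^ 2) * D.cellSeminormSq v K := by
  have hedge (σ) (hσ : σ ∈ D.edgesOf K) : volume.real (D.cone K σ) * ‖D.gradKσ v K σ‖ ^ 2 ≤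
      volume.real (D.cone K σ) * (2 * ‖D.gradK v K‖ ^ 2) +
        2 * (volume.real (D.cone K σ) * D.stab v K σ ^ 2) := by
    have hnorm : ‖D.gradKσ v K σ‖ ≤ ‖D.gradK v K‖ + |D.stab v K σ| := by
      simpa only [sub_zero] using D.norm_gradKσ_le hσ v 0
    calc _ ≤ volume.real (D.cone K σ) * (2 * (‖D.gradK v K‖ ^ 2 + |D.stab v K σ| ^ 2)) := by
          gcongr
          exact (pow_le_pow_left₀ (norm_nonneg _) hnorm 2).trans add_sq_le
      _ = _ := by rw [sq_abs]; ring
  calc _ ≤ D.vol K * (2 * ‖D.gradK v K‖ ^ 2) +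
        2 * ∑ σ ∈ D.edgesOf K, volume.real (D.cone K σ) * D.stab v K σ ^ 2 := by
        refine (Finset.sum_le_sum hedge).trans_eq ?_
        rw [Finset.sum_add_distrib, ← Finset.sum_mul, D.sum_vol_cone hΩ, ← Finset.mul_sum]
    _ ≤ 4 * D.cellSeminormSq v K +
        (2 + 4 * T ^ 2 * d) * (D.vol K * ‖D.gradK v K‖ ^ 2) := by
        linarith [D.sum_vol_cone_mul_stab_sq_le hΩ hT v]
    _ ≤ 4 * D.cellSeminormSq v K + (2 + 4 * T ^ 2 * d) * (d * D.cellSeminormSq v K) := by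
        gcongr _ + _ * ?_
        exact D.vol_mul_norm_gradK_sq_le hΩ v K
    _ = _ := by ring

end Stability

section Consistency

variable {v : D.X} {K : D.Cell} {G : Pt d} {ε : ℝ}
  (h : ∀ σ ∈ D.edgesOf K,
    |v.2 σ - v.1 K - ⟪G, D.bary σ - D.center K⟫| ≤ ε * D.dist K σ)

include h

theorem norm_gradK_sub_le : ‖D.gradK v K - G‖ ≤ d * ε := by
  have hvol := D.vol_pos hΩ K
  have hG : G = (D.vol K)⁻¹ • ∑ σ ∈ D.edgesOf K,
      (D.area σ * ⟪G, D.bary σ - D.center K⟫) • D.normal K σ := by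
    rw [D.sum_area_inner_smul hΩ, inv_smul_smul₀ hvol.ne']
  have hsub : D.gradK v K - G = (D.vol K)⁻¹ • ∑ σ ∈ D.edgesOf K,
      (D.area σ * (v.2 σ - v.1 K - ⟪G, D.bary σ - D.center K⟫)) • D.normal K σ := by
    simp only [mul_sub (D.area _) (_ - _), sub_smul _ _ (D.normal K _), Finset.sum_sub_distrib,
      smul_sub, ← hG, gradK]
  rw [hsub, norm_smul, norm_inv, Real.norm_of_nonneg hvol.le, inv_mul_le_iff₀ hvol]
  calc _ ≤ ∑ σ ∈ D.edgesOf K, D.area σ * (ε * D.dist K σ) := by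
        refine (norm_sum_le _ _).trans (Finset.sum_le_sum fun σ hσ => ?_)
        have harea := D.area_pos hΩ σ
        rw [D.norm_smul_normal hσ, abs_mul, abs_of_pos harea]
        exact mul_le_mul_of_nonneg_left (h σ hσ) harea.le
    _ = ε * ∑ σ ∈ D.edgesOf K, D.area σ * D.dist K σ := by
        rw [Finset.mul_sum]
        exact Finset.sum_congr rfl fun σ _ => by ring
    _ = D.vol K * (d * ε) := by
        rw [D.sum_area_mul_dist hΩ]
        ring

variable {T : ℝ} {σ : D.Edge} (hσ : σ ∈ D.edgesOf K) (hT : D.diam K ≤ T * D.dist K σ)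

include hσ hT

theorem abs_stab_le : |D.stab v K σ| ≤ √d * (1 + d * T) * ε := by
  have hdist : 0 < D.dist K σ := D.dist_pos K σ hσ
  have hinner : |⟪D.gradK v K - G, D.bary σ - D.center K⟫| ≤ d * ε * (T * D.dist K σ) := by
    refine (D.abs_inner_bary_le hΩ hσ _).trans ?_
    exact mul_le_mul (D.norm_gradK_sub_le hΩ h) hT Metric.diam_nonneg
      ((norm_nonneg _).trans (D.norm_gradK_sub_le hΩ h))
  have hresidual : |v.2 σ - v.1 K - ⟪D.gradK v K, D.bary σ - D.center K⟫| ≤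
      (1 + d * T) * ε * D.dist K σ := by
    rw [← sub_sub_sub_cancel_right _ _ ⟪G, D.bary σ - D.center K⟫, ← inner_sub_left]
    refine (abs_sub _ _).trans ?_
    linarith [h σ hσ]
  rw [stab, abs_mul, abs_of_nonneg (by positivity : 0 ≤ √d / D.dist K σ)]
  calc _ ≤ √d / D.dist K σ * ((1 + d * T) * ε * D.dist K σ) := by gcongr
    _ = _ := by field_simp

theorem norm_gradKσ_sub_le :
    ‖D.gradKσ v K σ - G‖ ≤ (d + √d * (1 + d * T)) * ε := by
  linarith [D.norm_gradKσ_le hσ v G, D.norm_gradK_sub_le hΩ h, D.abs_stab_le hΩ h hσ hT]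

end Consistency

end Bounds

section Interpolation

variable (hΩ : Bornology.IsBounded Ω) {R M : ℝ} (hR : Ω ⊆ Metric.closedBall 0 R) {u : Pt d → ℝ}
  (hM : IsTaylorBound u R M)

include hR

theorem norm_center_le (K : D.Cell) : ‖D.center K‖ ≤ R :=
  mem_closedBall_zero_iff.1 (hR (D.cell_subset K (D.center_mem K)))

include hΩ hM

theorem abs_apply_bary_le (hu : Differentiable ℝ u) {K : D.Cell} {σ : D.Edge}
    (h0 : ∀ y ∈ D.edge σ, u y = 0) (hσ : σ ∈ D.edgesOf K) :
    |u (D.bary σ)| ≤ M * D.diam K ^ 2 := by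
  obtain ⟨y, hy⟩ := D.edge_nonempty σ
  have hyR : ‖y‖ ≤ R := mem_closedBall_zero_iff.1
    (closure_minimal hR Metric.isClosed_closedBall (D.edge_subset σ hy))
  have hinner : ⟪∇ u y, D.bary σ - y⟫ = 0 :=
    D.inner_bary_sub_eq hΩ σ fun z hz => D.inner_gradient_eq_zero h0 (hu y) hy hz
  have htaylor := hM.taylor y (D.bary σ) hyR (D.norm_bary_le hR σ)
  rw [h0 y hy, hinner, sub_zero, sub_zero] at htaylor
  have := hM.nonneg
  refine htaylor.trans ?_
  gcongr
  exact D.norm_bary_sub_le hΩ hσ (D.edge_subset_closure_cell hσ hy)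

variable {B : Finset D.Edge} {β : D.Edge → D.Cell → ℝ} {T : ℝ} (hT : D.IsRegular B β T)
  (hβ : D.IsBarycentric B β) (hu : Differentiable ℝ u)
  (h0 : ∀ σ ∈ D.extEdges, ∀ y ∈ D.edge σ, u y = 0) {K : D.Cell} {σ : D.Edge}
  (hσ : σ ∈ D.edgesOf K)

include hT hβ hu h0 hσ

theorem abs_interpB_sub_bary_le :
    |(D.interpB B β u).2 σ - u (D.bary σ)| ≤ M * T * D.diam K ^ 2 := by
  have hM0 := hM.nonneg
  have hT1 := hT.one_le
  simp only [interpB]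
  split_ifs with hext hB
  · rw [zero_sub, abs_neg]
    calc |u (D.bary σ)| ≤ M * D.diam K ^ 2 := D.abs_apply_bary_le hΩ hR hM hu (h0 σ hext) hσ
      _ ≤ M * T * D.diam K ^ 2 := by
        gcongr
        exact le_mul_of_one_le_right hM0 hT1
  · obtain ⟨hsum, hbary⟩ := hβ σ hB
    calc _ ≤ M * ∑ L, |β σ L| * ‖D.center L - D.bary σ‖ ^ 2 :=
          hM.abs_sum_mul_sub_le hsum hbary (D.norm_bary_le hR σ) fun L _ => D.norm_center_le hR L
      _ ≤ M * (T * D.diam K ^ 2) := mul_le_mul_of_nonneg_left (hT.bary_le K σ hσ hB) hM0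
      _ = _ := by ring
  · rw [sub_self, abs_zero]
    positivity

theorem abs_interpB_sub_le :
    |(D.interpB B β u).2 σ - (D.interpB B β u).1 K -
      ⟪∇ u (D.center K), D.bary σ - D.center K⟫| ≤ M * (1 + T) * T * D.diam K * D.dist K σ := by
  have hM0 := hM.nonneg
  have hT1 := hT.one_le
  have hdiam : 0 ≤ D.diam K := Metric.diam_nonneg
  have hinterp := D.abs_interpB_sub_bary_le hΩ hR hM hT hβ hu h0 hσ
  have htaylor : |u (D.bary σ) - u (D.center K) - ⟪∇ u (D.center K), D.bary σ - D.center K⟫| ≤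
      M * D.diam K ^ 2 := by
    refine (hM.taylor _ _ (D.norm_center_le hR K) (D.norm_bary_le hR σ)).trans ?_
    gcongr
    exact D.norm_bary_sub_le hΩ hσ (subset_closure (D.center_mem K))
  have hcenter : (D.interpB B β u).1 K = u (D.center K) := rfl
  rw [hcenter, ← sub_add_sub_cancel _ (u (D.bary σ)) (u (D.center K)), add_sub_assoc]
  calc _ ≤ M * T * D.diam K ^ 2 + M * D.diam K ^ 2 :=
        (abs_add_le _ _).trans (add_le_add hinterp htaylor)
    _ = M * (1 + T) * D.diam K * D.diam K := by ring
    _ ≤ M * (1 + T) * D.diam K * (T * D.dist K σ) := by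
        gcongr
        exact hT.diam_le K σ hσ
    _ = _ := by ring

end Interpolation

end Discretisation

/-! ### The SUSHI fluxes -/

namespace Discretisation

variable {d : ℕ} {Ω : Set (Pt d)} (D : Discretisation Ω)

theorem yvec_eq (K : D.Cell) (τ σ : D.Edge) :
    D.yvec K τ σ = (D.area σ / D.vol K) • D.normal K σ + (√d / D.dist K τ *
      ((if τ = σ then 1 else 0) - D.area σ / D.vol K * ⟪D.normal K σ, D.bary τ - D.center K⟫)) •
        D.normal K τ := by
  by_cases h : τ = σ
  · subst h
    simp [yvec]
  · simp only [yvec, h, if_false]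
    rw [sub_eq_add_neg, ← neg_smul]
    congr 2
    ring

theorem stab_eq_sum (v : D.X) {K : D.Cell} {τ : D.Edge} (hτ : τ ∈ D.edgesOf K) :
    D.stab v K τ = ∑ σ ∈ D.edgesOf K, (v.2 σ - v.1 K) * (√d / D.dist K τ *
      ((if τ = σ then 1 else 0) -
        D.area σ / D.vol K * ⟪D.normal K σ, D.bary τ - D.center K⟫)) := by
  have hvalue : v.2 τ - v.1 K =
      ∑ σ ∈ D.edgesOf K, (v.2 σ - v.1 K) * (if τ = σ then 1 else 0) := by
    simp [hτ]
  have hinner : ⟪D.gradK v K, D.bary τ - D.center K⟫ = ∑ σ ∈ D.edgesOf K, (v.2 σ - v.1 K) *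
      (D.area σ / D.vol K * ⟪D.normal K σ, D.bary τ - D.center K⟫) := by
    rw [gradK, real_inner_smul_left, sum_inner, Finset.mul_sum]
    refine Finset.sum_congr rfl fun σ _ => ?_
    rw [real_inner_smul_left]
    ring
  rw [stab, hvalue, hinner, ← Finset.sum_sub_distrib, Finset.mul_sum]
  exact Finset.sum_congr rfl fun σ _ => by ring

theorem gradKσ_eq_sum (v : D.X) {K : D.Cell} {τ : D.Edge} (hτ : τ ∈ D.edgesOf K) :
    D.gradKσ v K τ = ∑ σ ∈ D.edgesOf K, (v.2 σ - v.1 K) • D.yvec K τ σ := by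
  simp only [D.yvec_eq, smul_add, Finset.sum_add_distrib, smul_smul]
  rw [gradKσ, ← Finset.sum_smul, ← D.stab_eq_sum v hτ, gradK, Finset.smul_sum]
  congr 1
  refine Finset.sum_congr rfl fun σ _ => ?_
  rw [smul_smul]
  congr 1
  ring

theorem localMatrix_idField (K : D.Cell) (σ σ' : D.Edge) :
    D.localMatrix (idField d) K σ σ' = ∑ τ ∈ D.edgesOf K,
      volume.real (D.cone K τ) * ⟪D.yvec K τ σ, D.yvec K τ σ'⟫ := by
  refine Finset.sum_congr rfl fun τ _ => ?_
  simp only [idField]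
  rw [setIntegral_const]
  simp [inner_smul_right]

theorem sushiFlux_eq (v : D.X) (K : D.Cell) (σ : D.Edge) :
    D.sushiFlux (idField d) K σ v = -∑ τ ∈ D.edgesOf K,
      volume.real (D.cone K τ) * ⟪D.yvec K τ σ, D.gradKσ v K τ⟫ := by
  have happly : D.sushiFlux (idField d) K σ v = ∑ σ' ∈ D.edgesOf K,
      D.localMatrix (idField d) K σ σ' * (v.1 K - v.2 σ') := by
    simp [sushiFlux]
  simp only [happly, D.localMatrix_idField, Finset.sum_mul]
  rw [Finset.sum_comm, ← Finset.sum_neg_distrib]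
  refine Finset.sum_congr rfl fun τ hτ => ?_
  rw [D.gradKσ_eq_sum v hτ, inner_sum, Finset.mul_sum, ← Finset.sum_neg_distrib]
  refine Finset.sum_congr rfl fun σ' _ => ?_
  rw [inner_smul_right]
  ring

theorem form_sushiFlux (v w : D.X) :
    D.form (D.sushiFlux (idField d)) v w = ∑ K, ∑ τ ∈ D.edgesOf K,
      volume.real (D.cone K τ) * ⟪D.gradKσ w K τ, D.gradKσ v K τ⟫ := by
  refine Finset.sum_congr rfl fun K _ => ?_
  simp only [D.sushiFlux_eq, ← Finset.sum_neg_distrib, Finset.sum_mul]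
  rw [Finset.sum_comm]
  refine Finset.sum_congr rfl fun τ hτ => ?_
  rw [D.gradKσ_eq_sum w hτ, sum_inner, Finset.mul_sum]
  refine Finset.sum_congr rfl fun σ _ => ?_
  rw [real_inner_smul_left]
  ring

section Bounded

variable (hΩ : Bornology.IsBounded Ω)

include hΩ

theorem abs_integral_edge_inner_gradient_sub_le {R M : ℝ} (hR : Ω ⊆ Metric.closedBall 0 R)
    {u : Pt d → ℝ} (hu : Continuous (∇ u)) (hM : IsTaylorBound u R M) {K : D.Cell}
    {σ : D.Edge} (hσ : σ ∈ D.edgesOf K) :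
    |∫ x in D.edge σ, ⟪∇ u x, D.normal K σ⟫ ∂(surf d) -
      D.area σ * ⟪D.normal K σ, ∇ u (D.center K)⟫| ≤ M * D.diam K * D.area σ := by
  have hsub : ∫ x in D.edge σ, ⟪∇ u x, D.normal K σ⟫ ∂(surf d) -
      D.area σ * ⟪D.normal K σ, ∇ u (D.center K)⟫ =
      ∫ x in D.edge σ, ⟪∇ u x - ∇ u (D.center K), D.normal K σ⟫ ∂(surf d) := by
    simp only [inner_sub_left]
    rw [integral_sub (D.integrableOn_edge hΩ σ (by fun_prop))
      (D.integrableOn_edge hΩ σ (by fun_prop)), setIntegral_const, smul_eq_mul,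
      real_inner_comm (∇ u (D.center K)), area]
  rw [hsub, ← Real.norm_eq_abs]
  refine norm_setIntegral_le_of_norm_le_const (D.surf_edge_lt_top hΩ σ) fun y hy => ?_
  have hyR : ‖y‖ ≤ R := mem_closedBall_zero_iff.1
    (closure_minimal hR Metric.isClosed_closedBall (D.edge_subset σ hy))
  calc _ ≤ ‖∇ u y - ∇ u (D.center K)‖ * ‖D.normal K σ‖ := norm_inner_le_norm _ _
    _ = ‖∇ u y - ∇ u (D.center K)‖ := by rw [(D.normal_spec K σ hσ).norm_eq, mul_one]
    _ ≤ M * ‖y - D.center K‖ := hM.grad _ _ (D.norm_center_le hR K) hyR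
    _ ≤ M * D.diam K := mul_le_mul_of_nonneg_left (D.norm_sub_le_diam hΩ
        (D.edge_subset_closure_cell hσ hy) (subset_closure (D.center_mem K))) hM.nonneg

theorem sum_vol_le : ∑ K, D.vol K ≤ volume.real Ω := by
  have hunion : ∑ K, D.vol K = volume.real (⋃ K, D.cell K) :=
    (measureReal_iUnion_fintype D.cell_disjoint (fun K => (D.cell_open K).measurableSet)
      (fun K => (hΩ.subset (D.cell_subset K)).measure_lt_top.ne)).symm
  rw [hunion]
  exact measureReal_mono (Set.iUnion_subset D.cell_subset) hΩ.measure_lt_top.ne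

theorem vol_cone_mul_sqrt_div_dist {K : D.Cell} {σ : D.Edge} (hσ : σ ∈ D.edgesOf K) :
    volume.real (D.cone K σ) * (√d / D.dist K σ) = √d / d * D.area σ := by
  have hdist : D.dist K σ ≠ 0 := (D.dist_pos K σ hσ).ne'
  rw [D.vol_cone hΩ hσ]
  field_simp

variable [NeZero d]

theorem consErr_le {B : Finset D.Edge} {β : D.Edge → D.Cell → ℝ} {F : D.Fluxes} {u : Pt d → ℝ}
    {C : ℝ} (hC : 0 ≤ C) (h : ∀ K, ∀ σ ∈ D.edgesOf K, |F K σ (D.interpB B β u) +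
      ∫ x in D.edge σ, ⟪∇ u x, D.normal K σ⟫ ∂(surf d)| ≤ C * D.diam K * D.area σ) :
    D.consErr B β F u ≤ C * √(d * volume.real Ω) * D.size := by
  have hsize := D.size_nonneg
  refine Real.sqrt_le_iff.2 ⟨by positivity, ?_⟩
  rw [mul_right_comm, mul_pow _ (√_), Real.sq_sqrt (by positivity)]
  calc _ ≤ ∑ K, ∑ σ ∈ D.edgesOf K, D.area σ * D.dist K σ * (C * D.size) ^ 2 := by
        refine Finset.sum_le_sum fun K _ => Finset.sum_le_sum fun σ hσ => ?_
        have harea := D.area_pos hΩ σ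
        have hdist : 0 < D.dist K σ := D.dist_pos K σ hσ
        have hedge := (h K σ hσ).trans (by gcongr; exact D.diam_le_size K :
          C * D.diam K * D.area σ ≤ C * D.size * D.area σ)
        rw [← sq_abs]
        calc _ ≤ D.dist K σ / D.area σ * (C * D.size * D.area σ) ^ 2 := by gcongr
          _ = _ := by field_simp
    _ = (C * D.size) ^ 2 * (d * ∑ K, D.vol K) := by
        simp only [← Finset.sum_mul, D.sum_area_mul_dist hΩ, ← Finset.mul_sum]
        ring
    _ ≤ _ := by
        gcongr
        exact D.sum_vol_le hΩ

theorem sum_vol_cone_mul_stab_smul_normal (v : D.X) (K : D.Cell) :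
    ∑ σ ∈ D.edgesOf K, (volume.real (D.cone K σ) * D.stab v K σ) • D.normal K σ = 0 := by
  have hedge (σ) (hσ : σ ∈ D.edgesOf K) :
      (volume.real (D.cone K σ) * D.stab v K σ) • D.normal K σ =
        (√d / d) • ((D.area σ * (v.2 σ - v.1 K)) • D.normal K σ -
          (D.area σ * ⟪D.gradK v K, D.bary σ - D.center K⟫) • D.normal K σ) := by
    rw [← sub_smul, smul_smul, stab, ← mul_assoc, D.vol_cone_mul_sqrt_div_dist hΩ hσ]
    congr 1
    ring
  rw [Finset.sum_congr rfl hedge, ← Finset.smul_sum, Finset.sum_sub_distrib,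
    D.sum_area_inner_smul hΩ, gradK, smul_inv_smul₀ (D.vol_pos hΩ K).ne', sub_self, smul_zero]

/-- The consistent part and the stabilisation of the discrete gradient are orthogonal. -/
theorem sum_vol_cone_mul_norm_sq_eq (v : D.X) (K : D.Cell) :
    ∑ σ ∈ D.edgesOf K, volume.real (D.cone K σ) * ‖D.gradKσ v K σ‖ ^ 2 =
      D.vol K * ‖D.gradK v K‖ ^ 2 +
        ∑ σ ∈ D.edgesOf K, volume.real (D.cone K σ) * D.stab v K σ ^ 2 := by
  have horthogonal : ∑ σ ∈ D.edgesOf K,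
      ⟪D.gradK v K, (volume.real (D.cone K σ) * D.stab v K σ) • D.normal K σ⟫ = 0 := by
    rw [← inner_sum, D.sum_vol_cone_mul_stab_smul_normal hΩ, inner_zero_right]
  have hedge (σ) (hσ : σ ∈ D.edgesOf K) : volume.real (D.cone K σ) * ‖D.gradKσ v K σ‖ ^ 2 =
      volume.real (D.cone K σ) * ‖D.gradK v K‖ ^ 2 +
        volume.real (D.cone K σ) * D.stab v K σ ^ 2 +
          2 * ⟪D.gradK v K, (volume.real (D.cone K σ) * D.stab v K σ) • D.normal K σ⟫ := by
    rw [gradKσ, norm_add_sq_real, D.norm_smul_normal hσ, sq_abs, inner_smul_right,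
      inner_smul_right]
    ring
  rw [Finset.sum_congr rfl hedge, Finset.sum_add_distrib, Finset.sum_add_distrib,
    ← Finset.mul_sum, horthogonal, mul_zero, add_zero, ← Finset.sum_mul, D.sum_vol_cone hΩ]

section Cell

variable {T : ℝ} {K : D.Cell} (hT : ∀ σ ∈ D.edgesOf K, D.diam K ≤ T * D.dist K σ)

include hT

theorem cellSeminormSq_le (v : D.X) :
    D.cellSeminormSq v K ≤ (2 + 2 * T ^ 2 * d) *
      ∑ σ ∈ D.edgesOf K, volume.real (D.cone K σ) * ‖D.gradKσ v K σ‖ ^ 2 := by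
  have hedge (σ) (hσ : σ ∈ D.edgesOf K) : D.area σ / D.dist K σ * (v.2 σ - v.1 K) ^ 2 ≤
      2 * (volume.real (D.cone K σ) * D.stab v K σ ^ 2) +
        D.area σ * D.dist K σ * (2 * T ^ 2 * ‖D.gradK v K‖ ^ 2) := by
    set r := ⟪D.gradK v K, D.bary σ - D.center K⟫ with hr
    calc _ = D.area σ / D.dist K σ * ((v.2 σ - v.1 K - r) + r) ^ 2 := by rw [sub_add_cancel]
      _ ≤ D.area σ / D.dist K σ * (2 * ((v.2 σ - v.1 K - r) ^ 2 + r ^ 2)) := by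
        have := D.area_div_dist_pos hΩ hσ
        gcongr
        exact add_sq_le
      _ ≤ _ := by
        rw [D.vol_cone_mul_stab_sq hΩ hσ, ← hr]
        linarith [D.area_div_dist_mul_inner_sq_le hΩ hσ (hT σ hσ) (D.gradK v K)]
  have hstab : 0 ≤ ∑ σ ∈ D.edgesOf K, volume.real (D.cone K σ) * D.stab v K σ ^ 2 :=
    Finset.sum_nonneg fun σ _ => mul_nonneg measureReal_nonneg (sq_nonneg _)
  have hgrad : 0 ≤ D.vol K * ‖D.gradK v K‖ ^ 2 := mul_nonneg (D.vol_pos hΩ K).le (sq_nonneg _)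
  rw [D.sum_vol_cone_mul_norm_sq_eq hΩ]
  calc _ ≤ 2 * ∑ σ ∈ D.edgesOf K, volume.real (D.cone K σ) * D.stab v K σ ^ 2 +
        d * D.vol K * (2 * T ^ 2 * ‖D.gradK v K‖ ^ 2) := by
        refine (Finset.sum_le_sum hedge).trans_eq ?_
        rw [Finset.sum_add_distrib, ← Finset.mul_sum, ← Finset.sum_mul, D.sum_area_mul_dist hΩ]
    _ ≤ _ := by
        linarith [mul_nonneg (by positivity : 0 ≤ 2 * T ^ 2 * d) hstab]

omit [NeZero d] in
theorem norm_yvec_le {σ τ : D.Edge} (hσ : σ ∈ D.edgesOf K) (hτ : τ ∈ D.edgesOf K) :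
    ‖D.yvec K τ σ‖ ≤ D.area σ / D.vol K * (1 + √d * T) +
      √d / D.dist K τ * (if τ = σ then 1 else 0) := by
  have hdist : 0 < D.dist K τ := D.dist_pos K τ hτ
  have hratio : 0 ≤ D.area σ / D.vol K := (div_pos (D.area_pos hΩ σ) (D.vol_pos hΩ K)).le
  have hinner : |⟪D.normal K σ, D.bary τ - D.center K⟫| ≤ T * D.dist K τ := by
    refine (D.abs_inner_bary_le hΩ hτ _).trans ?_
    rw [(D.normal_spec K σ hσ).norm_eq, one_mul]
    exact hT τ hτ
  have hcoeff : |(if τ = σ then (1 : ℝ) else 0) -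
      D.area σ / D.vol K * ⟪D.normal K σ, D.bary τ - D.center K⟫| ≤
      (if τ = σ then 1 else 0) + D.area σ / D.vol K * (T * D.dist K τ) := by
    refine (abs_sub _ _).trans (add_le_add ?_ ?_)
    · split_ifs <;> simp
    · rw [abs_mul, abs_of_nonneg hratio]
      gcongr
  rw [D.yvec_eq]
  calc _ ≤ D.area σ / D.vol K + √d / D.dist K τ *
        ((if τ = σ then 1 else 0) + D.area σ / D.vol K * (T * D.dist K τ)) := by
        refine (norm_add_le _ _).trans ?_
        rw [D.norm_smul_normal hσ, D.norm_smul_normal hτ, abs_of_nonneg hratio, abs_mul,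
          abs_of_nonneg (by positivity : 0 ≤ √d / D.dist K τ)]
        gcongr
    _ = _ := by
        field_simp
        ring

theorem sum_vol_cone_mul_norm_yvec_le {σ : D.Edge} (hσ : σ ∈ D.edgesOf K) :
    ∑ τ ∈ D.edgesOf K, volume.real (D.cone K τ) * ‖D.yvec K τ σ‖ ≤
      (1 + √d * T + √d / d) * D.area σ := by
  have hvol := D.vol_pos hΩ K
  have hedge (τ) (hτ : τ ∈ D.edgesOf K) : volume.real (D.cone K τ) * ‖D.yvec K τ σ‖ ≤
      volume.real (D.cone K τ) * (D.area σ / D.vol K * (1 + √d * T)) +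
        (if τ = σ then √d / d * D.area τ else 0) := by
    refine (mul_le_mul_of_nonneg_left (D.norm_yvec_le hΩ hT hσ hτ)
      measureReal_nonneg).trans_eq ?_
    rw [mul_add, ← mul_assoc (volume.real _) (√d / _), D.vol_cone_mul_sqrt_div_dist hΩ hτ,
      mul_ite, mul_one, mul_zero]
  refine (Finset.sum_le_sum hedge).trans_eq ?_
  rw [Finset.sum_add_distrib, ← Finset.sum_mul, D.sum_vol_cone hΩ, Finset.sum_ite_eq',
    if_pos hσ]
  field_simp

end Cell

theorem isCoercive_sushiFlux {T : ℝ}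
    (hT : ∀ K, ∀ σ ∈ D.edgesOf K, D.diam K ≤ T * D.dist K σ) :
    D.IsCoercive (D.sushiFlux (idField d)) (1 / (2 + 2 * T ^ 2 * d)) := by
  intro v
  rw [one_div, inv_mul_le_iff₀ (by positivity), D.form_sushiFlux, seminormSq, Finset.mul_sum]
  refine Finset.sum_le_sum fun K _ => ?_
  simp only [real_inner_self_eq_norm_sq]
  exact D.cellSeminormSq_le hΩ (hT K) v

theorem sum_vol_cone_smul_yvec {K : D.Cell} {σ : D.Edge} (hσ : σ ∈ D.edgesOf K) :
    ∑ τ ∈ D.edgesOf K, volume.real (D.cone K τ) • D.yvec K τ σ =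
      D.area σ • D.normal K σ := by
  have hvol := (D.vol_pos hΩ K).ne'
  have hedge (τ) (hτ : τ ∈ D.edgesOf K) : volume.real (D.cone K τ) • D.yvec K τ σ =
      (volume.real (D.cone K τ) * (D.area σ / D.vol K)) • D.normal K σ +
        (√d / d) • ((if τ = σ then D.area τ else 0) • D.normal K τ -
          (D.area σ / D.vol K) •
            ((D.area τ * ⟪D.normal K σ, D.bary τ - D.center K⟫) • D.normal K τ)) := by
    rw [D.yvec_eq, smul_add, smul_smul, smul_smul, ← mul_assoc,
      D.vol_cone_mul_sqrt_div_dist hΩ hτ, smul_smul, ← sub_smul, smul_smul]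
    congr 2
    split_ifs <;> ring
  rw [Finset.sum_congr rfl hedge, Finset.sum_add_distrib, ← Finset.sum_smul, ← Finset.sum_mul,
    D.sum_vol_cone hΩ, ← Finset.smul_sum, Finset.sum_sub_distrib, ← Finset.smul_sum,
    D.sum_area_inner_smul hΩ, smul_smul, div_mul_cancel₀ _ hvol, mul_div_cancel₀ _ hvol]
  simp [hσ]

section Consistency

variable {T : ℝ} {K : D.Cell} (hT : ∀ σ ∈ D.edgesOf K, D.diam K ≤ T * D.dist K σ) {v : D.X}
  {σ : D.Edge} (hσ : σ ∈ D.edgesOf K)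

include hT hσ

theorem abs_sushiFlux_add_area_mul_inner_le {G : Pt d} {ε : ℝ}
    (hv : ∀ τ ∈ D.edgesOf K, ‖D.gradKσ v K τ - G‖ ≤ ε) :
    |D.sushiFlux (idField d) K σ v + D.area σ * ⟪D.normal K σ, G⟫| ≤
      ε * ((1 + √d * T + √d / d) * D.area σ) := by
  have hε : 0 ≤ ε := (norm_nonneg _).trans (hv σ hσ)
  have hconst : D.area σ * ⟪D.normal K σ, G⟫ =
      ∑ τ ∈ D.edgesOf K, volume.real (D.cone K τ) * ⟪D.yvec K τ σ, G⟫ := by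
    simp only [← real_inner_smul_left, ← D.sum_vol_cone_smul_yvec hΩ hσ, sum_inner]
  have hsub : D.sushiFlux (idField d) K σ v + D.area σ * ⟪D.normal K σ, G⟫ =
      -∑ τ ∈ D.edgesOf K, volume.real (D.cone K τ) * ⟪D.yvec K τ σ, D.gradKσ v K τ - G⟫ := by
    simp only [D.sushiFlux_eq, hconst, inner_sub_right, mul_sub, Finset.sum_sub_distrib]
    ring
  rw [hsub, abs_neg]
  calc _ ≤ ∑ τ ∈ D.edgesOf K, volume.real (D.cone K τ) * (‖D.yvec K τ σ‖ * ε) := by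
        refine (Finset.abs_sum_le_sum_abs _ _).trans (Finset.sum_le_sum fun τ hτ => ?_)
        rw [abs_mul, abs_of_nonneg measureReal_nonneg]
        gcongr
        exact (abs_real_inner_le_norm _ _).trans
          (mul_le_mul_of_nonneg_left (hv τ hτ) (norm_nonneg _))
    _ = ε * ∑ τ ∈ D.edgesOf K, volume.real (D.cone K τ) * ‖D.yvec K τ σ‖ := by
        rw [Finset.mul_sum]
        exact Finset.sum_congr rfl fun τ _ => by ring
    _ ≤ _ := by
        gcongr
        exact D.sum_vol_cone_mul_norm_yvec_le hΩ hT hσ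

theorem abs_sushiFlux_add_le {R M C : ℝ} (hR : Ω ⊆ Metric.closedBall 0 R) {u : Pt d → ℝ}
    (hu : Continuous (∇ u)) (hM : IsTaylorBound u R M)
    (hv : ∀ τ ∈ D.edgesOf K, ‖D.gradKσ v K τ - ∇ u (D.center K)‖ ≤ C * D.diam K) :
    |D.sushiFlux (idField d) K σ v + ∫ x in D.edge σ, ⟪∇ u x, D.normal K σ⟫ ∂(surf d)| ≤
      (C * (1 + √d * T + √d / d) + M) * D.diam K * D.area σ := by
  have hflux := D.abs_sushiFlux_add_area_mul_inner_le hΩ hT hσ hv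
  have hintegral := D.abs_integral_edge_inner_gradient_sub_le hΩ hR hu hM hσ
  rw [← add_add_sub_cancel _ _ (D.area σ * ⟪D.normal K σ, ∇ u (D.center K)⟫)]
  calc _ ≤ _ := (abs_add_le _ _).trans (add_le_add hflux hintegral)
    _ = _ := by ring

end Consistency

end Bounded

end Discretisation

/-! ### Error estimates -/

section SimpleFunctions

variable {α V ι : Type*} {s : Finset ι} {A : ι → Set α}

theorem sum_indicator_eq_of_mem [AddCommMonoid V] (hA : (s : Set ι).PairwiseDisjoint A)
    (a : ι → V) {i : ι} (hi : i ∈ s) {x : α} (hx : x ∈ A i) :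
    ∑ j ∈ s, (A j).indicator (fun _ => a j) x = a i := by
  rw [Finset.sum_eq_single_of_mem i hi, Set.indicator_of_mem hx]
  intro j hj hji
  exact Set.indicator_of_notMem (Set.disjoint_right.1 (hA hj hi hji) hx) _

variable [NormedAddCommGroup V]

theorem enorm_sum_indicator_rpow_two (hA : (s : Set ι).PairwiseDisjoint A) (a : ι → V) (x : α) :
    ‖∑ i ∈ s, (A i).indicator (fun _ => a i) x‖ₑ ^ (2 : ℝ) =
      ∑ i ∈ s, (A i).indicator (fun _ => ENNReal.ofReal (‖a i‖ ^ 2)) x := by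
  by_cases hx : ∃ i ∈ s, x ∈ A i
  · obtain ⟨i, hi, hxi⟩ := hx
    rw [sum_indicator_eq_of_mem hA _ hi hxi, sum_indicator_eq_of_mem hA _ hi hxi, ← ofReal_norm,
      ENNReal.ofReal_rpow_of_nonneg (norm_nonneg _) zero_le_two, Real.rpow_two]
  · push Not at hx
    rw [Finset.sum_eq_zero fun i hi => Set.indicator_of_notMem (hx i hi) _,
      Finset.sum_eq_zero fun i hi => Set.indicator_of_notMem (hx i hi) _, enorm_zero,
      ENNReal.zero_rpow_of_pos two_pos]

theorem eLpNorm_sum_indicator_two [MeasurableSpace α] {μ : Measure α}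
    (hA : (s : Set ι).PairwiseDisjoint A) (hmeas : ∀ i ∈ s, MeasurableSet (A i))
    (hfin : ∀ i ∈ s, μ (A i) ≠ ⊤) (a : ι → V) :
    eLpNorm (fun x => ∑ i ∈ s, (A i).indicator (fun _ => a i) x) 2 μ =
      ENNReal.ofReal √(∑ i ∈ s, μ.real (A i) * ‖a i‖ ^ 2) := by
  have hnonneg (i) (_ : i ∈ s) : 0 ≤ μ.real (A i) * ‖a i‖ ^ 2 := by positivity
  have hlintegral : ∫⁻ x, ‖∑ i ∈ s, (A i).indicator (fun _ => a i) x‖ₑ ^ (2 : ℝ) ∂μ =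
      ENNReal.ofReal (∑ i ∈ s, μ.real (A i) * ‖a i‖ ^ 2) := by
    simp only [enorm_sum_indicator_rpow_two hA]
    rw [lintegral_finsetSum' _ fun i hi => (measurable_const.indicator (hmeas i hi)).aemeasurable,
      ENNReal.ofReal_sum_of_nonneg hnonneg]
    refine Finset.sum_congr rfl fun i hi => ?_
    rw [lintegral_indicator_const (hmeas i hi), ENNReal.ofReal_mul measureReal_nonneg,
      ofReal_measureReal (hfin i hi), mul_comm]
  rw [eLpNorm_eq_lintegral_rpow_enorm_toReal two_ne_zero ENNReal.ofNat_ne_top,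
    ENNReal.toReal_ofNat, hlintegral, Real.sqrt_eq_rpow,
    ENNReal.ofReal_rpow_of_nonneg (Finset.sum_nonneg hnonneg) (by positivity)]

theorem eLpNorm_two_le_of_ae_bound [MeasurableSpace α] {μ : Measure α} [IsFiniteMeasure μ]
    {g : α → V} {C : ℝ} (hg : ∀ᵐ x ∂μ, ‖g x‖ ≤ C) :
    eLpNorm g 2 μ ≤ ENNReal.ofReal (C * √(μ.real Set.univ)) := by
  refine (eLpNorm_le_of_ae_bound hg).trans_eq ?_
  rw [ENNReal.toReal_ofNat, mul_comm C, ENNReal.ofReal_mul (Real.sqrt_nonneg _),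
    Real.sqrt_eq_rpow, one_div, ← ENNReal.ofReal_rpow_of_nonneg measureReal_nonneg (by positivity),
    ofReal_measureReal]

end SimpleFunctions

/-- The constant in the consistency estimate of the discrete gradient, in terms of the regularity
`T` of the mesh and of the constant `M` of `IsTaylorBound`. -/
def consistencyConst (d : ℕ) (T M : ℝ) : ℝ := (d + √d * (1 + d * T)) * (M * (1 + T) * T)

theorem consistencyConst_nonneg (d : ℕ) {T M : ℝ} (hT : 0 ≤ T) (hM : 0 ≤ M) :
    0 ≤ consistencyConst d T M := by
  rw [consistencyConst]
  positivity

namespace Discretisation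

variable {d : ℕ} {Ω : Set (Pt d)} (D : Discretisation Ω)

theorem piM_sub_projM (B : Finset D.Edge) (β : D.Edge → D.Cell → ℝ) (u : Pt d → ℝ) (v : D.X) :
    D.piM v - D.projM u = D.piM (v - D.interpB B β u) := by
  ext1 x
  simp only [piM, projM, Pi.sub_apply, ← Finset.sum_sub_distrib]
  exact Finset.sum_congr rfl fun K _ => (congrFun (Set.indicator_sub' _ _ _) x).symm

/-- The pairs `(K, σ)` with `σ ∈ E_K`, which index the cones `D_{K,σ}`. -/
def pairs : Finset (Σ _ : D.Cell, D.Edge) := Finset.univ.sigma D.edgesOf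

variable {D} in
theorem mem_pairs {p : Σ _ : D.Cell, D.Edge} : p ∈ D.pairs ↔ p.2 ∈ D.edgesOf p.1 := by
  simp [pairs]

theorem gradD_eq_sum_pairs (v : D.X) : D.gradD v = fun x =>
    ∑ p ∈ D.pairs, (D.cone p.1 p.2).indicator (fun _ => D.gradKσ v p.1 p.2) x := by
  ext1 x
  rw [gradD, Finset.sum_sigma', pairs]

section Bounded

variable (hΩ : Bornology.IsBounded Ω)

include hΩ

theorem normL2_piM_le (v : D.X) : normL2 Ω (D.piM v) ≤ ENNReal.ofReal √(D.cellNormSq v) := by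
  refine (eLpNorm_mono_measure _ Measure.restrict_le_self).trans_eq ?_
  refine (eLpNorm_sum_indicator_two (fun K _ L _ hKL => D.cell_disjoint hKL)
    (fun K _ => (D.cell_open K).measurableSet)
    (fun K _ => (hΩ.subset (D.cell_subset K)).measure_lt_top.ne) v.1).trans ?_
  simp only [cellNormSq, vol, Real.norm_eq_abs, sq_abs]

theorem cone_subset_cell {K : D.Cell} {σ : D.Edge} (hσ : σ ∈ D.edgesOf K) :
    D.cone K σ ⊆ D.cell K :=
  (D.isStarCell hΩ K).cone_subset hσ

theorem pairwiseDisjoint_cone :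
    (D.pairs : Set (Σ _ : D.Cell, D.Edge)).PairwiseDisjoint fun p => D.cone p.1 p.2 := by
  rintro ⟨K, σ⟩ hσ ⟨L, τ⟩ hτ hne
  have hσK : σ ∈ D.edgesOf K := mem_pairs.1 hσ
  have hτL : τ ∈ D.edgesOf L := mem_pairs.1 hτ
  by_cases hKL : K = L
  · subst hKL
    exact (D.isStarCell hΩ K).cone_disjoint hσK hτL fun h => hne (congrArg (Sigma.mk K) h)
  · exact (D.cell_disjoint hKL).mono (D.cone_subset_cell hΩ hσK) (D.cone_subset_cell hΩ hτL)

theorem measurableSet_cone {p : Σ _ : D.Cell, D.Edge} (hp : p ∈ D.pairs) :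
    MeasurableSet (D.cone p.1 p.2) :=
  ((D.isStarCell hΩ p.1).isOpen_cone (mem_pairs.1 hp)).measurableSet

theorem gradD_eq_of_mem_cone (v : D.X) {K : D.Cell} {σ : D.Edge} (hσ : σ ∈ D.edgesOf K) {x : Pt d}
    (hx : x ∈ D.cone K σ) : D.gradD v x = D.gradKσ v K σ := by
  rw [gradD_eq_sum_pairs]
  exact sum_indicator_eq_of_mem (D.pairwiseDisjoint_cone hΩ)
    (fun p : Σ _ : D.Cell, D.Edge => D.gradKσ v p.1 p.2) (i := ⟨K, σ⟩) (mem_pairs.2 hσ) hx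

theorem stronglyMeasurable_gradD (v : D.X) : StronglyMeasurable (D.gradD v) := by
  rw [gradD_eq_sum_pairs]
  exact Finset.stronglyMeasurable_fun_sum _ fun p hp =>
    stronglyMeasurable_const.indicator (D.measurableSet_cone hΩ hp)

variable [NeZero d]

theorem normL2_gradD_le {T : ℝ} (hT : ∀ K, ∀ σ ∈ D.edgesOf K, D.diam K ≤ T * D.dist K σ)
    (v : D.X) : normL2 Ω (D.gradD v) ≤
      ENNReal.ofReal √((2 * d + 4 + 4 * T ^ 2 * d ^ 2) * D.seminormSq v) := by
  refine (eLpNorm_mono_measure _ Measure.restrict_le_self).trans ?_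
  rw [gradD_eq_sum_pairs, eLpNorm_sum_indicator_two (D.pairwiseDisjoint_cone hΩ)
    (fun p hp => D.measurableSet_cone hΩ hp) (fun p hp => (hΩ.subset ((D.cone_subset_cell hΩ
      (mem_pairs.1 hp)).trans (D.cell_subset p.1))).measure_lt_top.ne)]
  gcongr
  rw [pairs, Finset.sum_sigma, seminormSq, Finset.mul_sum]
  exact Finset.sum_le_sum fun K _ => D.sum_vol_cone_mul_norm_sq_le hΩ (hT K) v

section Consistency

variable {B : Finset D.Edge} {β : D.Edge → D.Cell → ℝ} {T : ℝ} (hT : D.IsRegular B β T)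
  (hβ : D.IsBarycentric B β) {R M : ℝ} (hR : Ω ⊆ Metric.closedBall 0 R) {u : Pt d → ℝ}
  (hM : IsTaylorBound u R M) (hu : Differentiable ℝ u)
  (h0 : ∀ σ ∈ D.extEdges, ∀ y ∈ D.edge σ, u y = 0)

include hT hβ hR hM hu h0

theorem norm_gradKσ_interpB_sub_le {K : D.Cell} {σ : D.Edge} (hσ : σ ∈ D.edgesOf K) :
    ‖D.gradKσ (D.interpB B β u) K σ - ∇ u (D.center K)‖ ≤ consistencyConst d T M * D.diam K := by
  refine (D.norm_gradKσ_sub_le hΩ (fun τ hτ => D.abs_interpB_sub_le hΩ hR hM hT hβ hu h0 hτ) hσ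
    (hT.diam_le K σ hσ)).trans_eq ?_
  rw [consistencyConst]
  ring

theorem norm_gradD_interpB_sub_le {K : D.Cell} {σ : D.Edge} (hσ : σ ∈ D.edgesOf K) {x : Pt d}
    (hx : x ∈ D.cone K σ) :
    ‖D.gradD (D.interpB B β u) x - ∇ u x‖ ≤ (consistencyConst d T M + M) * D.size := by
  have hC := consistencyConst_nonneg d (zero_le_one.trans hT.one_le) hM.nonneg
  have hM0 := hM.nonneg
  have hxK : x ∈ D.cell K := D.cone_subset_cell hΩ hσ hx
  have hgradient : ‖∇ u (D.center K) - ∇ u x‖ ≤ M * D.diam K := by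
    refine (hM.grad _ _ (mem_closedBall_zero_iff.1 (hR (D.cell_subset K hxK)))
      (D.norm_center_le hR K)).trans ?_
    gcongr
    exact D.norm_sub_le_diam hΩ (subset_closure (D.center_mem K)) (subset_closure hxK)
  rw [D.gradD_eq_of_mem_cone hΩ _ hσ hx]
  calc _ ≤ consistencyConst d T M * D.diam K + M * D.diam K :=
        (norm_sub_le_norm_sub_add_norm_sub _ (∇ u (D.center K)) _).trans
          (add_le_add (D.norm_gradKσ_interpB_sub_le hΩ hT hβ hR hM hu h0 hσ) hgradient)
    _ = (consistencyConst d T M + M) * D.diam K := by ring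
    _ ≤ _ := by
        gcongr
        exact D.diam_le_size K

theorem normL2_gradD_interpB_sub_le (hΩm : MeasurableSet Ω) :
    normL2 Ω (D.gradD (D.interpB B β u) - ∇ u) ≤ ENNReal.ofReal
      ((consistencyConst d T M + M) * D.size * √(volume.real Ω)) := by
  have : IsFiniteMeasure (volume.restrict Ω) :=
    isFiniteMeasure_restrict.2 hΩ.measure_lt_top.ne
  have hbound : ∀ᵐ x ∂(volume.restrict Ω), ‖(D.gradD (D.interpB B β u) - ∇ u) x‖ ≤
      (consistencyConst d T M + M) * D.size := by
    rw [ae_restrict_iff' hΩm]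
    filter_upwards [D.ae_mem_cone hΩ] with x hx hxΩ
    obtain ⟨K, σ, hσ, hxσ⟩ := hx hxΩ
    exact D.norm_gradD_interpB_sub_le hΩ hT hβ hR hM hu h0 hσ hxσ
  rw [← measureReal_restrict_apply_univ Ω]
  exact eLpNorm_two_le_of_ae_bound hbound

end Consistency

section WeakSolution

variable (hΩo : IsOpen Ω) {B : Finset D.Edge} {β : D.Edge → D.Cell → ℝ} {u f : Pt d → ℝ}
  (hu : ContDiff ℝ 2 u) (hw : IsWeakSolution Ω (idField d) f u)

include hΩo hu hw

theorem consErr_sushiFlux_le {T : ℝ} (hT : D.IsRegular B β T) (hβ : D.IsBarycentric B β)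
    {R M : ℝ} (hR : Ω ⊆ Metric.closedBall 0 R) (hM : IsTaylorBound u R M) :
    D.consErr B β (D.sushiFlux (idField d)) u ≤
      (consistencyConst d T M * (1 + √d * T + √d / d) + M) * √(d * volume.real Ω) * D.size := by
  have hT0 : 0 ≤ T := zero_le_one.trans hT.one_le
  have hC := consistencyConst_nonneg d hT0 hM.nonneg
  have hM0 := hM.nonneg
  have hu1 : ContDiff ℝ 1 u := hu.of_le one_le_two
  refine D.consErr_le hΩ (by positivity) fun K σ hσ => ?_
  refine D.abs_sushiFlux_add_le hΩ (hT.diam_le K) hσ hR (continuous_gradient hu1) hM fun τ hτ => ?_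
  exact D.norm_gradKσ_interpB_sub_le hΩ hT hβ hR hM (hu1.differentiable one_ne_zero)
    (fun σ hσ y hy => D.eq_zero_on_extEdge hΩo hΩ hu1 hw hσ hy) hτ

variable (hf : MemLp f 2 (volume.restrict Ω)) {α : ℝ} (hα : 0 < α) (hB : B ⊆ D.intEdges)
  {F : D.Fluxes} (hF : D.IsCoercive F α) {uD : D.X} (huD : D.IsSchemeSolution B β F f uD)

include hf hα hB hF huD

theorem sqrt_mul_seminormSq_le {C : ℝ} (hC : 0 ≤ C) :
    √(C * D.seminormSq (uD - D.interpB B β u)) ≤ √C / α * D.consErr B β F u := by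
  rw [Real.sqrt_mul hC, div_mul_eq_mul_div, mul_div_assoc]
  gcongr
  exact D.sqrt_seminormSq_sub_interpB_le hΩ hα hB hF (continuous_gradient (hu.of_le one_le_two))
    (D.integral_cell_eq hΩo hΩ hu hf hw) huD

theorem normL2_piM_sub_projM_le {R : ℝ} (hR : Ω ⊆ Metric.closedBall 0 R) :
    normL2 Ω (D.piM uD - D.projM u) ≤
      ENNReal.ofReal (√((4 * d + 4) * R ^ 2) / α * D.consErr B β F u) := by
  have hmem : D.MemXB B β (uD - D.interpB B β u) :=
    (D.submoduleXB B β).sub_mem huD.1 (D.memXB_interpB hB u)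
  rw [D.piM_sub_projM B β]
  refine (D.normL2_piM_le hΩ _).trans (ENNReal.ofReal_le_ofReal ?_)
  exact (Real.sqrt_le_sqrt (D.cellNormSq_le hR hmem.1)).trans
    (D.sqrt_mul_seminormSq_le hΩ hΩo hu hw hf hα hB hF huD (by positivity))

theorem normL2_gradD_sub_gradient_le {T : ℝ} (hT : D.IsRegular B β T) (hβ : D.IsBarycentric B β)
    {R M : ℝ} (hR : Ω ⊆ Metric.closedBall 0 R) (hM : IsTaylorBound u R M) :
    normL2 Ω (D.gradD uD - ∇ u) ≤ ENNReal.ofReal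
      (√(2 * d + 4 + 4 * T ^ 2 * d ^ 2) / α * D.consErr B β F u +
        (consistencyConst d T M + M) * D.size * √(volume.real Ω)) := by
  have hu1 : ContDiff ℝ 1 u := hu.of_le one_le_two
  have hsize := D.size_nonneg
  have hconsErr : 0 ≤ D.consErr B β F u := Real.sqrt_nonneg _
  have hC := consistencyConst_nonneg d (zero_le_one.trans hT.one_le) hM.nonneg
  have hM0 := hM.nonneg
  have hdecomp : D.gradD uD - ∇ u =
      D.gradD (uD - D.interpB B β u) + (D.gradD (D.interpB B β u) - ∇ u) := by
    rw [gradD_sub, sub_add_sub_cancel]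
  have hstable : normL2 Ω (D.gradD (uD - D.interpB B β u)) ≤
      ENNReal.ofReal (√(2 * d + 4 + 4 * T ^ 2 * d ^ 2) / α * D.consErr B β F u) :=
    (D.normL2_gradD_le hΩ hT.diam_le _).trans (ENNReal.ofReal_le_ofReal
      (D.sqrt_mul_seminormSq_le hΩ hΩo hu hw hf hα hB hF huD (by positivity)))
  have hconsistent := D.normL2_gradD_interpB_sub_le hΩ hT hβ hR hM
    (hu1.differentiable one_ne_zero)
    (fun σ hσ y hy => D.eq_zero_on_extEdge hΩo hΩ hu1 hw hσ hy) hΩo.measurableSet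
  rw [hdecomp, ENNReal.ofReal_add (by positivity) (by positivity)]
  exact (eLpNorm_add_le (D.stronglyMeasurable_gradD hΩ _).aestronglyMeasurable
    ((D.stronglyMeasurable_gradD hΩ _).aestronglyMeasurable.sub
      (continuous_gradient hu1).aestronglyMeasurable) one_le_two).trans
    (add_le_add hstable hconsistent)

end WeakSolution

end Bounded

end Discretisation

namespace Discretisation

variable {d : ℕ} [NeZero d] {Ω : Set (Pt d)} (hΩo : IsOpen Ω) (hΩ : Bornology.IsBounded Ω)

include hΩo hΩ

theorem exists_normL2_piM_sub_projM_le {α : ℝ} (hα : 0 < α) :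
    ∃ C : ℝ, 0 < C ∧ ∀ u f : Pt d → ℝ, ContDiff ℝ 2 u → MemLp f 2 (volume.restrict Ω) →
      IsWeakSolution Ω (idField d) f u →
      ∀ (D : Discretisation Ω) (B : Finset D.Edge) (β : D.Edge → D.Cell → ℝ),
        B ⊆ D.intEdges → ∀ F : D.Fluxes, D.IsCoercive F α →
          ∀ uD : D.X, D.IsSchemeSolution B β F f uD →
            normL2 Ω (D.piM uD - D.projM u) ≤ ENNReal.ofReal (C * D.consErr B β F u) := by
  obtain ⟨R, hRpos, hR⟩ := hΩ.subset_closedBall_lt 0 0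
  refine ⟨√((4 * d + 4) * R ^ 2) / α, by positivity, ?_⟩
  intro u f hu hf hw D B β hB F hF uD huD
  exact D.normL2_piM_sub_projM_le hΩ hΩo hu hw hf hα hB hF huD hR

section Smooth

variable {u : Pt d → ℝ} (hu : ContDiff ℝ 2 u) (θ : ℝ)

include hu

theorem exists_normL2_gradD_sub_gradient_le {α : ℝ} (hα : 0 < α) :
    ∃ C : ℝ, 0 < C ∧ ∀ f : Pt d → ℝ,
      MemLp f 2 (volume.restrict Ω) → IsWeakSolution Ω (idField d) f u →
      ∀ (D : Discretisation Ω) (B : Finset D.Edge) (β : D.Edge → D.Cell → ℝ),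
        B ⊆ D.intEdges → D.IsBarycentric B β → D.regB B β ≤ θ →
        ∀ F : D.Fluxes, D.IsCoercive F α →
          ∀ uD : D.X, D.IsSchemeSolution B β F f uD →
            normL2 Ω (D.gradD uD - ∇ u) ≤
              ENNReal.ofReal (C * (D.consErr B β F u + D.size)) := by
  obtain ⟨R, hR⟩ := hΩ.subset_closedBall 0
  obtain ⟨M, hM⟩ := exists_isTaylorBound hu R
  set T := max θ 1
  have hT0 : 0 ≤ T := zero_le_one.trans (le_max_right θ 1)
  have hM0 := hM.nonneg
  have hconst := consistencyConst_nonneg d hT0 hM0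
  set a := √(2 * d + 4 + 4 * T ^ 2 * d ^ 2) / α
  set b := (consistencyConst d T M + M) * √(volume.real Ω)
  have ha : 0 < a := by positivity
  have hb : 0 ≤ b := by positivity
  refine ⟨a + b, by positivity, fun f hf hw D B β hB hβ hθ F hF uD huD => ?_⟩
  have hT : D.IsRegular B β T := D.isRegular_of_regB_le hΩ hθ
  have hsize : 0 ≤ a * D.size := mul_nonneg ha.le D.size_nonneg
  have hconsErr : 0 ≤ b * D.consErr B β F u := mul_nonneg hb (Real.sqrt_nonneg _)
  refine (D.normL2_gradD_sub_gradient_le hΩ hΩo hu hw hf hα hB hF huD hT hβ hR hM).trans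
    (ENNReal.ofReal_le_ofReal ?_)
  linarith

theorem exists_consErr_sushiFlux_le : ∃ C : ℝ, 0 ≤ C ∧ ∀ f : Pt d → ℝ,
    IsWeakSolution Ω (idField d) f u →
    ∀ (D : Discretisation Ω) (B : Finset D.Edge) (β : D.Edge → D.Cell → ℝ),
      D.IsBarycentric B β → D.regB B β ≤ θ →
        D.consErr B β (D.sushiFlux (idField d)) u ≤ C * D.size := by
  obtain ⟨R, hR⟩ := hΩ.subset_closedBall 0
  obtain ⟨M, hM⟩ := exists_isTaylorBound hu R
  have hT0 : 0 ≤ max θ 1 := zero_le_one.trans (le_max_right θ 1)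
  have hM0 := hM.nonneg
  have hconst := consistencyConst_nonneg d hT0 hM0
  exact ⟨(consistencyConst d (max θ 1) M * (1 + √d * max θ 1 + √d / d) + M) *
    √(d * volume.real Ω), by positivity, fun f hw D B β hβ hθ =>
      D.consErr_sushiFlux_le hΩ hΩo hu hw (D.isRegular_of_regB_le hΩ hθ) hβ hR hM⟩

theorem exists_sushi_error_le :
    ∃ C : ℝ, 0 < C ∧ ∀ f : Pt d → ℝ,
      MemLp f 2 (volume.restrict Ω) → IsWeakSolution Ω (idField d) f u →
      ∀ (D : Discretisation Ω) (B : Finset D.Edge) (β : D.Edge → D.Cell → ℝ),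
        B ⊆ D.intEdges → D.IsBarycentric B β → D.regB B β ≤ θ →
          D.consErr B β (D.sushiFlux (idField d)) u ≤ C * D.size ∧
          (∃! w : D.X, D.IsSchemeSolution B β (D.sushiFlux (idField d)) f w) ∧
          ∀ uD : D.X, D.IsSchemeSolution B β (D.sushiFlux (idField d)) f uD →
            normL2 Ω (D.piM uD - D.projM u) ≤ ENNReal.ofReal (C * D.size) ∧
            normL2 Ω (D.gradD uD - ∇ u) ≤ ENNReal.ofReal (C * D.size) := by
  have hα : 0 < 1 / (2 + 2 * (max θ 1) ^ 2 * d : ℝ) := by positivity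
  obtain ⟨C₁, hC₁, hcell⟩ := exists_normL2_piM_sub_projM_le hΩo hΩ hα
  obtain ⟨C₂, hC₂, hgrad⟩ := exists_normL2_gradD_sub_gradient_le hΩo hΩ hu θ hα
  obtain ⟨C, hC, hconsErr⟩ := exists_consErr_sushiFlux_le hΩo hΩ hu θ
  refine ⟨max C (max (C₁ * C) (C₂ * (C + 1))), by positivity, ?_⟩
  intro f hf hw D B β hB hβ hθ
  have hF := D.isCoercive_sushiFlux hΩ (D.isRegular_of_regB_le hΩ hθ).diam_le
  have hE := hconsErr f hw D B β hβ hθ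
  have hsize := D.size_nonneg
  refine ⟨hE.trans ?_, D.existsUnique_schemeSolution hΩ hα B β hF f, fun uD huD =>
    ⟨(hcell u f hu hf hw D B β hB _ hF uD huD).trans (ENNReal.ofReal_le_ofReal ?_),
      (hgrad f hf hw D B β hB hβ hθ _ hF uD huD).trans (ENNReal.ofReal_le_ofReal ?_)⟩⟩
  · gcongr
    exact le_max_left _ _
  · calc C₁ * D.consErr B β (D.sushiFlux (idField d)) u ≤ C₁ * (C * D.size) := by gcongr
      _ = C₁ * C * D.size := by ring
      _ ≤ _ := by
        gcongr
        exact (le_max_left _ _).trans (le_max_right _ _)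
  · calc C₂ * (D.consErr B β (D.sushiFlux (idField d)) u + D.size) ≤
          C₂ * (C * D.size + D.size) := by gcongr
      _ = C₂ * (C + 1) * D.size := by ring
      _ ≤ _ := by
        gcongr
        exact (le_max_right _ _).trans (le_max_right _ _)

end Smooth

end Discretisation

end

theorem theorem4p2_general {d : ℕ} (hd : 0 < d) (Ω : Set (Pt d)) (hΩ_open : IsOpen Ω)
    (hΩ_bdd : Bornology.IsBounded Ω) (α θ : ℝ) (hα : 0 < α) :
    (∃ C₁ : ℝ, 0 < C₁ ∧ ∀ u f : Pt d → ℝ, ContDiff ℝ 2 u → MemLp f 2 (volume.restrict Ω) →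
      IsWeakSolution Ω (idField d) f u →
      ∀ (D : Discretisation Ω) (B : Finset D.Edge) (β : D.Edge → D.Cell → ℝ),
        B ⊆ D.intEdges → ∀ F : D.Fluxes, D.IsCoercive F α →
          (∃! w : D.X, D.IsSchemeSolution B β F f w) ∧
          ∀ uD : D.X, D.IsSchemeSolution B β F f uD →
            normL2 Ω (D.piM uD - D.projM u) ≤ ENNReal.ofReal (C₁ * D.consErr B β F u)) ∧
    (∀ u : Pt d → ℝ, ContDiff ℝ 2 u → ∃ C₂ : ℝ, 0 < C₂ ∧ ∀ f : Pt d → ℝ,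
      MemLp f 2 (volume.restrict Ω) → IsWeakSolution Ω (idField d) f u →
      ∀ (D : Discretisation Ω) (B : Finset D.Edge) (β : D.Edge → D.Cell → ℝ),
        B ⊆ D.intEdges → D.IsBarycentric B β → D.regB B β ≤ θ →
        ∀ F : D.Fluxes, D.IsCoercive F α →
          ∀ uD : D.X, D.IsSchemeSolution B β F f uD →
            normL2 Ω (D.gradD uD - ∇ u) ≤
              ENNReal.ofReal (C₂ * (D.consErr B β F u + D.size))) ∧
    (∀ u : Pt d → ℝ, ContDiff ℝ 2 u → ∃ C₃ : ℝ, 0 < C₃ ∧ ∀ f : Pt d → ℝ,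
      MemLp f 2 (volume.restrict Ω) → IsWeakSolution Ω (idField d) f u →
      ∀ (D : Discretisation Ω) (B : Finset D.Edge) (β : D.Edge → D.Cell → ℝ),
        B ⊆ D.intEdges → D.IsBarycentric B β → D.regB B β ≤ θ →
          D.consErr B β (D.sushiFlux (idField d)) u ≤ C₃ * D.size ∧
          (∃! w : D.X, D.IsSchemeSolution B β (D.sushiFlux (idField d)) f w) ∧
          ∀ uD : D.X, D.IsSchemeSolution B β (D.sushiFlux (idField d)) f uD →
            normL2 Ω (D.piM uD - D.projM u) ≤ ENNReal.ofReal (C₃ * D.size) ∧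
            normL2 Ω (D.gradD uD - ∇ u) ≤ ENNReal.ofReal (C₃ * D.size)) := by
  have : NeZero d := ⟨hd.ne'⟩
  obtain ⟨C₁, hC₁, hcell⟩ := Discretisation.exists_normL2_piM_sub_projM_le hΩ_open hΩ_bdd hα
  refine ⟨⟨C₁, hC₁, fun u f hu hf hw D B β hB F hF => ⟨?_, fun uD huD => ?_⟩⟩, fun u hu => ?_,
    fun u hu => ?_⟩
  · exact D.existsUnique_schemeSolution hΩ_bdd hα B β hF f
  · exact hcell u f hu hf hw D B β hB F hF uD huD
  · exact Discretisation.exists_normL2_gradD_sub_gradient_le hΩ_open hΩ_bdd hu θ hα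
  · exact Discretisation.exists_sushi_error_le hΩ_open hΩ_bdd hu θ

theorem theorem4p2 {d : ℕ} (hd : 0 < d) (Ω : Set (Pt d)) (hΩ_open : IsOpen Ω)
    (hΩ_bdd : Bornology.IsBounded Ω) (hΩ_conn : IsConnected Ω) (hΩ_poly : IsPolyhedral Ω)
    (α θ : ℝ) (hα : 0 < α) :
    -- well-posedness of the scheme and error estimate for the solution
    (∃ C₁ : ℝ, 0 < C₁ ∧ ∀ u f : Pt d → ℝ, ContDiff ℝ 2 u → MemLp f 2 (volume.restrict Ω) →
      IsWeakSolution Ω (idField d) f u →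
      ∀ (D : Discretisation Ω) (B : Finset D.Edge) (β : D.Edge → D.Cell → ℝ),
        B ⊆ D.intEdges → D.IsBarycentric B β → D.regB B β ≤ θ →
        ∀ F : D.Fluxes, D.IsCoercive F α →
          (∃! w : D.X, D.IsSchemeSolution B β F f w) ∧
          ∀ uD : D.X, D.IsSchemeSolution B β F f uD →
            normL2 Ω (D.piM uD - D.projM u) ≤ ENNReal.ofReal (C₁ * D.consErr B β F u)) ∧
    -- error estimate for the gradient
    (∀ u : Pt d → ℝ, ContDiff ℝ 2 u → ∃ C₂ : ℝ, 0 < C₂ ∧ ∀ f : Pt d → ℝ,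
      MemLp f 2 (volume.restrict Ω) → IsWeakSolution Ω (idField d) f u →
      ∀ (D : Discretisation Ω) (B : Finset D.Edge) (β : D.Edge → D.Cell → ℝ),
        B ⊆ D.intEdges → D.IsBarycentric B β → D.regB B β ≤ θ →
        ∀ F : D.Fluxes, D.IsCoercive F α →
          ∀ uD : D.X, D.IsSchemeSolution B β F f uD →
            normL2 Ω (D.gradD uD - ∇ u) ≤
              ENNReal.ofReal (C₂ * (D.consErr B β F u + D.size))) ∧
    -- first order convergence for the SUSHI fluxes
    (∀ u : Pt d → ℝ, ContDiff ℝ 2 u → ∃ C₃ : ℝ, 0 < C₃ ∧ ∀ f : Pt d → ℝ,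
      MemLp f 2 (volume.restrict Ω) → IsWeakSolution Ω (idField d) f u →
      ∀ (D : Discretisation Ω) (B : Finset D.Edge) (β : D.Edge → D.Cell → ℝ),
        B ⊆ D.intEdges → D.IsBarycentric B β → D.regB B β ≤ θ →
          D.consErr B β (D.sushiFlux (idField d)) u ≤ C₃ * D.size ∧
          (∃! w : D.X, D.IsSchemeSolution B β (D.sushiFlux (idField d)) f w) ∧
          ∀ uD : D.X, D.IsSchemeSolution B β (D.sushiFlux (idField d)) f uD →
            normL2 Ω (D.piM uD - D.projM u) ≤ ENNReal.ofReal (C₃ * D.size) ∧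
            normL2 Ω (D.gradD uD - ∇ u) ≤ ENNReal.ofReal (C₃ * D.size)) := by
  obtain ⟨⟨C₁, hC₁, h⟩, hsushi⟩ := theorem4p2_general hd Ω hΩ_open hΩ_bdd α θ hα
  exact ⟨⟨C₁, hC₁, fun u f hu hf hw D B β hB _ _ => h u f hu hf hw D B β hB⟩, hsushi⟩
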